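/- Let $f:\mathbb R^p\to\mathbb R$ be convex and differentiable with $L_f$-Lipschitz gradient, let $h:\mathbb R^l\to(-\infty,\infty]$ be closed, proper and convex with convex conjugate $h^*$, and let $K,A,B\in\mathbb R^{l\times p}$. Put $\mathcal L(x,y)=f(x)+\langle Kx,y\rangle-h^*(y)$. Let $X\subset\mathbb R^p$, $Y\subset\mathbb R^l$ and $\Omega_X,\Omega_Y>0$ satisfy $\sup_{x,x'\in X}\|x-x'\|_2^2\le 2\Omega_X^2$ and $\sup_{y,y'\in Y}\|y-y'\|_2^2\le 2\Omega_Y^2$, and let $\mathcal G^\star(\tilde x,\tilde y)=\sup_{(x,y)\in X\times Y}\big(\mathcal L(\tilde x,y)-\mathcal L(x,\tilde y)\big)$ be the duality gap. **Parameters.** Let $\tau_k,\sigma_k>0$ ($k\ge1$), $\rho_1=1$, $\rho_{k+1}^{-1}-1=\rho_k^{-1}\theta_{k+1}$ for $k\ge1$, and, for $k\ge2$, $0<\theta_k\le\min(\tau_{k-1}/\tau_k,\sigma_{k-1}/\sigma_k)$ and $\max(\tau_{k-1}/\tau_k,\sigma_{k-1}/\sigma_k)\le1$. Suppose that for some $q,r,s,t\in(0,1)$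 and all $k\ge1$ $$\frac{s-q}{\tau_k}-L_f\rho_k-\frac{\|A\|_2^2\sigma_k}{r}\ge0,\qquad \frac{t-r}{\sigma_k}-\tau_k\Big(2\|K+A\|_2\|K+B\|_2+\frac{\|B\|_2^2}{q}\Big)\ge0 .$$ Let $\gamma_1=1$ and $\gamma_k=\theta_k^{-1}\gamma_{k-1}$ for $k\ge2$. **Algorithm.** Start from deterministic $\tilde x^0=\tilde x^1$, $\tilde y^0=\tilde y^1$. A hat denotes the random answer of a stochastic oracle to a query: $\hat{\mathcal F}(x)$ estimates $\nabla f(x)$, and $\hat{\mathcal K}_x(x),\hat{\mathcal K}_y(y),\hat{\mathcal A}(x),\hat{\mathcal B}(y)$ estimate $Kx,K^Ty,Ax,B^Ty$. For $k\ge1$: $$\begin{aligned} x_{md}^k&=(1-\rho_k)x^k+\rho_k\tilde x^k,\\ w^k&=\hat{\mathcal F}(x_{md}^k)+\hat{\mathcal K}_y\Big(\tilde y^k+\tfrac{\theta_k\tau_{k-1}}{\tau_k}(\tilde y^k-\tilde y^{k-1})\Big)+\hat{\mathcal B}\Big(\theta_k\big(\tfrac{\tau_{k-1}}{\tau_k}-1\big)(\tilde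 y^k-\tilde y^{k-1})\Big),\\ \tilde u^{k+1}&=\hat{\mathcal K}_x(\tilde x^k-\tau_kw^k)-\hat{\mathcal A}\big(\theta_k(\tilde x^k-\tilde x^{k-1})+\tau_kw^k\big),\\ \tilde y^{k+1}&=\operatorname{prox}_{\sigma_kh^*}(\tilde y^k+\sigma_k\tilde u^{k+1}),\\ \tilde v^{k+1}&=\hat{\mathcal K}_y(\tilde y^{k+1})+\hat{\mathcal B}\big(\tilde y^{k+1}-\tilde y^k-\theta_k(\tilde y^k-\tilde y^{k-1})\big),\\ \tilde x^{k+1}&=\tilde x^k-\tau_k\big(\hat{\mathcal F}(x_{md}^k)+\tilde v^{k+1}\big),\\ x^{k+1}&=(1-\rho_k)x^k+\rho_k\tilde x^{k+1},\qquad y^{k+1}=(1-\rho_k)y^k+\rho_k\tilde y^{k+1}. \end{aligned}$$ In each iteration $\hat{\mathcal F}(x^k_{md})$ is called once and its answer is used twice; each other displayed oracle expression is a separate call. Every answer is unbiased conditionally on all answers given before it. Assume that almost surely $\tilde x^k\in X$ and $\tilde y^k\in Y$ for all $k\ge1$. **(i)** Suppose the errors (answer minus estimated vector) of $\hat{\mathcal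 F},\hat{\mathcal K}_y,\hat{\mathcal K}_x,\hat{\mathcal A},\hat{\mathcal B}$ in all these calls have second moments $\mathbb E\|\cdot\|^2$ at most $\chi_{x,f}^2,\chi_{x,K}^2,\chi_y^2,\chi_A^2,\chi_B^2$, respectively, and let $\chi_x=\sqrt{\chi_{x,f}^2+\chi_{x,K}^2}$. Then, for all $k\ge1$, $\mathcal G^\star(z^{k+1})$ with $z^{k+1}=(x^{k+1},y^{k+1})$ is almost surely finite and integrable, and $\mathbb E[\mathcal G^\star(z^{k+1})]\le\mathcal Q_0(k)$, where $$\begin{aligned}\mathcal Q_0(k)={}&\frac{\rho_k}{\gamma_k}\Big(\frac{2\gamma_k}{\tau_k}\Omega_X^2+\frac{2\gamma_k}{\sigma_k}\Omega_Y^2\Big)+\frac{\rho_k}{2\gamma_k}\sum_{i=1}^k\Big(\frac{(2-s)\tau_i\gamma_i}{1-s}(\chi_x^2+\chi_B^2)\\&+\frac{(2-t)\sigma_i\gamma_i}{1-t}\big(\chi_y^2+\chi_A^2+\tau_k^2\|K+A\|_2^2(\chi_x^2+\chi_B^2)\big)\Big).\end{aligned}$$ **(ii)** Suppose $A=-K$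 and $B=bK$ with $b\in\mathbb R$, and that the algorithm is run with one call for each of $\tilde u^{k+1}$, $\tilde v^{k+1}$, namely $$\tilde u^{k+1}=\hat{\mathcal K}_x\big(\tilde x^k+\theta_k(\tilde x^k-\tilde x^{k-1})\big),\qquad \tilde v^{k+1}=\hat{\mathcal K}_y\big(\tilde y^{k+1}+b(\tilde y^{k+1}-\tilde y^k-\theta_k(\tilde y^k-\tilde y^{k-1}))\big),$$ the other steps being unchanged. Suppose that for some $\chi_{x,f},\chi_{x,K},\chi_y>0$ the errors $\Delta$ of the answers of $\hat{\mathcal F},\hat{\mathcal K}_y,\hat{\mathcal K}_x$ satisfy, conditionally on all earlier answers, $\mathbb E[\exp(\|\Delta\|^2/\chi^2)]\le e$ with $\chi=\chi_{x,f},\chi_{x,K},\chi_y$, respectively. Then for all $k\ge1$ and $\lambda>0$ $$\mathbb P\big(\mathcal G^\star(z^{k+1})>\mathcal Q_0'(k)+\lambda\mathcal Q_1(k)\big)\le3e^{-\lambda^2/3}+3e^{-\lambda},$$ where $$\mathcal Q_0'(k)=\frac{\rho_k}{\gamma_k}\Big(\frac{2\gamma_k}{\tau_k}\Omega_X^2+\frac{2\gamma_k}{\sigma_k}\Omega_Y^2\Big)+\frac{\rho_k}{2\gamma_k}\sum_{i=1}^k\Big(\frac{(2-s)\tau_i\gamma_i}{1-s}\chi_x^2+\frac{(2-t)\sigma_i\gamma_i}{1-t}\chi_y^2\Big),$$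 $$\mathcal Q_1(k)=\frac{\rho_k}{\gamma_k}\big(\sqrt2\,\chi_x\Omega_X+\chi_y\Omega_Y\big)\sqrt{2\sum_{i=1}^k\gamma_i^2}+\frac{\rho_k}{2\gamma_k}\sum_{i=1}^k\Big(\frac{(2-s)\tau_i\gamma_i}{1-s}\chi_x^2+\frac{(2-t)\sigma_i\gamma_i}{1-t}\chi_y^2\Big).$$ -/

import Mathlib

open MeasureTheory
open scoped InnerProductSpace NNReal ENNReal

/-- `ℝⁿ` with the Euclidean norm. -/
abbrev Vec (n : ℕ) : Type := EuclideanSpace ℝ (Fin n)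

namespace StocPD

noncomputable section

/-! ### The saddle point problem -/

/-- Closed, proper, convex functions `h : ℝˡ → (-∞, ∞]`. -/
structure ClosedProperConvex {l : ℕ} (h : Vec l → EReal) : Prop where
  ne_bot : ∀ u, h u ≠ ⊥
  exists_ne_top : ∃ u, h u ≠ ⊤
  closed : LowerSemicontinuous h
  convex_epigraph : Convex ℝ {w : Vec l × ℝ | h w.1 ≤ (w.2 : EReal)}

/-- The convex conjugate `h*(v) = sup_u ⟨u, v⟩ - h(u)`. -/
def conjugate {l : ℕ} (h : Vec l → EReal) (v : Vec l) : EReal :=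
  ⨆ u : Vec l, ((⟪u, v⟫_ℝ : ℝ) : EReal) - h u

/-- `y = prox_{c φ}(v)`, i.e. `y` minimizes `c φ(y') + ½ ‖y' - v‖²` over `y'`. -/
def IsProx {l : ℕ} (c : ℝ) (φ : Vec l → EReal) (v y : Vec l) : Prop :=
  IsMinOn (fun y' : Vec l => (c : EReal) * φ y' + ((1 / 2 * ‖y' - v‖ ^ 2 : ℝ) : EReal))
    Set.univ y

/-- The saddle function `ℒ(x, y) = f(x) + ⟨K x, y⟩ - h*(y)`. -/
def saddle {p l : ℕ} (f : Vec p → ℝ) (h : Vec l → EReal) (K : Vec p →L[ℝ] Vec l)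
    (x : Vec p) (y : Vec l) : EReal :=
  ((f x + ⟪K x, y⟫_ℝ : ℝ) : EReal) - conjugate h y

/-- The duality gap `𝒢⋆(x̃, ỹ) = sup_{(x, y) ∈ X × Y} ℒ(x̃, y) - ℒ(x, ỹ)`. -/
def dualityGap {p l : ℕ} (f : Vec p → ℝ) (h : Vec l → EReal) (K : Vec p →L[ℝ] Vec l)
    (X : Set (Vec p)) (Y : Set (Vec l)) (x' : Vec p) (y' : Vec l) : EReal :=
  ⨆ x ∈ X, ⨆ y ∈ Y, saddle f h K x' y - saddle f h K x y'

/-! ### Parameters; only the indices `k ≥ 1` matter -/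

/-- The weights `γ₁ = 1`, `γ_k = θ_k⁻¹ γ_{k-1}` for `k ≥ 2`. -/
def gam (θ : ℕ → ℝ) : ℕ → ℝ
  | 0 => 1
  | 1 => 1
  | k + 2 => (θ (k + 2))⁻¹ * gam θ (k + 1)

/-- The conditions on `ρ_k, θ_k, τ_k, σ_k` that do not involve `f, K, A, B`. -/
structure StepSizes (ρ θ τ σ : ℕ → ℝ) : Prop where
  tau_pos : ∀ k, 1 ≤ k → 0 < τ k
  sigma_pos : ∀ k, 1 ≤ k → 0 < σ k
  rho_one : ρ 1 = 1
  rho_succ : ∀ k, 1 ≤ k → (ρ (k + 1))⁻¹ - 1 = (ρ k)⁻¹ * θ (k + 1)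
  theta_pos : ∀ k, 2 ≤ k → 0 < θ k
  theta_le : ∀ k, 2 ≤ k → θ k ≤ min (τ (k - 1) / τ k) (σ (k - 1) / σ k)
  ratio_le : ∀ k, 2 ≤ k → max (τ (k - 1) / τ k) (σ (k - 1) / σ k) ≤ 1

/-- The two coupling inequalities between step sizes, `L_f` and the operators. -/
structure Coupling {p l : ℕ} (K A B : Vec p →L[ℝ] Vec l) (Lf : ℝ) (q r s t : ℝ)
    (ρ τ σ : ℕ → ℝ) : Prop where
  primal : ∀ k, 1 ≤ k → 0 ≤ (s - q) / τ k - Lf * ρ k - ‖A‖ ^ 2 * σ k / r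
  dual : ∀ k, 1 ≤ k →
    0 ≤ (t - r) / σ k - τ k * (2 * ‖K + A‖ * ‖K + B‖ + ‖B‖ ^ 2 / q)

/-! ### Stochastic oracle calls

`𝓕 i` is the information available right before the call number `i`; the call asks for the
vector `target` (a linear map or `∇f`, at a point computed from earlier information) and is
answered by the random vector `ans`. -/

section Oracle

variable {Ω : Type*} {mΩ : MeasurableSpace Ω} {ι : Type*} [Preorder ι] {n : ℕ}

/-- The answer becomes part of the later information and is conditionally unbiased given
everything that happened before the call. -/
structure UnbiasedCall (μ : Measure Ω) (𝓕 : Filtration ι mΩ) (i : ι)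
    (target ans : Ω → Vec n) : Prop where
  known_later : ∀ j, i < j → Measurable[𝓕 j] ans
  integrable : Integrable (fun ω => ans ω - target ω) μ
  unbiased : μ[fun ω => ans ω - target ω | 𝓕 i] =ᵐ[μ] 0

/-- An unbiased call with `E ‖ans - target‖² ≤ χ²`. -/
structure BoundedVarianceCall (μ : Measure Ω) (𝓕 : Filtration ι mΩ) (χ : ℝ) (i : ι)
    (target ans : Ω → Vec n) : Prop extends UnbiasedCall μ 𝓕 i target ans where
  variance_le : ∫⁻ ω, ‖ans ω - target ω‖ₑ ^ 2 ∂μ ≤ ENNReal.ofReal (χ ^ 2)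

/-- An unbiased call with `E [exp (‖ans - target‖² / χ²) | past] ≤ exp 1`. -/
structure LightTailCall (μ : Measure Ω) (𝓕 : Filtration ι mΩ) (χ : ℝ) (i : ι)
    (target ans : Ω → Vec n) : Prop extends UnbiasedCall μ 𝓕 i target ans where
  integrable_exp : Integrable (fun ω => Real.exp (‖ans ω - target ω‖ ^ 2 / χ ^ 2)) μ
  tail_le : ∀ᵐ ω ∂μ,
    (μ[fun ω => Real.exp (‖ans ω - target ω‖ ^ 2 / χ ^ 2) | 𝓕 i]) ω ≤ Real.exp 1

end Oracle

/-! ### The algorithm -/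

/-- The iterates `x^k, x̃^k, y^k, ỹ^k`. -/
structure Iterates (Ω : Type*) (p l : ℕ) where
  x : ℕ → Ω → Vec p
  xt : ℕ → Ω → Vec p
  y : ℕ → Ω → Vec l
  yt : ℕ → Ω → Vec l

variable {Ω : Type*} {p l : ℕ}

namespace Iterates

/-- `x_md^k = (1 - ρ_k) x^k + ρ_k x̃^k`. -/
def xmd (Z : Iterates Ω p l) (ρ : ℕ → ℝ) (k : ℕ) (ω : Ω) : Vec p :=
  (1 - ρ k) • Z.x k ω + ρ k • Z.xt k ω

/-- `x̃^k - x̃^{k-1}`. -/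
def dx (Z : Iterates Ω p l) (k : ℕ) (ω : Ω) : Vec p := Z.xt k ω - Z.xt (k - 1) ω

/-- `ỹ^k - ỹ^{k-1}`. -/
def dy (Z : Iterates Ω p l) (k : ℕ) (ω : Ω) : Vec l := Z.yt k ω - Z.yt (k - 1) ω

/-- The update of the iterates in each iteration `k ≥ 1`, driven by the estimate `g k` of
`∇f(x_md^k)` and by `u k = ũ^{k+1}`, `v k = ṽ^{k+1}`. The starting point `(x̃¹, ỹ¹)` is
deterministic and `x̃⁰ = x̃¹`, `ỹ⁰ = ỹ¹`. (As `ρ₁ = 1`, the values of `x¹, y¹` are irrelevant.) -/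
structure Driven (Z : Iterates Ω p l) (h : Vec l → EReal) (ρ τ σ : ℕ → ℝ)
    (g : ℕ → Ω → Vec p) (u : ℕ → Ω → Vec l) (v : ℕ → Ω → Vec p) : Prop where
  xt_one : ∃ c, ∀ ω, Z.xt 1 ω = c
  yt_one : ∃ c, ∀ ω, Z.yt 1 ω = c
  xt_zero : ∀ ω, Z.xt 0 ω = Z.xt 1 ω
  yt_zero : ∀ ω, Z.yt 0 ω = Z.yt 1 ω
  yt_succ : ∀ k, 1 ≤ k → ∀ ω,
    IsProx (σ k) (conjugate h) (Z.yt k ω + σ k • u k ω) (Z.yt (k + 1) ω)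
  xt_succ : ∀ k, 1 ≤ k → ∀ ω,
    Z.xt (k + 1) ω = Z.xt k ω - τ k • (g k ω + v k ω)
  x_succ : ∀ k, 1 ≤ k → ∀ ω,
    Z.x (k + 1) ω = (1 - ρ k) • Z.x k ω + ρ k • Z.xt (k + 1) ω
  y_succ : ∀ k, 1 ≤ k → ∀ ω,
    Z.y (k + 1) ω = (1 - ρ k) • Z.y k ω + ρ k • Z.yt (k + 1) ω

/-- Almost surely all `x̃^k` lie in `X` and all `ỹ^k` in `Y`. -/
def StaysIn {mΩ : MeasurableSpace Ω} (Z : Iterates Ω p l) (μ : Measure Ω)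
    (X : Set (Vec p)) (Y : Set (Vec l)) : Prop :=
  ∀ᵐ ω ∂μ, ∀ k, 1 ≤ k → Z.xt k ω ∈ X ∧ Z.yt k ω ∈ Y

end Iterates

/-- The answers of the oracles `F̂, 𝒦̂_x, 𝒦̂_y, Â, B̂` in each iteration `k`. There are two calls
of each of `𝒦̂_y` and `B̂`, one for `v̄_k` and one (primed) for `ṽ^{k+1}`. -/
structure Answers (Ω : Type*) (p l : ℕ) where
  F : ℕ → Ω → Vec p
  Ky : ℕ → Ω → Vec p
  B : ℕ → Ω → Vec p
  Kx : ℕ → Ω → Vec l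
  A : ℕ → Ω → Vec l
  Ky' : ℕ → Ω → Vec p
  B' : ℕ → Ω → Vec p

/-- `w_k = F̂(x_md^k) + v̄_k`, where `v̄_k` is the sum of the first answers of `𝒦̂_y` and `B̂`. -/
def Answers.w (O : Answers Ω p l) (k : ℕ) (ω : Ω) : Vec p :=
  O.F k ω + (O.Ky k ω + O.B k ω)

/-- A run of the stochastic algorithm with bounded-variance oracles; `(k, j)` is the number of the
call `j` in the iteration `k`, in the order of time. In
`ũ^{k+1} = 𝒦̂_x(x̃^k) - θ_k Â(x̃^k - x̃^{k-1}) - τ_k (𝒦̂_x + Â)(w_k)`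
the terms with the same oracle are one call, i.e.
`ũ^{k+1} = 𝒦̂_x(x̃^k - τ_k w_k) - Â(θ_k (x̃^k - x̃^{k-1}) + τ_k w_k)`. -/
structure Run {mΩ : MeasurableSpace Ω} (μ : Measure Ω) (𝓕 : Filtration (ℕ ×ₗ Fin 7) mΩ)
    (f : Vec p → ℝ) (h : Vec l → EReal) (K A B : Vec p →L[ℝ] Vec l) (ρ θ τ σ : ℕ → ℝ)
    (χf χK χy χA χB : ℝ) (Z : Iterates Ω p l) (O : Answers Ω p l) : Prop where
  /-- `F̂(x_md^k)` -/
  call_F : ∀ k, 1 ≤ k → BoundedVarianceCall μ 𝓕 χf (toLex (k, 0))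
    (fun ω => gradient f (Z.xmd ρ k ω)) (O.F k)
  /-- `𝒦̂_y(ỹ^k + (θ_k τ_{k-1} / τ_k) (ỹ^k - ỹ^{k-1}))` -/
  call_Ky : ∀ k, 1 ≤ k → BoundedVarianceCall μ 𝓕 χK (toLex (k, 1))
    (fun ω => K.adjoint (Z.yt k ω + (θ k * τ (k - 1) / τ k) • Z.dy k ω)) (O.Ky k)
  /-- `B̂(θ_k (τ_{k-1} / τ_k - 1) (ỹ^k - ỹ^{k-1}))` -/
  call_B : ∀ k, 1 ≤ k → BoundedVarianceCall μ 𝓕 χB (toLex (k, 2))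
    (fun ω => B.adjoint ((θ k * (τ (k - 1) / τ k - 1)) • Z.dy k ω)) (O.B k)
  /-- `𝒦̂_x(x̃^k - τ_k w_k)` -/
  call_Kx : ∀ k, 1 ≤ k → BoundedVarianceCall μ 𝓕 χy (toLex (k, 3))
    (fun ω => K (Z.xt k ω - τ k • O.w k ω)) (O.Kx k)
  /-- `Â(θ_k (x̃^k - x̃^{k-1}) + τ_k w_k)` -/
  call_A : ∀ k, 1 ≤ k → BoundedVarianceCall μ 𝓕 χA (toLex (k, 4))
    (fun ω => A (θ k • Z.dx k ω + τ k • O.w k ω)) (O.A k)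
  /-- `𝒦̂_y(ỹ^{k+1})` -/
  call_Ky' : ∀ k, 1 ≤ k → BoundedVarianceCall μ 𝓕 χK (toLex (k, 5))
    (fun ω => K.adjoint (Z.yt (k + 1) ω)) (O.Ky' k)
  /-- `B̂(ỹ^{k+1} - ỹ^k - θ_k (ỹ^k - ỹ^{k-1}))` -/
  call_B' : ∀ k, 1 ≤ k → BoundedVarianceCall μ 𝓕 χB (toLex (k, 6))
    (fun ω => B.adjoint (Z.dy (k + 1) ω - θ k • Z.dy k ω)) (O.B' k)
  /-- the updates, with `ũ^{k+1}` and `ṽ^{k+1}` assembled from the answers -/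
  driven : Z.Driven h ρ τ σ O.F (fun k ω => O.Kx k ω - O.A k ω)
    (fun k ω => O.Ky' k ω + O.B' k ω)

/-- The answers of the oracles `F̂, 𝒦̂_x, 𝒦̂_y` in each iteration `k`, in the special case `A = -K`,
`B = b K`. -/
structure SimpleAnswers (Ω : Type*) (p l : ℕ) where
  F : ℕ → Ω → Vec p
  Kx : ℕ → Ω → Vec l
  Ky : ℕ → Ω → Vec p

/-- A run of the stochastic algorithm for `A = -K`, `B = b K` with light-tailed oracles. Here
`Â = -𝒦̂_x`, `B̂ = b 𝒦̂_y`, and `ũ^{k+1}`, `ṽ^{k+1}` are one call each: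
`ũ^{k+1} = 𝒦̂_x(x̃^k + θ_k (x̃^k - x̃^{k-1}))` and
`ṽ^{k+1} = 𝒦̂_y(ỹ^{k+1} + b (ỹ^{k+1} - ỹ^k - θ_k (ỹ^k - ỹ^{k-1})))`. -/
structure SimpleRun {mΩ : MeasurableSpace Ω} (μ : Measure Ω)
    (𝓕 : Filtration (ℕ ×ₗ Fin 3) mΩ)
    (f : Vec p → ℝ) (h : Vec l → EReal) (K : Vec p →L[ℝ] Vec l) (b : ℝ) (ρ θ τ σ : ℕ → ℝ)
    (χf χK χy : ℝ) (Z : Iterates Ω p l) (O : SimpleAnswers Ω p l) : Prop where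
  call_F : ∀ k, 1 ≤ k → LightTailCall μ 𝓕 χf (toLex (k, 0))
    (fun ω => gradient f (Z.xmd ρ k ω)) (O.F k)
  call_Kx : ∀ k, 1 ≤ k → LightTailCall μ 𝓕 χy (toLex (k, 1))
    (fun ω => K (Z.xt k ω + θ k • Z.dx k ω)) (O.Kx k)
  call_Ky : ∀ k, 1 ≤ k → LightTailCall μ 𝓕 χK (toLex (k, 2))
    (fun ω => K.adjoint (Z.yt (k + 1) ω + b • (Z.dy (k + 1) ω - θ k • Z.dy k ω))) (O.Ky k)
  driven : Z.Driven h ρ τ σ O.F O.Kx O.Ky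

/-! ### The bounds -/

/-- `χ_x = √(χ_{x,f}² + χ_{x,K}²)`. -/
def chiX (χf χK : ℝ) : ℝ := √(χf ^ 2 + χK ^ 2)

/-- `(ρ_k / γ_k) (2 γ_k Ω_X² / τ_k + 2 γ_k Ω_Y² / σ_k)`. -/
def diamTerm (ρ θ τ σ : ℕ → ℝ) (ΩX ΩY : ℝ) (k : ℕ) : ℝ :=
  ρ k / gam θ k * (2 * gam θ k / τ k * ΩX ^ 2 + 2 * gam θ k / σ k * ΩY ^ 2)

/-- `(ρ_k / (2 γ_k)) ∑_{i=1}^k ((2-s) τ_i γ_i / (1-s) · vx + (2-t) σ_i γ_i / (1-t) · vy)`. -/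
def noiseTerm (ρ θ τ σ : ℕ → ℝ) (s t vx vy : ℝ) (k : ℕ) : ℝ :=
  ρ k / (2 * gam θ k) * ∑ i ∈ Finset.Icc 1 k,
    ((2 - s) * τ i * gam θ i / (1 - s) * vx + (2 - t) * σ i * gam θ i / (1 - t) * vy)

/-- `𝒬₀(k)`; `κ` is `‖K + A‖`. -/
def Q0 (ρ θ τ σ : ℕ → ℝ) (ΩX ΩY s t χf χK χy χA χB κ : ℝ) (k : ℕ) : ℝ :=
  diamTerm ρ θ τ σ ΩX ΩY k +
    noiseTerm ρ θ τ σ s t (chiX χf χK ^ 2 + χB ^ 2)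
      (χy ^ 2 + χA ^ 2 + τ k ^ 2 * κ ^ 2 * (chiX χf χK ^ 2 + χB ^ 2)) k

/-- `𝒬₀'(k)`. -/
def Q0' (ρ θ τ σ : ℕ → ℝ) (ΩX ΩY s t χf χK χy : ℝ) (k : ℕ) : ℝ :=
  diamTerm ρ θ τ σ ΩX ΩY k + noiseTerm ρ θ τ σ s t (chiX χf χK ^ 2) (χy ^ 2) k

/-- `𝒬₁(k)`. -/
def Q1 (ρ θ τ σ : ℕ → ℝ) (ΩX ΩY s t χf χK χy : ℝ) (k : ℕ) : ℝ :=
  ρ k / gam θ k * (√2 * chiX χf χK * ΩX + χy * ΩY) * √(2 * ∑ i ∈ Finset.Icc 1 k, gam θ i ^ 2) +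
    noiseTerm ρ θ τ σ s t (chiX χf χK ^ 2) (χy ^ 2) k

end

end StocPD

/-! Fix one outcome. Inserting the update of `x̃` into `ũ^{k+1}` turns the algorithm into a
deterministic iteration with additive errors (`NoisyIteration`). The answer of `F̂` enters both
`w^k` and `x̃^{k+1}`, so its error cancels in the dual step, and the remaining mismatch there is `(K
+ A)(K + B)ᵀ` applied to increments of `ỹ`. Convexity at `x_md`, the descent lemma and the first
order condition of the proximal map bound the gap against any fixed `(x, y)` by differences of
squared distances, differences of a coupling term, cross terms of consecutive increments, and
errors.

With the weights `γ_k` the recursion telescopes, since `γ_{k+1} θ_{k+1} = γ_k`. As `γ_k/τ_k` and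
`γ_k/σ_k` increase and all distances are bounded, the squared distances sum to diameter terms. The
coupling inequalities pay for the cross terms and leave the fractions `1 - s` and `1 - t` of the
quadratic terms to the errors. This is `NoisyIteration.gapAt_le`.

An error is paired with `x̃^{k+1} - x`. Moving from `x̃^{k+1}` back to the earlier `x̃^k` costs `τ_k
‖δ‖² / (2(1 - s))` by Young's inequality, and the product with `x̃^k` is centered. What remains is
linear in `x` and has to be bounded uniformly, because the gap is a supremum. The dual side is
alike, except that errors made after `ỹ^{k+1}` need no move.

For (i) the linear part is the support function of `X` at the accumulated error. Symmetrization
(`integral_suppFun_le`) bounds its mean by a diameter term and the second moment of a martingale.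
For (ii) a pathwise bound is needed: a projected reference sequence (`exists_reference`) competes
with all `x` at once and leaves three martingales, treated by Azuma's inequality
(`measure_lt_sum_le`), and a weighted sum of squared errors, treated by Jensen and Markov
(`measure_lt_weighted_sum_le`). Either way the uniform bound costs a second diameter term and a
further `τ_i/2` per squared error, and `1/(1 - s) + 1 = (2 - s)/(1 - s)`. -/

namespace StocPD

noncomputable section

/-! ### The convex conjugate -/

section Conjugate

variable {l : ℕ} {h : Vec l → EReal}

theorem conjugate_le_coe_iff (hb : ∀ u, h u ≠ ⊥) {v : Vec l} {M : ℝ} :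
    conjugate h v ≤ (M : EReal) ↔ ∀ u (c : ℝ), h u = (c : EReal) → ⟪u, v⟫_ℝ - c ≤ M := by
  unfold conjugate
  rw [iSup_le_iff]
  constructor
  · intro H u c hc
    have := H u
    rw [hc, ← EReal.coe_sub] at this
    exact_mod_cast this
  · intro H u
    induction hu : h u using EReal.rec with
    | bot => exact absurd hu (hb u)
    | top => simp
    | coe c =>
      rw [← EReal.coe_sub]
      exact_mod_cast H u c hu

theorem ClosedProperConvex.exists_eq_coe (hh : ClosedProperConvex h) :
    ∃ u, ∃ c : ℝ, h u = (c : EReal) := by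
  obtain ⟨u, hu⟩ := hh.exists_ne_top
  exact ⟨u, (h u).toReal, (EReal.coe_toReal hu (hh.ne_bot u)).symm⟩

theorem ClosedProperConvex.conjugate_ne_bot (hh : ClosedProperConvex h) (v : Vec l) :
    conjugate h v ≠ ⊥ := by
  obtain ⟨u, c, hc⟩ := hh.exists_eq_coe
  intro hv
  have := le_iSup (fun u : Vec l => ((⟪u, v⟫_ℝ : ℝ) : EReal) - h u) u
  unfold conjugate at hv
  rw [hv] at this
  simp only [hc, ← EReal.coe_sub, le_bot_iff] at this
  exact EReal.coe_ne_bot _ this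

/-- A point just below the epigraph is separated from it by a hyperplane that is not vertical, and
the slope of this hyperplane is a point where `h*` is finite. If there were none, every point would
minimize the proximal objective and `IsProx` would carry no information. -/
theorem ClosedProperConvex.exists_conjugate_ne_top (hh : ClosedProperConvex h) :
    ∃ v, conjugate h v ≠ ⊤ := by
  obtain ⟨u₀, c, hc⟩ := hh.exists_eq_coe
  have hclosed : IsClosed {w : Vec l × ℝ | h w.1 ≤ (w.2 : EReal)} :=
    hh.closed.isClosed_epigraph.preimage
      (f := fun w : Vec l × ℝ => (w.1, (w.2 : EReal)))
      (continuous_fst.prodMk (continuous_coe_real_ereal.comp continuous_snd))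
  have hnot : (u₀, c - 1) ∉ {w : Vec l × ℝ | h w.1 ≤ (w.2 : EReal)} := by
    simp only [Set.mem_ofPred_eq, hc, EReal.coe_le_coe_iff]
    linarith
  obtain ⟨L, s, hL, hs⟩ := geometric_hahn_banach_point_closed hh.convex_epigraph hclosed hnot
  have hsplit : ∀ u a, L (u, a) = L (u, 0) + a * L (0, 1) := by
    intro u a
    have : ((u, a) : Vec l × ℝ) = (u, 0) + a • (0, 1) := by simp
    rw [this, map_add, map_smul, smul_eq_mul]
  -- Over `u₀` the functional is larger at height `c` than at height `c - 1`, so its vertical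
  -- component is positive.
  have hβ : 0 < L (0, 1) := by
    have h1 := hs (u₀, c) (by simp [hc])
    rw [hsplit] at h1 hL
    nlinarith
  set β := L (0, 1)
  let g : Vec l := (InnerProductSpace.toDual ℝ (Vec l)).symm (L.comp (ContinuousLinearMap.inl ℝ _ _))
  have hg : ∀ u, ⟪u, g⟫_ℝ = L (u, 0) := by
    intro u
    rw [real_inner_comm, InnerProductSpace.toDual_symm_apply]
    simp
  refine ⟨-(β⁻¹ • g), ne_top_of_le_ne_top (EReal.coe_ne_top (-(s / β))) ?_⟩
  rw [conjugate_le_coe_iff hh.ne_bot]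
  intro u a ha
  have h1 := hs (u, a) (by simp [ha])
  rw [hsplit] at h1
  rw [inner_neg_right, inner_smul_right, hg]
  have : s / β < β⁻¹ * L (u, 0) + a := by
    rw [div_lt_iff₀ hβ, add_mul, mul_comm β⁻¹, mul_assoc, inv_mul_cancel₀ hβ.ne', mul_one]
    exact h1
  linarith

/-- The convex conjugate as a real-valued function; only meaningful where it is finite. -/
def conjReal (h : Vec l → EReal) (v : Vec l) : ℝ := (conjugate h v).toReal

theorem ClosedProperConvex.coe_conjReal (hh : ClosedProperConvex h) {v : Vec l}
    (hv : conjugate h v ≠ ⊤) : ((conjReal h v : ℝ) : EReal) = conjugate h v :=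
  EReal.coe_toReal hv (hh.conjugate_ne_bot v)

theorem ClosedProperConvex.sub_le_conjReal (hh : ClosedProperConvex h) {v : Vec l}
    (hv : conjugate h v ≠ ⊤) {u : Vec l} {c : ℝ} (hc : h u = (c : EReal)) :
    ⟪u, v⟫_ℝ - c ≤ conjReal h v :=
  (conjugate_le_coe_iff hh.ne_bot).1 (hh.coe_conjReal hv).ge u c hc

theorem ClosedProperConvex.conjugate_combo_le (hh : ClosedProperConvex h) {v w : Vec l}
    (hv : conjugate h v ≠ ⊤) (hw : conjugate h w ≠ ⊤) {a b : ℝ} (ha : 0 ≤ a) (hb : 0 ≤ b)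
    (hab : a + b = 1) :
    conjugate h (a • v + b • w) ≤ ((a * conjReal h v + b * conjReal h w : ℝ) : EReal) := by
  rw [conjugate_le_coe_iff hh.ne_bot]
  intro u c hc
  rw [inner_add_right, inner_smul_right, inner_smul_right]
  have h1 := mul_le_mul_of_nonneg_left (hh.sub_le_conjReal hv hc) ha
  have h2 := mul_le_mul_of_nonneg_left (hh.sub_le_conjReal hw hc) hb
  have h3 : c = a * c + b * c := by rw [← add_mul, hab, one_mul]
  linarith

theorem ClosedProperConvex.conjugate_combo_ne_top (hh : ClosedProperConvex h) {v w : Vec l}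
    (hv : conjugate h v ≠ ⊤) (hw : conjugate h w ≠ ⊤) {a b : ℝ} (ha : 0 ≤ a) (hb : 0 ≤ b)
    (hab : a + b = 1) : conjugate h (a • v + b • w) ≠ ⊤ :=
  ne_top_of_le_ne_top (EReal.coe_ne_top _) (hh.conjugate_combo_le hv hw ha hb hab)

theorem ClosedProperConvex.conjReal_combo_le (hh : ClosedProperConvex h) {v w : Vec l}
    (hv : conjugate h v ≠ ⊤) (hw : conjugate h w ≠ ⊤) {a b : ℝ} (ha : 0 ≤ a) (hb : 0 ≤ b)
    (hab : a + b = 1) :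
    conjReal h (a • v + b • w) ≤ a * conjReal h v + b * conjReal h w := by
  have := hh.conjugate_combo_le hv hw ha hb hab
  rw [← hh.coe_conjReal (hh.conjugate_combo_ne_top hv hw ha hb hab)] at this
  exact_mod_cast this

theorem ClosedProperConvex.lowerSemicontinuous_conjugate (hh : ClosedProperConvex h) :
    LowerSemicontinuous (conjugate h) := by
  refine lowerSemicontinuous_iSup fun u => ?_
  induction hu : h u using EReal.rec with
  | bot => exact absurd hu (hh.ne_bot u)
  | top => simpa using lowerSemicontinuous_const
  | coe c =>
    simp only [← EReal.coe_sub]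
    exact (continuous_coe_real_ereal.comp (by fun_prop)).lowerSemicontinuous

end Conjugate

/-! ### The proximal map -/

section Prox

variable {l : ℕ} {h : Vec l → EReal}

theorem IsProx.conjugate_ne_top (hh : ClosedProperConvex h) {c : ℝ} (hc : 0 < c) {v a : Vec l}
    (ha : IsProx c (conjugate h) v a) : conjugate h a ≠ ⊤ := by
  obtain ⟨b, hb⟩ := hh.exists_conjugate_ne_top
  intro htop
  have h1 := ha (Set.mem_univ b)
  simp only [Set.mem_ofPred_eq, htop] at h1
  rw [EReal.coe_mul_top_of_pos hc, EReal.top_add_coe, ← hh.coe_conjReal hb, ← EReal.coe_mul,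
    ← EReal.coe_add, top_le_iff] at h1
  exact EReal.coe_ne_top _ h1

/-- Divide by `ε` and let it tend to 0. Only `ε ≤ 1` is asked for, because `ε` will be a convex
weight. -/
theorem nonneg_of_forall_small {a b : ℝ} (H : ∀ ε, 0 < ε → ε ≤ 1 → 0 ≤ ε * a + ε ^ 2 * b) :
    0 ≤ a := by
  by_contra! ha
  have hb : 0 < |b| + |a| + 1 := by positivity
  -- This `ε` is at most 1 and satisfies `ε |b| < |a|`.
  have hε : 0 < |a| / (|b| + |a| + 1) := div_pos (abs_pos.2 ha.ne) hb
  have h1 := H _ hε (by rw [div_le_one hb]; linarith [abs_nonneg b])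
  have h2 : 0 ≤ a + |a| / (|b| + |a| + 1) * b := by
    by_contra! h3
    nlinarith
  have h3 : |a| / (|b| + |a| + 1) * b < |a| := by
    rw [div_mul_eq_mul_div, div_lt_iff₀ hb]
    nlinarith [le_abs_self b, abs_pos.2 ha.ne]
  rw [abs_of_neg ha] at *
  linarith

/-- First order condition of the proximal map: compare the minimizer with the points `(1 - ε) a + ε
b`. By convexity `h*` changes at most linearly in `ε`, while `‖b - a‖²` enters only with `ε²`. -/
theorem IsProx.inner_le (hh : ClosedProperConvex h) {c : ℝ} (hc : 0 < c) {v a b : Vec l}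
    (ha : IsProx c (conjugate h) v a) (hb : conjugate h b ≠ ⊤) :
    ⟪v - a, b - a⟫_ℝ ≤ c * (conjReal h b - conjReal h a) := by
  have hatop := ha.conjugate_ne_top hh hc
  suffices 0 ≤ c * (conjReal h b - conjReal h a) - ⟪v - a, b - a⟫_ℝ by linarith
  refine nonneg_of_forall_small (b := 1 / 2 * ‖b - a‖ ^ 2) fun ε hε hε1 => ?_
  have h1 := ha (Set.mem_univ ((1 - ε) • a + ε • b))
  have hne := hh.conjugate_combo_ne_top hatop hb (sub_nonneg.2 hε1) hε.le (by ring)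
  have h2 := hh.conjReal_combo_le hatop hb (sub_nonneg.2 hε1) hε.le (by ring)
  simp only [Set.mem_ofPred_eq] at h1
  rw [← hh.coe_conjReal hatop, ← hh.coe_conjReal hne, ← EReal.coe_mul, ← EReal.coe_mul,
    ← EReal.coe_add, ← EReal.coe_add, EReal.coe_le_coe_iff] at h1
  have h3 : (1 - ε) • a + ε • b - v = ε • (b - a) - (v - a) := by module
  have h5 : ‖ε • (b - a) - (v - a)‖ ^ 2 =
      ε ^ 2 * ‖b - a‖ ^ 2 - 2 * (ε * ⟪v - a, b - a⟫_ℝ) + ‖v - a‖ ^ 2 := by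
    rw [norm_sub_sq_real, norm_smul, real_inner_smul_left, mul_pow, Real.norm_eq_abs, sq_abs,
      real_inner_comm]
  rw [h3, h5, norm_sub_rev a v] at h1
  have h4 := mul_le_mul_of_nonneg_left h2 hc.le
  linarith

/-- Two points that satisfy the first order condition of a proximal map at `v` and `w` are not
farther apart than `v` and `w`. -/
theorem norm_sub_le_of_inner_le {E : Type*} [NormedAddCommGroup E] [InnerProductSpace ℝ E]
    {v w a b : E} {e : ℝ} (ha : ⟪v - a, b - a⟫_ℝ ≤ e) (hb : ⟪w - b, a - b⟫_ℝ ≤ -e) :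
    ‖a - b‖ ≤ ‖v - w‖ := by
  have h1 : ‖a - b‖ ^ 2 ≤ ⟪v - w, a - b⟫_ℝ := by
    rw [← real_inner_self_eq_norm_sq]
    have e1 : v - w = (v - a) - (w - b) + (a - b) := by abel
    have e2 : ⟪v - a, a - b⟫_ℝ = -⟪v - a, b - a⟫_ℝ := by rw [← inner_neg_right, neg_sub]
    rw [e1, inner_add_left, inner_sub_left (v - a), e2]
    linarith
  have h2 := real_inner_le_norm (v - w) (a - b)
  by_contra! h3
  nlinarith [norm_nonneg (v - w)]

/-- The proximal step is a relation, so measurability of its output is not automatic. Here `a`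
factors through `v` by a Lipschitz map on the range of `v`. That range need not be measurable, so
the map is extended to the whole space. The result holds for every σ-algebra that makes `v`
measurable, which yields adaptedness. -/
theorem measurable_of_nonexpansive {Ω : Type*} {m : MeasurableSpace Ω} {n : ℕ}
    {v a : Ω → Vec n} (hv : Measurable v)
    (H : ∀ ω ω', ‖a ω - a ω'‖ ≤ ‖v ω - v ω'‖) : Measurable a := by
  classical
  have hfac : ∀ ω ω', v ω = v ω' → a ω = a ω' := by
    intro ω ω' he
    have := H ω ω'
    rw [he, sub_self, norm_zero] at this
    exact sub_eq_zero.1 (norm_le_zero_iff.1 this)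
  let P : Vec n → Vec n := fun z => if hz : ∃ ω, v ω = z then a hz.choose else 0
  have hP : ∀ ω, P (v ω) = a ω := by
    intro ω
    have hz : ∃ ω', v ω' = v ω := ⟨ω, rfl⟩
    simp only [P, dif_pos hz]
    exact hfac _ _ hz.choose_spec
  have hlip : LipschitzOnWith 1 P (Set.range v) := by
    refine LipschitzOnWith.of_dist_le_mul ?_
    rintro _ ⟨ω, rfl⟩ _ ⟨ω', rfl⟩
    rw [hP, hP, dist_eq_norm, dist_eq_norm, NNReal.coe_one, one_mul]
    exact H ω ω'
  obtain ⟨g, hg, hPg⟩ := hlip.extend_finite_dimension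
  have : a = g ∘ v := by
    ext1 ω
    rw [Function.comp_apply, ← hPg ⟨ω, rfl⟩, hP]
  rw [this]
  exact hg.continuous.measurable.comp hv

theorem IsProx.measurable (hh : ClosedProperConvex h) {Ω : Type*} {m : MeasurableSpace Ω}
    {c : ℝ} (hc : 0 < c) {v a : Ω → Vec l} (hv : Measurable v)
    (ha : ∀ ω, IsProx c (conjugate h) (v ω) (a ω)) : Measurable a := by
  refine measurable_of_nonexpansive hv fun ω ω' => ?_
  refine norm_sub_le_of_inner_le
    ((ha ω).inner_le hh hc ((ha ω').conjugate_ne_top hh hc)) ?_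
  have := (ha ω').inner_le hh hc ((ha ω).conjugate_ne_top hh hc)
  linarith

end Prox

/-! ### The duality gap -/

section Gap

variable {p l : ℕ} {f : Vec p → ℝ} {h : Vec l → EReal} {K : Vec p →L[ℝ] Vec l}

/-- `ℒ(x', y) - ℒ(x, y')` as a real number; only meaningful where `h*(y)`, `h*(y')` are finite. -/
def gapAt (f : Vec p → ℝ) (h : Vec l → EReal) (K : Vec p →L[ℝ] Vec l) (x : Vec p) (y : Vec l)
    (x' : Vec p) (y' : Vec l) : ℝ :=
  f x' + ⟪K x', y⟫_ℝ - conjReal h y - (f x + ⟪K x, y'⟫_ℝ - conjReal h y')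

theorem saddle_sub_saddle (hh : ClosedProperConvex h) {x x' : Vec p} {y y' : Vec l}
    (hy : conjugate h y ≠ ⊤) (hy' : conjugate h y' ≠ ⊤) :
    saddle f h K x' y - saddle f h K x y' = ((gapAt f h K x y x' y' : ℝ) : EReal) := by
  unfold saddle gapAt
  rw [← hh.coe_conjReal hy, ← hh.coe_conjReal hy', ← EReal.coe_sub, ← EReal.coe_sub,
    ← EReal.coe_sub]

theorem dualityGap_le (hh : ClosedProperConvex h) {X : Set (Vec p)} {Y : Set (Vec l)}
    {x' : Vec p} {y' : Vec l} (hy' : conjugate h y' ≠ ⊤) {M : ℝ}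
    (H : ∀ x ∈ X, ∀ y ∈ Y, conjugate h y ≠ ⊤ → gapAt f h K x y x' y' ≤ M) :
    dualityGap f h K X Y x' y' ≤ (M : EReal) := by
  refine iSup₂_le fun x hx => iSup₂_le fun y hy => ?_
  by_cases hy'' : conjugate h y = ⊤
  · simp [saddle, hy'']
  · rw [saddle_sub_saddle hh hy'' hy']
    exact_mod_cast H x hx y hy hy''

theorem le_dualityGap (hh : ClosedProperConvex h) {X : Set (Vec p)} {Y : Set (Vec l)}
    {x x' : Vec p} {y y' : Vec l} (hx : x ∈ X) (hy : y ∈ Y) (hyt : conjugate h y ≠ ⊤)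
    (hy' : conjugate h y' ≠ ⊤) :
    ((gapAt f h K x y x' y' : ℝ) : EReal) ≤ dualityGap f h K X Y x' y' := by
  rw [← saddle_sub_saddle hh hyt hy']
  exact le_iSup₂_of_le x hx (le_iSup₂_of_le y hy le_rfl)

/-- An uncountable supremum of measurable functions need not be measurable, but a supremum of lower
semicontinuous functions is lower semicontinuous. -/
theorem measurable_dualityGap (hh : ClosedProperConvex h) (hf : Continuous f)
    (X : Set (Vec p)) (Y : Set (Vec l)) :
    Measurable fun z : Vec p × Vec l => dualityGap f h K X Y z.1 z.2 := by
  refine LowerSemicontinuous.measurable ?_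
  refine lowerSemicontinuous_iSup fun x => lowerSemicontinuous_iSup fun _ =>
    lowerSemicontinuous_iSup fun y => lowerSemicontinuous_iSup fun _ => ?_
  by_cases hy : conjugate h y = ⊤
  · simpa [saddle, hy] using lowerSemicontinuous_const
  -- Only `h*(z.2)` can be infinite. Once separated, it is lower semicontinuous and the other
  -- summand is finite and continuous.
  · have hrw : ∀ z : Vec p × Vec l, saddle f h K z.1 y - saddle f h K x z.2 =
        ((f z.1 + ⟪K z.1, y⟫_ℝ - conjReal h y - (f x + ⟪K x, z.2⟫_ℝ) : ℝ) : EReal) +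
          conjugate h z.2 := by
      intro z
      unfold saddle
      rw [← hh.coe_conjReal hy]
      by_cases hz : conjugate h z.2 = ⊤
      · rw [hz, ← EReal.coe_sub, EReal.coe_add_top, EReal.sub_top, EReal.coe_sub_bot]
      · rw [← hh.coe_conjReal hz, ← EReal.coe_sub, ← EReal.coe_sub, ← EReal.coe_sub,
          ← EReal.coe_add]
        congr 1
        ring
    simp only [hrw]
    refine LowerSemicontinuous.add' ?_ ?_ ?_
    · exact (continuous_coe_real_ereal.comp (by fun_prop)).lowerSemicontinuous
    · exact hh.lowerSemicontinuous_conjugate.comp continuous_snd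
    · intro z
      exact EReal.continuousAt_add (Or.inl (EReal.coe_ne_top _)) (Or.inl (EReal.coe_ne_bot _))

end Gap

/-! ### Smooth convex functions -/

section Smooth

variable {p : ℕ} {f : Vec p → ℝ}

theorem hasDerivAt_line (hf : Differentiable ℝ f) (x d : Vec p) (c : ℝ) :
    HasDerivAt (fun c : ℝ => f (x + c • d)) ⟪gradient f (x + c • d), d⟫_ℝ c := by
  have h1 : HasDerivAt (fun c : ℝ => x + c • d) d c := by
    simpa using ((hasDerivAt_id c).smul_const d).const_add x
  have h2 := (hf (x + c • d)).hasGradientAt.hasFDerivAt.comp_hasDerivAt c h1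
  rw [InnerProductSpace.toDual_apply_apply] at h2
  exact h2

theorem le_of_convex_differentiable (hc : ConvexOn ℝ Set.univ f) (hf : Differentiable ℝ f)
    (x y : Vec p) : f x + ⟪gradient f x, y - x⟫_ℝ ≤ f y := by
  have h1 : ConvexOn ℝ Set.univ (fun c : ℝ => f (x + c • (y - x))) := by
    refine ⟨convex_univ, fun a _ b _ u v hu hv huv => ?_⟩
    have := hc.2 (Set.mem_univ (x + a • (y - x))) (Set.mem_univ (x + b • (y - x))) hu hv huv
    have he : x + (u • a + v • b) • (y - x) =
        u • (x + a • (y - x)) + v • (x + b • (y - x)) := by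
      have : x = (u + v) • x := by rw [huv, one_smul]
      nth_rewrite 1 [this]
      simp only [smul_eq_mul]
      module
    simp only [he]
    exact this
  have h2 := h1.le_slope_of_hasDerivAt (Set.mem_univ 0) (Set.mem_univ 1) one_pos
    (hasDerivAt_line hf x (y - x) 0)
  simp only [slope_def_field, zero_smul, one_smul, add_zero, add_sub_cancel, sub_zero,
    div_one] at h2
  linarith

theorem le_of_lipschitz_gradient {L : ℝ≥0} (hf : Differentiable ℝ f)
    (hL : LipschitzWith L (gradient f)) (x y : Vec p) :
    f y ≤ f x + ⟪gradient f x, y - x⟫_ℝ + L / 2 * ‖y - x‖ ^ 2 := by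
  set d := y - x with hd
  -- The claim is `g 1 ≤ g 0`. The Lipschitz bound on the gradient makes the derivative of `g`
  -- nonpositive on the segment.
  let g : ℝ → ℝ := fun c => f (x + c • d) - c * ⟪gradient f x, d⟫_ℝ - L / 2 * ‖d‖ ^ 2 * c ^ 2
  have hg : ∀ c, HasDerivAt g
      (⟪gradient f (x + c • d), d⟫_ℝ - ⟪gradient f x, d⟫_ℝ - L / 2 * ‖d‖ ^ 2 * (2 * c)) c := by
    intro c
    have h1 := (hasDerivAt_id c).mul_const ⟪gradient f x, d⟫_ℝ
    have h2 := (hasDerivAt_pow 2 c).const_mul (L / 2 * ‖d‖ ^ 2)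
    have := ((hasDerivAt_line hf x d c).sub h1).sub h2
    simp only [one_mul, Nat.cast_ofNat, Nat.add_one_sub_one, pow_one] at this
    exact this
  have hanti : AntitoneOn g (Set.Icc 0 1) := by
    refine antitoneOn_of_deriv_nonpos (convex_Icc 0 1)
      (fun c _ => (hg c).continuousAt.continuousWithinAt)
      (fun c _ => (hg c).differentiableAt.differentiableWithinAt) fun c hc => ?_
    rw [interior_Icc] at hc
    rw [(hg c).deriv, ← inner_sub_left]
    have h1 := real_inner_le_norm (gradient f (x + c • d) - gradient f x) d
    have h2 := hL.norm_sub_le (x + c • d) x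
    rw [add_sub_cancel_left, norm_smul, Real.norm_of_nonneg hc.1.le] at h2
    have h3 := mul_le_mul_of_nonneg_right h2 (norm_nonneg d)
    nlinarith
  have h01 := hanti (Set.left_mem_Icc.2 zero_le_one) (Set.right_mem_Icc.2 zero_le_one) zero_le_one
  simp only [g, hd, zero_smul, one_smul, add_zero, add_sub_cancel, zero_mul, one_mul, sub_zero,
    one_pow, mul_one, ne_eq, OfNat.ofNat_ne_zero, not_false_eq_true, zero_pow, mul_zero] at h01
  rw [hd]
  linarith

end Smooth

/-! ### Step sizes -/

section StepSizes

variable {ρ θ τ σ : ℕ → ℝ}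

/-- The value `gam θ 0 = 1` is a filler that does not follow the recursion, hence `1 ≤ k`. -/
theorem gam_succ (θ : ℕ → ℝ) {k : ℕ} (hk : 1 ≤ k) :
    gam θ (k + 1) = (θ (k + 1))⁻¹ * gam θ k := by
  obtain ⟨n, rfl⟩ := Nat.exists_eq_add_of_le' hk
  rfl

namespace StepSizes

theorem gam_pos (hS : StepSizes ρ θ τ σ) {k : ℕ} (hk : 1 ≤ k) : 0 < gam θ k := by
  induction k, hk using Nat.le_induction with
  | base => exact one_pos
  | succ k hk ih =>
    rw [gam_succ θ hk]
    exact mul_pos (inv_pos.2 (hS.theta_pos _ (by omega))) ih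

theorem gam_succ_mul (hS : StepSizes ρ θ τ σ) {k : ℕ} (hk : 1 ≤ k) :
    gam θ (k + 1) * θ (k + 1) = gam θ k := by
  rw [gam_succ θ hk, mul_comm, ← mul_assoc, mul_inv_cancel₀ (hS.theta_pos _ (by omega)).ne',
    one_mul]

theorem rho_mem (hS : StepSizes ρ θ τ σ) {k : ℕ} (hk : 1 ≤ k) : 0 < ρ k ∧ ρ k ≤ 1 := by
  induction k, hk using Nat.le_induction with
  | base => rw [hS.rho_one]; norm_num
  | succ k hk ih =>
    have h1 := hS.rho_succ k hk
    have h2 : 0 ≤ (ρ k)⁻¹ * θ (k + 1) :=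
      (mul_pos (inv_pos.2 ih.1) (hS.theta_pos _ (by omega))).le
    have h3 : 1 ≤ (ρ (k + 1))⁻¹ := by linarith
    exact ⟨inv_pos.1 (by linarith), by simpa using inv_le_one_of_one_le₀ h3⟩

theorem theta_mul_tau_le (hS : StepSizes ρ θ τ σ) {k : ℕ} (hk : 1 ≤ k) :
    θ (k + 1) * τ (k + 1) ≤ τ k := by
  have := (hS.theta_le (k + 1) (by omega)).trans (min_le_left _ _)
  rwa [Nat.add_sub_cancel, le_div_iff₀ (hS.tau_pos _ (by omega))] at this

theorem theta_mul_sigma_le (hS : StepSizes ρ θ τ σ) {k : ℕ} (hk : 1 ≤ k) :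
    θ (k + 1) * σ (k + 1) ≤ σ k := by
  have := (hS.theta_le (k + 1) (by omega)).trans (min_le_right _ _)
  rwa [Nat.add_sub_cancel, le_div_iff₀ (hS.sigma_pos _ (by omega))] at this

theorem tau_le_succ (hS : StepSizes ρ θ τ σ) {k : ℕ} (hk : 1 ≤ k) : τ k ≤ τ (k + 1) := by
  have := (le_max_left _ _).trans (hS.ratio_le (k + 1) (by omega))
  rwa [Nat.add_sub_cancel, div_le_one (hS.tau_pos _ (by omega))] at this

theorem theta_le_one (hS : StepSizes ρ θ τ σ) {k : ℕ} (hk : 1 ≤ k) : θ (k + 1) ≤ 1 :=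
  ((hS.theta_le (k + 1) (by omega)).trans (min_le_left _ _)).trans
    ((le_max_left _ _).trans (hS.ratio_le (k + 1) (by omega)))

theorem gam_le_succ (hS : StepSizes ρ θ τ σ) {k : ℕ} (hk : 1 ≤ k) :
    gam θ k ≤ gam θ (k + 1) := by
  rw [← hS.gam_succ_mul hk]
  exact mul_le_of_le_one_right (hS.gam_pos (by omega)).le (hS.theta_le_one hk)

/-- This is the condition `θ_{k+1} ≤ τ_k / τ_{k+1}` in terms of the weights. It lets weighted
differences of squared distances be summed by parts, each distance being replaced by the diameter
bound. -/
theorem gam_div_tau_le (hS : StepSizes ρ θ τ σ) {k : ℕ} (hk : 1 ≤ k) :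
    gam θ k / τ k ≤ gam θ (k + 1) / τ (k + 1) := by
  rw [div_le_div_iff₀ (hS.tau_pos k hk) (hS.tau_pos _ (by omega)), ← hS.gam_succ_mul hk, mul_assoc]
  exact mul_le_mul_of_nonneg_left (hS.theta_mul_tau_le hk) (hS.gam_pos (by omega)).le

theorem gam_div_sigma_le (hS : StepSizes ρ θ τ σ) {k : ℕ} (hk : 1 ≤ k) :
    gam θ k / σ k ≤ gam θ (k + 1) / σ (k + 1) := by
  rw [div_le_div_iff₀ (hS.sigma_pos k hk) (hS.sigma_pos _ (by omega)), ← hS.gam_succ_mul hk,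
    mul_assoc]
  exact mul_le_mul_of_nonneg_left (hS.theta_mul_sigma_le hk) (hS.gam_pos (by omega)).le

theorem gam_mul_tau_le (hS : StepSizes ρ θ τ σ) {k : ℕ} (hk : 1 ≤ k) :
    gam θ k * τ k ≤ gam θ (k + 1) * τ (k + 1) :=
  mul_le_mul (hS.gam_le_succ hk) (hS.tau_le_succ hk) (hS.tau_pos k hk).le
    (hS.gam_pos (by omega)).le

/-- The gap with weight `γ_k / ρ_k` telescopes because of this identity. -/
theorem gam_div_rho (hS : StepSizes ρ θ τ σ) {k : ℕ} (hk : 1 ≤ k) :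
    gam θ (k + 1) * ((ρ (k + 1))⁻¹ - 1) = gam θ k / ρ k := by
  rw [hS.rho_succ k hk, ← hS.gam_succ_mul hk]
  ring

theorem tau_mono (hS : StepSizes ρ θ τ σ) {i k : ℕ} (hi : 1 ≤ i) (hik : i ≤ k) :
    τ i ≤ τ k := by
  induction k, hik using Nat.le_induction with
  | base => exact le_rfl
  | succ k hk ih => exact ih.trans (hS.tau_le_succ (hi.trans hk))

theorem gam_div_tau_mono (hS : StepSizes ρ θ τ σ) {i k : ℕ} (hi : 1 ≤ i) (hik : i ≤ k) :
    gam θ i / τ i ≤ gam θ k / τ k := by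
  induction k, hik using Nat.le_induction with
  | base => exact le_rfl
  | succ k hk ih => exact ih.trans (hS.gam_div_tau_le (hi.trans hk))

theorem gam_div_sigma_mono (hS : StepSizes ρ θ τ σ) {i k : ℕ} (hi : 1 ≤ i) (hik : i ≤ k) :
    gam θ i / σ i ≤ gam θ k / σ k := by
  induction k, hik using Nat.le_induction with
  | base => exact le_rfl
  | succ k hk ih => exact ih.trans (hS.gam_div_sigma_le (hi.trans hk))

end StepSizes

end StepSizes

/-! ### The deterministic estimate -/

section Deterministic

variable {p l : ℕ}

/-- The iteration for one outcome, with the oracle errors collected into `δx` and `δy`. -/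
structure NoisyIteration (f : Vec p → ℝ) (h : Vec l → EReal) (K A B : Vec p →L[ℝ] Vec l)
    (ρ θ τ σ : ℕ → ℝ) (xs xt : ℕ → Vec p) (ys yt : ℕ → Vec l) (δx : ℕ → Vec p)
    (δy : ℕ → Vec l) : Prop where
  xt_zero : xt 0 = xt 1
  yt_zero : yt 0 = yt 1
  xt_succ : ∀ k, 1 ≤ k → xt (k + 1) = xt k - τ k • (gradient f ((1 - ρ k) • xs k + ρ k • xt k) +
    K.adjoint (yt (k + 1)) +
      B.adjoint ((yt (k + 1) - yt k) - θ k • (yt k - yt (k - 1))) + δx k)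
  yt_succ : ∀ k, 1 ≤ k → IsProx (σ k) (conjugate h) (yt k + σ k • (K (xt (k + 1)) +
    A ((xt (k + 1) - xt k) - θ k • (xt k - xt (k - 1))) +
    (K + A) ((K + B).adjoint (τ k • (yt (k + 1) - yt k) -
      (θ k * τ (k - 1)) • (yt k - yt (k - 1)))) + δy k)) (yt (k + 1))
  x_succ : ∀ k, 1 ≤ k → xs (k + 1) = (1 - ρ k) • xs k + ρ k • xt (k + 1)
  y_succ : ∀ k, 1 ≤ k → ys (k + 1) = (1 - ρ k) • ys k + ρ k • yt (k + 1)

/-- The contribution of the oracle errors of one iteration, net of the part of the quadratic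
terms that is reserved for it. -/
def noiseAt (τ σ : ℕ → ℝ) (s t : ℝ) (xt : ℕ → Vec p) (yt : ℕ → Vec l) (δx : ℕ → Vec p)
    (δy : ℕ → Vec l) (x : Vec p) (y : Vec l) (k : ℕ) : ℝ :=
  ⟪δy k, yt (k + 1) - y⟫_ℝ - ⟪δx k, xt (k + 1) - x⟫_ℝ -
    (1 - s) / (2 * τ k) * ‖xt (k + 1) - xt k‖ ^ 2 - (1 - t) / (2 * σ k) * ‖yt (k + 1) - yt k‖ ^ 2

theorem three_point {E : Type*} [NormedAddCommGroup E] [InnerProductSpace ℝ E] (a b x : E) :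
    ⟪a - b, b - x⟫_ℝ = (‖x - a‖ ^ 2 - ‖x - b‖ ^ 2 - ‖b - a‖ ^ 2) / 2 := by
  have h1 : x - a = (x - b) + (b - a) := by abel
  have h2 : ⟪a - b, b - x⟫_ℝ = ⟪x - b, b - a⟫_ℝ := by
    rw [real_inner_comm, ← neg_sub x b, ← neg_sub b a, inner_neg_neg]
  rw [h1, norm_add_sq_real, h2]
  ring

theorem young {a b c : ℝ} (hc : 0 < c) : a * b ≤ a ^ 2 * c / 2 + b ^ 2 / (2 * c) := by
  have h1 : a ^ 2 * c / 2 + b ^ 2 / (2 * c) - a * b = (a * c - b) ^ 2 / (2 * c) := by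
    field_simp
    ring
  have h2 : 0 ≤ (a * c - b) ^ 2 / (2 * c) := by positivity
  linarith

theorem inner_map_le {m n : ℕ} (T : Vec m →L[ℝ] Vec n) (u : Vec m) (v : Vec n) {c : ℝ}
    (hc : 0 < c) : |⟪T u, v⟫_ℝ| ≤ ‖T‖ ^ 2 * c / 2 * ‖u‖ ^ 2 + ‖v‖ ^ 2 / (2 * c) := by
  have h1 : |⟪T u, v⟫_ℝ| ≤ ‖T‖ * ‖u‖ * ‖v‖ :=
    (abs_real_inner_le_norm _ _).trans
      (mul_le_mul_of_nonneg_right (T.le_opNorm u) (norm_nonneg _))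
  refine h1.trans ((young hc).trans (le_of_eq ?_))
  ring

theorem inner_comp_adjoint_le {m n : ℕ} (S T : Vec m →L[ℝ] Vec n) (u v : Vec n) :
    |⟪S (T.adjoint u), v⟫_ℝ| ≤ ‖S‖ * ‖T‖ / 2 * (‖u‖ ^ 2 + ‖v‖ ^ 2) := by
  have h0 : ‖S (T.adjoint u)‖ ≤ ‖S‖ * (‖T‖ * ‖u‖) := by
    refine (S.le_opNorm _).trans (mul_le_mul_of_nonneg_left ?_ (norm_nonneg _))
    refine (T.adjoint.le_opNorm u).trans (le_of_eq ?_)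
    rw [ContinuousLinearMap.adjoint.norm_map]
  have h1 : |⟪S (T.adjoint u), v⟫_ℝ| ≤ ‖S‖ * (‖T‖ * ‖u‖) * ‖v‖ :=
    (abs_real_inner_le_norm _ _).trans (mul_le_mul_of_nonneg_right h0 (norm_nonneg _))
  have h2 : 0 ≤ ‖S‖ * ‖T‖ := by positivity
  nlinarith [mul_nonneg h2 (sq_nonneg (‖u‖ - ‖v‖))]

namespace NoisyIteration

variable {f : Vec p → ℝ} {h : Vec l → EReal} {K A B : Vec p →L[ℝ] Vec l} {ρ θ τ σ : ℕ → ℝ}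
  {xs xt : ℕ → Vec p} {ys yt : ℕ → Vec l} {δx : ℕ → Vec p} {δy : ℕ → Vec l}

theorem conjugate_yt_ne_top (hN : NoisyIteration f h K A B ρ θ τ σ xs xt ys yt δx δy)
    (hh : ClosedProperConvex h) (hS : StepSizes ρ θ τ σ) {k : ℕ} (hk : 1 ≤ k) :
    conjugate h (yt (k + 1)) ≠ ⊤ :=
  (hN.yt_succ k hk).conjugate_ne_top hh (hS.sigma_pos k hk)

/-- The point `y¹` is arbitrary and `h*` may be infinite there. The induction can start because `ρ₁
= 1` removes it from `y²`. -/
theorem conjugate_ys_ne_top (hN : NoisyIteration f h K A B ρ θ τ σ xs xt ys yt δx δy)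
    (hh : ClosedProperConvex h) (hS : StepSizes ρ θ τ σ) {k : ℕ} (hk : 1 ≤ k) :
    conjugate h (ys (k + 1)) ≠ ⊤ := by
  induction k, hk using Nat.le_induction with
  | base =>
    rw [hN.y_succ 1 le_rfl, hS.rho_one]
    simpa using hN.conjugate_yt_ne_top hh hS le_rfl
  | succ k hk ih =>
    rw [hN.y_succ _ (by omega)]
    have := hS.rho_mem (k := k + 1) (by omega)
    exact hh.conjugate_combo_ne_top ih (hN.conjugate_yt_ne_top hh hS (by omega))
      (by linarith) this.1.le (by ring)

/-- One step of the gap in terms of the linearized gap. -/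
theorem gapAt_succ_le (hN : NoisyIteration f h K A B ρ θ τ σ xs xt ys yt δx δy)
    (hh : ClosedProperConvex h) (hS : StepSizes ρ θ τ σ) (hc : ConvexOn ℝ Set.univ f)
    (hf : Differentiable ℝ f) {L : ℝ≥0} (hL : LipschitzWith L (gradient f)) (x : Vec p)
    (y : Vec l) {k : ℕ} (hk : 1 ≤ k) :
    gapAt f h K x y (xs (k + 1)) (ys (k + 1)) ≤ (1 - ρ k) * gapAt f h K x y (xs k) (ys k) +
      ρ k * (⟪gradient f ((1 - ρ k) • xs k + ρ k • xt k), xt (k + 1) - x⟫_ℝ +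
        ⟪K (xt (k + 1)), y⟫_ℝ - ⟪K x, yt (k + 1)⟫_ℝ + conjReal h (yt (k + 1)) - conjReal h y +
        L * ρ k / 2 * ‖xt (k + 1) - xt k‖ ^ 2) := by
  obtain ⟨hρ0, hρ1⟩ := hS.rho_mem hk
  set xm := (1 - ρ k) • xs k + ρ k • xt k with hxm
  have hxd : xs (k + 1) - xm = ρ k • (xt (k + 1) - xt k) := by
    rw [hN.x_succ k hk, hxm]
    module
  have hconj : conjReal h (ys (k + 1)) ≤
      (1 - ρ k) * conjReal h (ys k) + ρ k * conjReal h (yt (k + 1)) := by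
    rw [hN.y_succ k hk]
    -- For `k = 1` the value `conjReal h (ys 1)` may be meaningless, but its factor `1 - ρ₁`
    -- vanishes.
    rcases hk.eq_or_lt with rfl | hk1
    · simp [hS.rho_one]
    · obtain ⟨n, rfl⟩ : ∃ n, k = n + 1 := ⟨k - 1, by omega⟩
      exact hh.conjReal_combo_le (hN.conjugate_ys_ne_top hh hS (by omega))
        (hN.conjugate_yt_ne_top hh hS (by omega)) (by linarith) hρ0.le (by ring)
  have hdesc := le_of_lipschitz_gradient hf hL xm (xs (k + 1))
  have h1 := le_of_convex_differentiable hc hf xm (xs k)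
  have h2 := le_of_convex_differentiable hc hf xm x
  rw [hxd, norm_smul, mul_pow, Real.norm_of_nonneg hρ0.le, real_inner_smul_right] at hdesc
  -- The linear terms of the tangent bounds cancel because `xm` is exactly this convex combination.
  have h3 : (1 - ρ k) * ⟪gradient f xm, xs k - xm⟫_ℝ + ρ k * ⟪gradient f xm, xt k - xm⟫_ℝ = 0 := by
    rw [← real_inner_smul_right, ← real_inner_smul_right, ← inner_add_right]
    have : (1 - ρ k) • (xs k - xm) + ρ k • (xt k - xm) = 0 := by
      rw [hxm]
      module
    rw [this, inner_zero_right]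
  have e1 : ⟪gradient f xm, xt (k + 1) - x⟫_ℝ = ⟪gradient f xm, xt (k + 1) - xt k⟫_ℝ +
      ⟪gradient f xm, xt k - xm⟫_ℝ - ⟪gradient f xm, x - xm⟫_ℝ := by
    rw [← inner_add_right, ← inner_sub_right]
    congr 1
    abel
  have h4 := mul_le_mul_of_nonneg_left h1 (sub_nonneg.2 hρ1)
  have h5 := mul_le_mul_of_nonneg_left h2 hρ0.le
  have e2 : ⟪K (xs (k + 1)), y⟫_ℝ = (1 - ρ k) * ⟪K (xs k), y⟫_ℝ + ρ k * ⟪K (xt (k + 1)), y⟫_ℝ := by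
    rw [hN.x_succ k hk, map_add, map_smul, map_smul, inner_add_left, real_inner_smul_left,
      real_inner_smul_left]
  have e3 : ⟪K x, ys (k + 1)⟫_ℝ = (1 - ρ k) * ⟪K x, ys k⟫_ℝ + ρ k * ⟪K x, yt (k + 1)⟫_ℝ := by
    rw [hN.y_succ k hk, inner_add_right, real_inner_smul_right, real_inner_smul_right]
  unfold gapAt
  rw [e1, e2, e3]
  linarith

/-- The coupling term that telescopes along the iteration. -/
def coupling (K A B : Vec p →L[ℝ] Vec l) (τ : ℕ → ℝ) (xt : ℕ → Vec p) (yt : ℕ → Vec l)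
    (x : Vec p) (y : Vec l) (k : ℕ) : ℝ :=
  ⟪A (xt (k + 1) - xt k), yt (k + 1) - y⟫_ℝ +
    τ k * ⟪(K + A) ((K + B).adjoint (yt (k + 1) - yt k)), yt (k + 1) - y⟫_ℝ -
    ⟪B (xt (k + 1) - x), yt (k + 1) - yt k⟫_ℝ

/-- The cross terms between two consecutive increments. -/
def crossTerm (K A B : Vec p →L[ℝ] Vec l) (τ : ℕ → ℝ) (xt : ℕ → Vec p) (yt : ℕ → Vec l)
    (k : ℕ) : ℝ :=
  ⟪A (xt k - xt (k - 1)), yt (k + 1) - yt k⟫_ℝ +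
    τ (k - 1) * ⟪(K + A) ((K + B).adjoint (yt k - yt (k - 1))), yt (k + 1) - yt k⟫_ℝ -
    ⟪B (xt (k + 1) - xt k), yt k - yt (k - 1)⟫_ℝ

/-- The gradient is eliminated by the update of `x̃` and the conjugates by the proximal inequality.
The pairings with `K` then cancel, and those with `A`, `B` and `(K + A)(K + B)ᵀ` regroup into a
difference of coupling terms and a cross term. -/
theorem linearized_gap_le (hN : NoisyIteration f h K A B ρ θ τ σ xs xt ys yt δx δy)
    (hh : ClosedProperConvex h) (hS : StepSizes ρ θ τ σ) (s t : ℝ) (x : Vec p)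
    (y : Vec l) (hy : conjugate h y ≠ ⊤) {k : ℕ} (hk : 1 ≤ k) :
    ⟪gradient f ((1 - ρ k) • xs k + ρ k • xt k), xt (k + 1) - x⟫_ℝ +
        ⟪K (xt (k + 1)), y⟫_ℝ - ⟪K x, yt (k + 1)⟫_ℝ + conjReal h (yt (k + 1)) - conjReal h y ≤
      (‖x - xt k‖ ^ 2 - ‖x - xt (k + 1)‖ ^ 2 - s * ‖xt (k + 1) - xt k‖ ^ 2) / (2 * τ k) +
      (‖y - yt k‖ ^ 2 - ‖y - yt (k + 1)‖ ^ 2 - t * ‖yt (k + 1) - yt k‖ ^ 2) / (2 * σ k) +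
      coupling K A B τ xt yt x y k - θ k * coupling K A B τ xt yt x y (k - 1) -
      θ k * crossTerm K A B τ xt yt k + noiseAt τ σ s t xt yt δx δy x y k := by
  have hτ := hS.tau_pos k hk
  have hσ := hS.sigma_pos k hk
  obtain ⟨n, rfl⟩ : ∃ n, k = n + 1 := ⟨k - 1, by omega⟩
  have hprox := (hN.yt_succ _ hk).inner_le hh hσ hy
  have hxs := hN.xt_succ _ hk
  simp only [Nat.add_sub_cancel] at hprox hxs ⊢
  set g := gradient f ((1 - ρ (n + 1)) • xs (n + 1) + ρ (n + 1) • xt (n + 1))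
  set a := xt n
  set a' := xt (n + 1)
  set a'' := xt (n + 1 + 1)
  set b := yt n
  set b' := yt (n + 1)
  set b'' := yt (n + 1 + 1)
  have hg : ⟪g, a'' - x⟫_ℝ = (‖x - a'‖ ^ 2 - ‖x - a''‖ ^ 2 - ‖a'' - a'‖ ^ 2) / (2 * τ (n + 1)) -
      ⟪K (a'' - x), b''⟫_ℝ - ⟪B (a'' - x), (b'' - b') - θ (n + 1) • (b' - b)⟫_ℝ -
      ⟪δx (n + 1), a'' - x⟫_ℝ := by
    have e : g = (τ (n + 1))⁻¹ • (a' - a'') - K.adjoint b'' -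
        B.adjoint ((b'' - b') - θ (n + 1) • (b' - b)) - δx (n + 1) := by
      rw [hxs, sub_sub_cancel, smul_smul, inv_mul_cancel₀ hτ.ne', one_smul]
      abel
    rw [e, inner_sub_left, inner_sub_left, inner_sub_left, real_inner_smul_left, three_point,
      ContinuousLinearMap.adjoint_inner_left, ContinuousLinearMap.adjoint_inner_left,
      real_inner_comm (K (a'' - x)), real_inner_comm (B (a'' - x))]
    field_simp
  have hp : conjReal h b'' - conjReal h y ≤
      (‖y - b'‖ ^ 2 - ‖y - b''‖ ^ 2 - ‖b'' - b'‖ ^ 2) / (2 * σ (n + 1)) +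
      ⟪K a'' + A ((a'' - a') - θ (n + 1) • (a' - a)) + (K + A) ((K + B).adjoint
        (τ (n + 1) • (b'' - b') - (θ (n + 1) * τ n) • (b' - b))) + δy (n + 1), b'' - y⟫_ℝ := by
    set u := K a'' + A ((a'' - a') - θ (n + 1) • (a' - a)) + (K + A) ((K + B).adjoint
        (τ (n + 1) • (b'' - b') - (θ (n + 1) * τ n) • (b' - b))) + δy (n + 1)
    have e : ⟪b' + σ (n + 1) • u - b'', y - b''⟫_ℝ =
        -((‖y - b'‖ ^ 2 - ‖y - b''‖ ^ 2 - ‖b'' - b'‖ ^ 2) / 2) - σ (n + 1) * ⟪u, b'' - y⟫_ℝ := by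
      rw [← three_point, add_sub_right_comm, inner_add_left, real_inner_smul_left,
        ← neg_sub b'' y, inner_neg_right, inner_neg_right]
      ring
    rw [e] at hprox
    have h1 : (‖y - b'‖ ^ 2 - ‖y - b''‖ ^ 2 - ‖b'' - b'‖ ^ 2) / (2 * σ (n + 1)) =
        (‖y - b'‖ ^ 2 - ‖y - b''‖ ^ 2 - ‖b'' - b'‖ ^ 2) / 2 / σ (n + 1) := by
      rw [div_div]
    rw [h1, ← sub_le_iff_le_add, le_div_iff₀ hσ]
    linarith
  rw [hg]
  unfold coupling crossTerm noiseAt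
  simp only [Nat.add_sub_cancel]
  have ex : (‖x - a'‖ ^ 2 - ‖x - a''‖ ^ 2 - ‖a'' - a'‖ ^ 2) / (2 * τ (n + 1)) =
      (‖x - a'‖ ^ 2 - ‖x - a''‖ ^ 2 - s * ‖a'' - a'‖ ^ 2) / (2 * τ (n + 1)) -
        (1 - s) / (2 * τ (n + 1)) * ‖a'' - a'‖ ^ 2 := by ring
  have ey : (‖y - b'‖ ^ 2 - ‖y - b''‖ ^ 2 - ‖b'' - b'‖ ^ 2) / (2 * σ (n + 1)) =
      (‖y - b'‖ ^ 2 - ‖y - b''‖ ^ 2 - t * ‖b'' - b'‖ ^ 2) / (2 * σ (n + 1)) -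
        (1 - t) / (2 * σ (n + 1)) * ‖b'' - b'‖ ^ 2 := by ring
  rw [ex]
  rw [ey] at hp
  -- This split turns the pairings of the previous increments into the previous coupling term, based
  -- at `b'` and `a'`, plus the cross term.
  have d1 : b'' - y = (b'' - b') + (b' - y) := by abel
  have d2 : a'' - x = (a'' - a') + (a' - x) := by abel
  have e1 : ⟪A (a' - a), b'' - y⟫_ℝ = ⟪A (a' - a), b'' - b'⟫_ℝ + ⟪A (a' - a), b' - y⟫_ℝ := by
    rw [d1, inner_add_right]
  have e2 : ⟪(K + A) ((K + B).adjoint (b' - b)), b'' - y⟫_ℝ =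
      ⟪(K + A) ((K + B).adjoint (b' - b)), b'' - b'⟫_ℝ +
        ⟪(K + A) ((K + B).adjoint (b' - b)), b' - y⟫_ℝ := by
    rw [d1, inner_add_right]
  have e3 : ⟪B (a'' - x), b' - b⟫_ℝ = ⟪B (a'' - a'), b' - b⟫_ℝ + ⟪B (a' - x), b' - b⟫_ℝ := by
    rw [d2, map_add, inner_add_left]
  rw [inner_add_left (_ + _) (δy (n + 1)), inner_add_left (_ + _) ((K + A) _),
    inner_add_left (K a''), map_sub A, map_smul A, inner_sub_left (A (a'' - a')),
    real_inner_smul_left, map_sub (K + B).adjoint (τ (n + 1) • _), map_smul (K + B).adjoint,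
    map_smul (K + B).adjoint, map_sub (K + A) (τ (n + 1) • _), map_smul (K + A), map_smul (K + A),
    inner_sub_left (τ (n + 1) • _), real_inner_smul_left, real_inner_smul_left, e1, e2,
    inner_sub_right (K a'')] at hp
  rw [inner_sub_right (B (a'' - x)), real_inner_smul_right, e3, map_sub K, inner_sub_left (K a'')]
  linarith

/-- The part of the quadratic terms that is kept for the next iteration. -/
def reserve (K A B : Vec p →L[ℝ] Vec l) (τ σ : ℕ → ℝ) (q r : ℝ) (xt : ℕ → Vec p)
    (yt : ℕ → Vec l) (k : ℕ) : ℝ :=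
  ‖A‖ ^ 2 * σ k / (2 * r) * ‖xt (k + 1) - xt k‖ ^ 2 +
    (‖B‖ ^ 2 * τ k / (2 * q) + τ k * (‖K + A‖ * ‖K + B‖) / 2) * ‖yt (k + 1) - yt k‖ ^ 2

/-- These are the two coupling inequalities, halved. Of the two copies of `‖K + A‖ ‖K + B‖`, one is
reserved for the next cross term and the other pays for the current one. -/
theorem reserve_le {Lf : ℝ} {q r s t : ℝ} (hC : Coupling K A B Lf q r s t ρ τ σ) {k : ℕ}
    (hk : 1 ≤ k) :
    reserve K A B τ σ q r xt yt k ≤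
      ((s - q) / (2 * τ k) - Lf * ρ k / 2) * ‖xt (k + 1) - xt k‖ ^ 2 +
      ((t - r) / (2 * σ k) - τ k * (‖K + A‖ * ‖K + B‖) / 2) * ‖yt (k + 1) - yt k‖ ^ 2 := by
  have h1 := hC.primal k hk
  have h2 := hC.dual k hk
  unfold reserve
  have e1 : ‖A‖ ^ 2 * σ k / (2 * r) = ‖A‖ ^ 2 * σ k / r / 2 := by rw [mul_comm 2 r, div_div]
  have e2 : ‖B‖ ^ 2 * τ k / (2 * q) = τ k * (‖B‖ ^ 2 / q) / 2 := by ring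
  have e3 : (s - q) / (2 * τ k) = (s - q) / τ k / 2 := by rw [mul_comm 2, div_div]
  have e4 : (t - r) / (2 * σ k) = (t - r) / σ k / 2 := by rw [mul_comm 2, div_div]
  rw [e1, e2, e3, e4]
  refine add_le_add (mul_le_mul_of_nonneg_right (by linarith) (sq_nonneg _))
    (mul_le_mul_of_nonneg_right (by linarith) (sq_nonneg _))

/-- Young's inequality with the weights `σ_k / r` and `τ_k / q`: the old increments produce exactly
the reserve, and the new ones use the shares `q` and `r` of the next quadratic terms. -/
theorem neg_crossTerm_le {q r : ℝ} (hS : StepSizes ρ θ τ σ) (hq : 0 < q) (hr : 0 < r) {k : ℕ}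
    (hk : 1 ≤ k) :
    -crossTerm K A B τ xt yt (k + 1) ≤ reserve K A B τ σ q r xt yt k +
      q / (2 * τ k) * ‖xt (k + 2) - xt (k + 1)‖ ^ 2 +
      (r / (2 * σ k) + τ k * (‖K + A‖ * ‖K + B‖) / 2) * ‖yt (k + 2) - yt (k + 1)‖ ^ 2 := by
  have hτ := hS.tau_pos k hk
  have hσ := hS.sigma_pos k hk
  have h1 := inner_map_le A (xt (k + 1) - xt k) (yt (k + 2) - yt (k + 1)) (div_pos hσ hr)
  have h2 := inner_comp_adjoint_le (K + A) (K + B) (yt (k + 1) - yt k) (yt (k + 2) - yt (k + 1))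
  have h3 : ⟪B (xt (k + 2) - xt (k + 1)), yt (k + 1) - yt k⟫_ℝ ≤
      ‖B‖ ^ 2 * τ k / (2 * q) * ‖yt (k + 1) - yt k‖ ^ 2 +
        q / (2 * τ k) * ‖xt (k + 2) - xt (k + 1)‖ ^ 2 := by
    have h4 : ⟪B (xt (k + 2) - xt (k + 1)), yt (k + 1) - yt k⟫_ℝ ≤
        (‖B‖ * ‖yt (k + 1) - yt k‖) * ‖xt (k + 2) - xt (k + 1)‖ := by
      refine (real_inner_le_norm _ _).trans ?_
      have := mul_le_mul_of_nonneg_right (B.le_opNorm (xt (k + 2) - xt (k + 1)))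
        (norm_nonneg (yt (k + 1) - yt k))
      linarith
    refine h4.trans ((young (div_pos hτ hq)).trans (le_of_eq ?_))
    field_simp
  have h5 := mul_le_mul_of_nonneg_left h2 hτ.le
  rw [← abs_of_pos hτ, ← abs_mul, abs_of_pos hτ] at h5
  have e1 : ‖A‖ ^ 2 * (σ k / r) / 2 * ‖xt (k + 1) - xt k‖ ^ 2 +
      ‖yt (k + 2) - yt (k + 1)‖ ^ 2 / (2 * (σ k / r)) =
      ‖A‖ ^ 2 * σ k / (2 * r) * ‖xt (k + 1) - xt k‖ ^ 2 +
        r / (2 * σ k) * ‖yt (k + 2) - yt (k + 1)‖ ^ 2 := by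
    field_simp
  rw [e1] at h1
  unfold crossTerm reserve
  simp only [Nat.add_sub_cancel]
  have h6 := neg_abs_le ⟪A (xt (k + 1) - xt k), yt (k + 2) - yt (k + 1)⟫_ℝ
  have h7 := neg_abs_le
    (τ k * ⟪(K + A) ((K + B).adjoint (yt (k + 1) - yt k)), yt (k + 2) - yt (k + 1)⟫_ℝ)
  linarith

/-- The last coupling term has no later iteration to absorb it. The same weights as for the cross
terms bound it by the last reserve and the final squared distances, which the telescoped sum still
contains with a negative sign. -/
theorem coupling_le {Lf : ℝ} {q r s t : ℝ} (hS : StepSizes ρ θ τ σ)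
    (hC : Coupling K A B Lf q r s t ρ τ σ) (hq : q ∈ Set.Ioo 0 1) (hr : r ∈ Set.Ioo 0 1)
    (ht : t ∈ Set.Ioo 0 1) (x : Vec p) (y : Vec l) {k : ℕ} (hk : 1 ≤ k) :
    coupling K A B τ xt yt x y k - reserve K A B τ σ q r xt yt k ≤
      ‖x - xt (k + 1)‖ ^ 2 / (2 * τ k) + ‖y - yt (k + 1)‖ ^ 2 / (2 * σ k) := by
  have hτ := hS.tau_pos k hk
  have hσ := hS.sigma_pos k hk
  have hq0 := hq.1
  have hr0 := hr.1
  have h1 := inner_map_le A (xt (k + 1) - xt k) (yt (k + 1) - y) (div_pos hσ hr.1)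
  have h2 := inner_comp_adjoint_le (K + A) (K + B) (yt (k + 1) - yt k) (yt (k + 1) - y)
  have h3 : -⟪B (xt (k + 1) - x), yt (k + 1) - yt k⟫_ℝ ≤
      ‖B‖ ^ 2 * τ k / (2 * q) * ‖yt (k + 1) - yt k‖ ^ 2 +
        q / (2 * τ k) * ‖xt (k + 1) - x‖ ^ 2 := by
    have h4 : -⟪B (xt (k + 1) - x), yt (k + 1) - yt k⟫_ℝ ≤
        (‖B‖ * ‖yt (k + 1) - yt k‖) * ‖xt (k + 1) - x‖ := by
      refine (neg_le_abs _).trans ((abs_real_inner_le_norm _ _).trans ?_)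
      have := mul_le_mul_of_nonneg_right (B.le_opNorm (xt (k + 1) - x))
        (norm_nonneg (yt (k + 1) - yt k))
      linarith
    refine h4.trans ((young (div_pos hτ hq.1)).trans (le_of_eq ?_))
    field_simp
  have h5 := mul_le_mul_of_nonneg_left h2 hτ.le
  rw [← abs_of_pos hτ, ← abs_mul, abs_of_pos hτ] at h5
  have e1 : ‖A‖ ^ 2 * (σ k / r) / 2 * ‖xt (k + 1) - xt k‖ ^ 2 +
      ‖yt (k + 1) - y‖ ^ 2 / (2 * (σ k / r)) =
      ‖A‖ ^ 2 * σ k / (2 * r) * ‖xt (k + 1) - xt k‖ ^ 2 +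
        r / (2 * σ k) * ‖yt (k + 1) - y‖ ^ 2 := by
    field_simp
  rw [e1] at h1
  have h6 := le_abs_self ⟪A (xt (k + 1) - xt k), yt (k + 1) - y⟫_ℝ
  have h7 := le_abs_self
    (τ k * ⟪(K + A) ((K + B).adjoint (yt (k + 1) - yt k)), yt (k + 1) - y⟫_ℝ)
  have h8 : q / (2 * τ k) * ‖xt (k + 1) - x‖ ^ 2 ≤ ‖x - xt (k + 1)‖ ^ 2 / (2 * τ k) := by
    rw [norm_sub_rev x, div_mul_eq_mul_div]
    exact div_le_div_of_nonneg_right (mul_le_of_le_one_left (sq_nonneg _) hq.2.le) (by positivity)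
  have h9 : (r / (2 * σ k) + τ k * (‖K + A‖ * ‖K + B‖) / 2) * ‖yt (k + 1) - y‖ ^ 2 ≤
      ‖y - yt (k + 1)‖ ^ 2 / (2 * σ k) := by
    rw [norm_sub_rev y, div_eq_mul_one_div (‖yt (k + 1) - y‖ ^ 2), mul_comm]
    refine mul_le_mul_of_nonneg_left ?_ (sq_nonneg _)
    have hd := hC.dual k hk
    have h10 : 0 ≤ τ k * (‖B‖ ^ 2 / q) := by positivity
    have h12 : 0 ≤ τ k * (‖K + A‖ * ‖K + B‖) := by positivity
    have h11 : (t - r) / σ k ≤ (1 - r) / σ k :=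
      div_le_div_of_nonneg_right (by linarith [ht.2]) hσ.le
    have e : 1 / (2 * σ k) = r / (2 * σ k) + (1 - r) / σ k / 2 := by
      field_simp
      ring
    rw [e]
    nlinarith
  unfold coupling reserve
  linarith

/-- The gap at any reference point, in terms of the accumulated oracle errors. -/
theorem gapAt_le (hN : NoisyIteration f h K A B ρ θ τ σ xs xt ys yt δx δy)
    (hh : ClosedProperConvex h) (hS : StepSizes ρ θ τ σ) (hc : ConvexOn ℝ Set.univ f)
    (hf : Differentiable ℝ f) {L : ℝ≥0} (hL : LipschitzWith L (gradient f)) {q r s t : ℝ}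
    (hC : Coupling K A B L q r s t ρ τ σ) (hq : q ∈ Set.Ioo 0 1) (hr : r ∈ Set.Ioo 0 1)
    (ht : t ∈ Set.Ioo 0 1) {ΩX ΩY : ℝ} {x : Vec p} {y : Vec l} (hy : conjugate h y ≠ ⊤)
    (hX : ∀ k, 1 ≤ k → ‖x - xt k‖ ^ 2 ≤ 2 * ΩX ^ 2) (hY : ∀ k, 1 ≤ k → ‖y - yt k‖ ^ 2 ≤ 2 * ΩY ^ 2)
    {k : ℕ} (hk : 1 ≤ k) :
    gam θ k / ρ k * gapAt f h K x y (xs (k + 1)) (ys (k + 1)) ≤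
      gam θ k / τ k * ΩX ^ 2 + gam θ k / σ k * ΩY ^ 2 +
        ∑ i ∈ Finset.Icc 1 k, gam θ i * noiseAt τ σ s t xt yt δx δy x y i := by
  have hstep : ∀ k, 1 ≤ k → gam θ k / ρ k * gapAt f h K x y (xs (k + 1)) (ys (k + 1)) ≤
      gam θ k * ((ρ k)⁻¹ - 1) * gapAt f h K x y (xs k) (ys k) + gam θ k *
      ((‖x - xt k‖ ^ 2 - ‖x - xt (k + 1)‖ ^ 2) / (2 * τ k) +
      (‖y - yt k‖ ^ 2 - ‖y - yt (k + 1)‖ ^ 2) / (2 * σ k) -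
      (s / (2 * τ k) - L * ρ k / 2) * ‖xt (k + 1) - xt k‖ ^ 2 -
      t / (2 * σ k) * ‖yt (k + 1) - yt k‖ ^ 2 +
      coupling K A B τ xt yt x y k - θ k * coupling K A B τ xt yt x y (k - 1) -
      θ k * crossTerm K A B τ xt yt k + noiseAt τ σ s t xt yt δx δy x y k) := by
    intro k hk
    obtain ⟨hρ0, hρ1⟩ := hS.rho_mem hk
    have h1 := hN.gapAt_succ_le hh hS hc hf hL x y hk
    have h2 := hN.linearized_gap_le hh hS s t x y hy hk
    have h3 := mul_le_mul_of_nonneg_left h1 (div_pos (hS.gam_pos hk) hρ0).le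
    have h4 := mul_le_mul_of_nonneg_left h2 (hS.gam_pos hk).le
    refine h3.trans ?_
    have e : ∀ a b : ℝ, gam θ k / ρ k * ((1 - ρ k) * a + ρ k * b) =
        gam θ k * ((ρ k)⁻¹ - 1) * a + gam θ k * b := by
      intro a b
      field_simp
    rw [e]
    ring_nf at h4 ⊢
    linarith
  -- The induction carries the final distances and the unspent reserve, so that the next cross term
  -- can be paid from it.
  have main : ∀ k, 1 ≤ k → gam θ k / ρ k * gapAt f h K x y (xs (k + 1)) (ys (k + 1)) ≤
      gam θ k / τ k * (ΩX ^ 2 - ‖x - xt (k + 1)‖ ^ 2 / 2) +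
      gam θ k / σ k * (ΩY ^ 2 - ‖y - yt (k + 1)‖ ^ 2 / 2) +
      gam θ k * (coupling K A B τ xt yt x y k - reserve K A B τ σ q r xt yt k) +
      ∑ i ∈ Finset.Icc 1 k, gam θ i * noiseAt τ σ s t xt yt δx δy x y i := by
    intro k hk
    induction k, hk using Nat.le_induction with
    | base =>
      have h1 := hstep 1 le_rfl
      have h2 := reserve_le (xt := xt) (yt := yt) hC le_rfl
      have hτ := hS.tau_pos 1 le_rfl
      have hσ := hS.sigma_pos 1 le_rfl
      -- The index 0 enters only through increments that vanish by `x̃⁰ = x̃¹` and `ỹ⁰ = ỹ¹`, so the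
      -- unconstrained `τ 0` does no harm.
      have c0 : coupling K A B τ xt yt x y 0 = 0 := by
        simp [coupling, hN.xt_zero, hN.yt_zero]
      have c1 : crossTerm K A B τ xt yt 1 = 0 := by
        simp [crossTerm, hN.xt_zero, hN.yt_zero]
      have hX1 := div_le_div_of_nonneg_right (hX 1 le_rfl) (by positivity : 0 ≤ 2 * τ 1)
      have hY1 := div_le_div_of_nonneg_right (hY 1 le_rfl) (by positivity : 0 ≤ 2 * σ 1)
      have hq2 : 0 ≤ q / (2 * τ 1) * ‖xt (1 + 1) - xt 1‖ ^ 2 := by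
        have := hq.1
        positivity
      have hr2 : 0 ≤ (r / (2 * σ 1) + τ 1 * (‖K + A‖ * ‖K + B‖) / 2) *
          ‖yt (1 + 1) - yt 1‖ ^ 2 := by
        have := hr.1
        positivity
      have g1 : gam θ 1 = 1 := rfl
      simp only [Nat.sub_self, c0, c1, hS.rho_one, g1, inv_one, sub_self, mul_zero, zero_mul,
        sub_zero, zero_add, one_mul, Finset.Icc_self, Finset.sum_singleton] at h1 h2 ⊢
      rw [mul_one] at h1 h2
      ring_nf at h1 h2 hX1 hY1 hq2 hr2 ⊢
      linarith
    | succ k hk ih =>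
      have h1 := hstep (k + 1) (by omega)
      have h2 := reserve_le (xt := xt) (yt := yt) hC (k := k + 1) (by omega)
      have h3 := neg_crossTerm_le (K := K) (A := A) (B := B) (xt := xt) (yt := yt) hS hq.1 hr.1 hk
      have hg := hS.gam_pos hk
      have hg' := hS.gam_pos (k := k + 1) (by omega)
      rw [hS.gam_div_rho hk] at h1
      rw [Finset.sum_Icc_succ_top (by omega)]
      simp only [Nat.add_sub_cancel] at h1
      have h4 := mul_le_mul_of_nonneg_left h3 hg.le
      have h5 := mul_le_mul_of_nonneg_left h2 hg'.le
      have hm : 0 ≤ ‖K + A‖ * ‖K + B‖ := by positivity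
      -- Raising the weight of the squared distance from `γ_k/τ_k` to `γ_{k+1}/τ_{k+1}` is paid by
      -- the diameter bound. The next three facts raise the weights of the increments in the cross
      -- term likewise.
      have hX1 := mul_nonneg (sub_nonneg.2 (hS.gam_div_tau_le hk))
        (sub_nonneg.2 (hX (k + 1) (by omega)))
      have hY1 := mul_nonneg (sub_nonneg.2 (hS.gam_div_sigma_le hk))
        (sub_nonneg.2 (hY (k + 1) (by omega)))
      have hX2 := mul_nonneg (sub_nonneg.2 (hS.gam_div_tau_le hk))
        (mul_nonneg hq.1.le (sq_nonneg ‖xt (k + 2) - xt (k + 1)‖))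
      have hY2 := mul_nonneg (sub_nonneg.2 (hS.gam_div_sigma_le hk))
        (mul_nonneg hr.1.le (sq_nonneg ‖yt (k + 2) - yt (k + 1)‖))
      have hY3 := mul_nonneg (sub_nonneg.2 (hS.gam_mul_tau_le hk))
        (mul_nonneg hm (sq_nonneg ‖yt (k + 2) - yt (k + 1)‖))
      have e1 : gam θ (k + 1) * (θ (k + 1) * coupling K A B τ xt yt x y k) =
          gam θ k * coupling K A B τ xt yt x y k := by
        rw [← mul_assoc, hS.gam_succ_mul hk]
      have e2 : gam θ (k + 1) * (θ (k + 1) * crossTerm K A B τ xt yt (k + 1)) =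
          gam θ k * crossTerm K A B τ xt yt (k + 1) := by
        rw [← mul_assoc, hS.gam_succ_mul hk]
      refine h1.trans ?_
      rw [show k + 1 + 1 = k + 2 from rfl] at *
      ring_nf at ih h4 h5 hX1 hY1 hX2 hY2 hY3 e1 e2 ⊢
      linarith
  refine (main k hk).trans ?_
  have h1 := mul_le_mul_of_nonneg_left
    (coupling_le (xt := xt) (yt := yt) hS hC hq hr ht x y hk) (hS.gam_pos hk).le
  ring_nf at h1 ⊢
  linarith

end NoisyIteration

end Deterministic

/-! ### Elementary inequalities for the exponential function -/

section Exp

open Real Finset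

/-- The partial sums of the series of `exp (-x)` bound it alternately from above and below for `x ≥
0`: each signed remainder vanishes at 0 and has the previous one as its derivative. -/
theorem alternating_taylor_exp_neg (n : ℕ) :
    ∀ x : ℝ, 0 ≤ x → 0 ≤ (-1) ^ n * (exp (-x) - ∑ i ∈ range n, (-x) ^ i / (i.factorial : ℝ)) := by
  induction n with
  | zero =>
    intro x _
    simpa using (exp_pos (-x)).le
  | succ n ih =>
    intro x hx
    let F : ℝ → ℝ := fun x =>
      (-1) ^ (n + 1) * (exp (-x) - ∑ i ∈ range (n + 1), (-x) ^ i / (i.factorial : ℝ))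
    have hsum : ∀ x : ℝ, HasDerivAt (fun x : ℝ => ∑ i ∈ range (n + 1), (-x) ^ i / (i.factorial : ℝ))
        (-∑ i ∈ range n, (-x) ^ i / (i.factorial : ℝ)) x := by
      intro x
      have h1 := HasDerivAt.fun_sum (u := range (n + 1)) fun i _ =>
        (((hasDerivAt_id x).neg.pow i).div_const (i.factorial : ℝ))
      refine HasDerivAt.congr_deriv h1 ?_
      rw [Finset.sum_range_succ', ← Finset.sum_neg_distrib]
      simp only [Nat.cast_zero, zero_mul, zero_div, add_zero]
      refine Finset.sum_congr rfl fun i _ => ?_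
      have : (i.factorial : ℝ) ≠ 0 := by positivity
      rw [Nat.factorial_succ]
      push_cast
      simp only [Pi.neg_apply, id]
      field_simp
    have hF : ∀ x, HasDerivAt F
        ((-1) ^ n * (exp (-x) - ∑ i ∈ range n, (-x) ^ i / (i.factorial : ℝ))) x := by
      intro x
      have h1 := (((hasDerivAt_id x).neg.exp).sub (hsum x)).const_mul ((-1 : ℝ) ^ (n + 1))
      refine HasDerivAt.congr_deriv h1 ?_
      simp only [id, pow_succ, Pi.neg_apply]
      ring
    have hmono : MonotoneOn F (Set.Ici 0) := by
      refine monotoneOn_of_deriv_nonneg (convex_Ici 0)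
        (fun c _ => (hF c).continuousAt.continuousWithinAt)
        (fun c _ => (hF c).differentiableAt.differentiableWithinAt) fun c hc => ?_
      rw [interior_Ici] at hc
      rw [(hF c).deriv]
      exact ih c (le_of_lt hc)
    have h0 : F 0 = 0 := by
      simp [F, Finset.sum_range_succ']
    have := hmono Set.self_mem_Ici hx hx
    rwa [h0] at this

/-- The linear term has conditional mean zero when `x` is a centered increment, so only the
exponential of a square is left of its moment generating function. -/
theorem exp_le_add_exp_sq (x : ℝ) : exp x ≤ x + exp (9 * x ^ 2 / 16) := by
  rcases le_total x 0 with hx | hx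
  · have h1 := alternating_taylor_exp_neg 3 (-x) (by linarith)
    have h2 := add_one_le_exp (9 * x ^ 2 / 16)
    simp [Finset.sum_range_succ, Nat.factorial] at h1
    nlinarith [sq_nonneg x]
  · rcases le_total (16 / 9) x with hx1 | hx1
    · have : exp x ≤ exp (9 * x ^ 2 / 16) := exp_le_exp.2 (by nlinarith)
      linarith
    -- Since `9 x² / 16 = x - x v`, the claim becomes `1 - exp (-x v) ≤ x exp (-x)`. Taylor
    -- polynomials of degrees 3 and 5 bound the two exponentials from below and leave a polynomial
    -- inequality.
    · set v := 1 - 9 / 16 * x with hv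
      have hv0 : 0 ≤ v := by rw [hv]; linarith
      have hw : 0 ≤ x * v := mul_nonneg hx hv0
      have h1 := alternating_taylor_exp_neg 4 (x * v) hw
      have h2 := alternating_taylor_exp_neg 6 x hx
      simp [Finset.sum_range_succ, Nat.factorial] at h1 h2
      have hpoly : v * (1 - x * v / 2 + (x * v) ^ 2 / 6) ≤
          1 - x + x ^ 2 / 2 - x ^ 3 / 6 + x ^ 4 / 24 - x ^ 5 / 120 := by
        have e : 1 - x + x ^ 2 / 2 - x ^ 3 / 6 + x ^ 4 / 24 - x ^ 5 / 120 -
            v * (1 - x * v / 2 + (x * v) ^ 2 / 6) =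
            x * (1 / 16 - 11 / 48 * x + 419 / 1536 * x ^ 2 - 179 / 1536 * x ^ 3 +
              2621 / 122880 * x ^ 4) := by
          rw [hv]
          ring
        -- The squares given below complete the quartic to a sum of squares.
        have hq : 0 ≤ 1 / 16 - 11 / 48 * x + 419 / 1536 * x ^ 2 - 179 / 1536 * x ^ 3 +
              2621 / 122880 * x ^ 4 := by
          nlinarith [sq_nonneg (1 - 11 / 6 * x + 56 / 125 * x ^ 2),
            sq_nonneg (x - 7989 / 7738 * x ^ 2), sq_nonneg (x ^ 2), sq_nonneg x]
        have := mul_nonneg hx hq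
        linarith
      have h3 : v * (1 - x * v / 2 + (x * v) ^ 2 / 6) ≤ exp (-x) := by linarith
      have h4 : 1 - exp (-(x * v)) ≤ x * exp (-x) := by
        have := mul_le_mul_of_nonneg_left h3 hx
        linarith
      have h5 : exp (9 * x ^ 2 / 16) = exp x * exp (-(x * v)) := by
        rw [← exp_add, hv]
        congr 1
        ring
      have h6 : exp x * exp (-x) = 1 := by rw [← exp_add]; simp
      have h7 := mul_le_mul_of_nonneg_left h4 (exp_pos x).le
      rw [mul_left_comm, h6, mul_one] at h7
      rw [h5]
      linarith

/-- Young's inequality for `exp (κ w)`, the tangent of the power function at `e`. -/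
theorem exp_mul_le {κ : ℝ} (h0 : 0 ≤ κ) (h1 : κ ≤ 1) (w : ℝ) :
    exp (κ * w) ≤ κ * exp (κ - 1) * exp w + (1 - κ) * exp κ := by
  have h2 := convexOn_exp.2 (Set.mem_univ (w - 1)) (Set.mem_univ 0) h0 (sub_nonneg.2 h1) (by ring)
  simp only [smul_eq_mul, mul_zero, add_zero, exp_zero, mul_one] at h2
  have h3 := mul_le_mul_of_nonneg_left h2 (exp_pos κ).le
  rw [← exp_add] at h3
  have e1 : κ + κ * (w - 1) = κ * w := by ring
  have e2 : exp (κ - 1) * exp w = exp κ * exp (w - 1) := by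
    rw [← exp_add, ← exp_add]
    congr 1
    ring
  rw [e1] at h3
  calc exp (κ * w) ≤ exp κ * (κ * exp (w - 1) + (1 - κ)) := h3
    _ = κ * (exp κ * exp (w - 1)) + (1 - κ) * exp κ := by ring
    _ = κ * exp (κ - 1) * exp w + (1 - κ) * exp κ := by rw [← e2]; ring

end Exp

/-! ### Second moments -/

section SecondMoment

variable {Ω : Type*} {m mΩ : MeasurableSpace Ω} {μ : Measure Ω} {n k : ℕ}

theorem MemLp_two_integrable_inner {d Z : Ω → Vec n} (hZ : MemLp Z 2 μ) (hd : MemLp d 2 μ) :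
    Integrable (fun ω => ⟪Z ω, d ω⟫_ℝ) μ := by
  refine (hZ.norm.integrable_mul hd.norm).mono' (hZ.1.inner hd.1) (ae_of_all _ fun ω => ?_)
  exact norm_inner_le_norm _ _

theorem MemLp_two_of_bounded [IsFiniteMeasure μ] {Z : Ω → Vec n} (hZ : Measurable Z) {R : ℝ}
    (hR : ∀ᵐ ω ∂μ, ‖Z ω‖ ≤ R) : MemLp Z 2 μ :=
  MemLp.of_bound hZ.aestronglyMeasurable R hR

/-- A factor known before the call can be taken out of the conditional expectation, which vanishes.
-/
theorem integral_inner_eq_zero [IsFiniteMeasure μ] (hm : m ≤ mΩ) {d Z : Ω → Vec n}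
    (hd : Integrable d μ) (h0 : μ[d | m] =ᵐ[μ] 0) (hZ : Measurable[m] Z)
    (hZd : Integrable (fun ω => ⟪Z ω, d ω⟫_ℝ) μ) : ∫ ω, ⟪Z ω, d ω⟫_ℝ ∂μ = 0 := by
  have h1 : μ[fun ω => ⟪Z ω, d ω⟫_ℝ | m] =ᵐ[μ] fun ω => ⟪Z ω, μ[d | m] ω⟫_ℝ :=
    condExp_bilin_of_stronglyMeasurable_left (m := m) (innerSL ℝ) (f := Z) (g := d)
      hZ.stronglyMeasurable hZd hd
  have h2 : μ[fun ω => ⟪Z ω, d ω⟫_ℝ | m] =ᵐ[μ] 0 := by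
    filter_upwards [h1, h0] with ω hω hω'
    rw [hω, hω']
    simp
  rw [← integral_condExp hm, integral_congr_ae h2]
  simp

/-- Adding a conditionally centered error to something known before adds the second moments. -/
theorem integral_norm_add_sq_le [IsFiniteMeasure μ] (hm : m ≤ mΩ) {d : Ω → Vec n}
    {P : Ω → Vec k} (hd : MemLp d 2 μ) (h0 : μ[d | m] =ᵐ[μ] 0) (hP : MemLp P 2 μ)
    (hPm : Measurable[m] P) (T : Vec n →L[ℝ] Vec k) :
    MemLp (fun ω => P ω + T (d ω)) 2 μ ∧
      ∫ ω, ‖P ω + T (d ω)‖ ^ 2 ∂μ ≤ ∫ ω, ‖P ω‖ ^ 2 ∂μ + ‖T‖ ^ 2 * ∫ ω, ‖d ω‖ ^ 2 ∂μ := by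
  have hTd : MemLp (fun ω => T (d ω)) 2 μ := T.comp_memLp' hd
  refine ⟨hP.add hTd, ?_⟩
  have hPi := (memLp_two_iff_integrable_sq_norm hP.1).1 hP
  have hdi := (memLp_two_iff_integrable_sq_norm hd.1).1 hd
  have hTi := (memLp_two_iff_integrable_sq_norm hTd.1).1 hTd
  have hcross : ∫ ω, ⟪P ω, T (d ω)⟫_ℝ ∂μ = 0 := by
    have e : ∀ ω, ⟪P ω, T (d ω)⟫_ℝ = ⟪T.adjoint (P ω), d ω⟫_ℝ := fun ω =>
      (ContinuousLinearMap.adjoint_inner_left T _ _).symm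
    simp only [e]
    exact integral_inner_eq_zero hm (hd.integrable one_le_two) h0
      (T.adjoint.continuous.measurable.comp hPm)
      (MemLp_two_integrable_inner (T.adjoint.comp_memLp' hP) hd)
  have hci := MemLp_two_integrable_inner hP hTd
  calc ∫ ω, ‖P ω + T (d ω)‖ ^ 2 ∂μ
      = ∫ ω, (‖P ω‖ ^ 2 + 2 * ⟪P ω, T (d ω)⟫_ℝ + ‖T (d ω)‖ ^ 2) ∂μ := by
        simp only [norm_add_sq_real]
    _ = ∫ ω, ‖P ω‖ ^ 2 ∂μ + ∫ ω, ‖T (d ω)‖ ^ 2 ∂μ := by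
        rw [integral_add (hPi.fun_add (hci.const_mul 2)) hTi, integral_add hPi (hci.const_mul 2),
          integral_const_mul, hcross]
        ring
    _ ≤ ∫ ω, ‖P ω‖ ^ 2 ∂μ + ∫ ω, ‖T‖ ^ 2 * ‖d ω‖ ^ 2 ∂μ := by
        refine add_le_add_right (integral_mono hTi (hdi.const_mul _) fun ω => ?_) _
        have := T.le_opNorm (d ω)
        simp only [← mul_pow]
        exact pow_le_pow_left₀ (norm_nonneg _) this 2
    _ = _ := by rw [integral_const_mul]

end SecondMoment

/-! ### Support functions of bounded sets -/

section Support

variable {n : ℕ}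

/-- The support function of `X`. -/
def suppFun (X : Set (Vec n)) (v : Vec n) : ℝ := ⨆ x : X, ⟪v, (x : Vec n)⟫_ℝ

variable {X : Set (Vec n)} {R : ℝ}

theorem suppFun_bddAbove (hR : ∀ x ∈ X, ‖x‖ ≤ R) (v : Vec n) :
    BddAbove (Set.range fun x : X => ⟪v, (x : Vec n)⟫_ℝ) := by
  refine ⟨‖v‖ * R, ?_⟩
  rintro _ ⟨x, rfl⟩
  exact (real_inner_le_norm _ _).trans
    (mul_le_mul_of_nonneg_left (hR x x.2) (norm_nonneg _))

theorem le_suppFun (hR : ∀ x ∈ X, ‖x‖ ≤ R) (v : Vec n) {x : Vec n} (hx : x ∈ X) :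
    ⟪v, x⟫_ℝ ≤ suppFun X v :=
  le_ciSup (suppFun_bddAbove hR v) ⟨x, hx⟩

theorem suppFun_le (hne : X.Nonempty) {v : Vec n} {M : ℝ} (H : ∀ x ∈ X, ⟪v, x⟫_ℝ ≤ M) :
    suppFun X v ≤ M := by
  have := hne.to_subtype
  exact ciSup_le fun x => H x x.2

theorem suppFun_sub_le (hne : X.Nonempty) (hR : ∀ x ∈ X, ‖x‖ ≤ R) (v w : Vec n) :
    suppFun X v - suppFun X w ≤ R * ‖v - w‖ := by
  rw [sub_le_iff_le_add]
  refine suppFun_le hne fun x hx => ?_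
  have h1 := le_suppFun hR w hx
  have h2 := (real_inner_le_norm (v - w) x).trans
    (mul_le_mul_of_nonneg_left (hR x hx) (norm_nonneg _))
  rw [inner_sub_left] at h2
  linarith

theorem abs_suppFun_le (hne : X.Nonempty) (hR : ∀ x ∈ X, ‖x‖ ≤ R) (v : Vec n) :
    |suppFun X v| ≤ R * ‖v‖ := by
  have h0 : suppFun X 0 = 0 := by
    have := hne.to_subtype
    simp [suppFun]
  have h1 := suppFun_sub_le hne hR v 0
  have h2 := suppFun_sub_le hne hR 0 v
  rw [h0, sub_zero, sub_zero] at h1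
  rw [h0, zero_sub, zero_sub, norm_neg] at h2
  exact abs_le.2 ⟨by linarith, h1⟩

theorem continuous_suppFun (hne : X.Nonempty) (hR : ∀ x ∈ X, ‖x‖ ≤ R) :
    Continuous (suppFun X) := by
  have hR0 : 0 ≤ R := (norm_nonneg _).trans (hR _ hne.some_mem)
  refine (LipschitzWith.of_dist_le_mul (K := ⟨R, hR0⟩) fun v w => ?_).continuous
  rw [Real.dist_eq, dist_eq_norm]
  refine abs_sub_le_iff.2 ⟨suppFun_sub_le hne hR v w, ?_⟩
  rw [norm_sub_rev]
  exact suppFun_sub_le hne hR w v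

/-- The left side is the width of `X` in the direction `v`, scaled by `‖v‖`. It depends only on the
diameter, not on the position of `X`. -/
theorem suppFun_add_neg_le (hne : X.Nonempty) {D : ℝ}
    (hD : ∀ x ∈ X, ∀ x' ∈ X, ‖x - x'‖ ≤ D) (v : Vec n) :
    suppFun X v + suppFun X (-v) ≤ D * ‖v‖ := by
  rw [← le_sub_iff_add_le]
  refine suppFun_le hne fun x hx => ?_
  rw [le_sub_comm]
  refine suppFun_le hne fun x' hx' => ?_
  have := (real_inner_le_norm v (x - x')).trans
    (mul_le_mul_of_nonneg_left (hD x hx x' hx') (norm_nonneg _))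
  rw [inner_sub_right] at this
  rw [inner_neg_left]
  linarith

variable {Ω : Type*} {mΩ : MeasurableSpace Ω} {μ : Measure Ω}

theorem integrable_suppFun (hne : X.Nonempty) (hR : ∀ x ∈ X, ‖x‖ ≤ R) {S : Ω → Vec n}
    (hS : Integrable S μ) : Integrable (fun ω => suppFun X (S ω)) μ :=
  (hS.norm.const_mul R).mono' ((continuous_suppFun hne hR).comp_aestronglyMeasurable hS.1)
    (ae_of_all _ fun ω => abs_suppFun_le hne hR (S ω))

/-- The mean of the support function at a centered random vector. The constant comes from
symmetrization with an independent copy. -/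
theorem integral_suppFun_le [IsProbabilityMeasure μ] (hne : X.Nonempty) (hR : ∀ x ∈ X, ‖x‖ ≤ R)
    {D : ℝ} (hD : ∀ x ∈ X, ∀ x' ∈ X, ‖x - x'‖ ^ 2 ≤ 2 * D ^ 2) {S : Ω → Vec n}
    (hS : MemLp S 2 μ) (h0 : ∫ ω, S ω ∂μ = 0) {a : ℝ} (ha : 0 < a) :
    ∫ ω, suppFun X (S ω) ∂μ ≤ a * D ^ 2 + (∫ ω, ‖S ω‖ ^ 2 ∂μ) / (4 * a) := by
  have hSi := hS.integrable one_le_two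
  have hS2 := (memLp_two_iff_integrable_sq_norm hS.1).1 hS
  have hpair : MemLp (fun z : Ω × Ω => S z.1 - S z.2) 2 (μ.prod μ) :=
    (hS.comp_fst μ).sub (hS.comp_snd μ)
  have hpi := hpair.integrable one_le_two
  have hp2 := (memLp_two_iff_integrable_sq_norm hpair.1).1 hpair
  have hgi := integrable_suppFun hne hR hpi
  have hDs : ∀ x ∈ X, ∀ x' ∈ X, ‖x - x'‖ ≤ √(2 * D ^ 2) := fun x hx x' hx' =>
    Real.le_sqrt_of_sq_le (hD x hx x' hx')
  -- The second coordinate is an independent copy of mean zero. Subtracting it does not lower the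
  -- mean of a convex function.
  have hjensen : ∫ ω, suppFun X (S ω) ∂μ ≤
      ∫ z, suppFun X (S z.1 - S z.2) ∂(μ.prod μ) := by
    rw [integral_prod _ hgi]
    refine integral_mono (integrable_suppFun hne hR hSi) hgi.integral_prod_left fun ω => ?_
    refine suppFun_le hne fun x hx => ?_
    have hi : Integrable (fun ω' => S ω - S ω') μ := (integrable_const _).sub hSi
    calc ⟪S ω, x⟫_ℝ = ∫ ω', ⟪S ω - S ω', x⟫_ℝ ∂μ := by
          have : ∀ ω', ⟪S ω - S ω', x⟫_ℝ = ⟪x, S ω - S ω'⟫_ℝ := fun ω' => real_inner_comm _ _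
          simp only [this]
          rw [integral_inner hi, integral_sub (integrable_const _) hSi, h0]
          simp [real_inner_comm]
      _ ≤ ∫ ω', suppFun X (S ω - S ω') ∂μ :=
          integral_mono (hi.inner_const x) (integrable_suppFun hne hR hi)
            fun ω' => le_suppFun hR _ hx
  -- Exchanging the copies flips the sign of the difference. Averaging both forms brings in the
  -- width, and the doubled variance of the difference still leaves the factor `1/(4a)`.
  have hswap : ∫ z, suppFun X (S z.1 - S z.2) ∂(μ.prod μ) =
      ∫ z, suppFun X (-(S z.1 - S z.2)) ∂(μ.prod μ) := by
    rw [← integral_prod_swap]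
    simp
  have hsq : ∫ z, ‖S z.1 - S z.2‖ ^ 2 ∂(μ.prod μ) = 2 * ∫ ω, ‖S ω‖ ^ 2 ∂μ := by
    have hin : Integrable (fun z : Ω × Ω => ⟪S z.1, S z.2⟫_ℝ) (μ.prod μ) :=
      MemLp_two_integrable_inner (hS.comp_fst μ) (hS.comp_snd μ)
    have h1 : ∫ z : Ω × Ω, ⟪S z.1, S z.2⟫_ℝ ∂(μ.prod μ) = 0 := by
      rw [integral_prod _ hin]
      simp [integral_inner hSi, h0]
    have h2 : Integrable (fun z : Ω × Ω => ‖S z.1‖ ^ 2) (μ.prod μ) := hS2.comp_fst μ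
    have h3 : Integrable (fun z : Ω × Ω => ‖S z.2‖ ^ 2) (μ.prod μ) := hS2.comp_snd μ
    have h4 : Integrable (fun z : Ω × Ω => ‖S z.1‖ ^ 2 - 2 * ⟪S z.1, S z.2⟫_ℝ) (μ.prod μ) :=
      h2.sub (hin.const_mul 2)
    simp only [norm_sub_sq_real]
    rw [integral_add h4 h3, integral_sub h2 (hin.const_mul 2),
      integral_const_mul, h1, integral_fun_fst (fun ω => ‖S ω‖ ^ 2),
      integral_fun_snd (fun ω => ‖S ω‖ ^ 2)]
    simp
    ring
  have hneg : Integrable (fun z : Ω × Ω => suppFun X (-(S z.1 - S z.2))) (μ.prod μ) :=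
    integrable_suppFun hne hR hpi.neg
  have hsum : 2 * ∫ z, suppFun X (S z.1 - S z.2) ∂(μ.prod μ) ≤
      ∫ z, (2 * a * D ^ 2 + 1 / (4 * a) * ‖S z.1 - S z.2‖ ^ 2) ∂(μ.prod μ) := by
    rw [two_mul]
    nth_rewrite 2 [hswap]
    rw [← integral_add hgi hneg]
    refine integral_mono (hgi.add hneg) ((integrable_const _).add (hp2.const_mul _)) fun z => ?_
    refine (suppFun_add_neg_le hne hDs _).trans ?_
    have h1 := young (a := √(2 * D ^ 2)) (b := ‖S z.1 - S z.2‖) (c := 2 * a) (by positivity)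
    rw [Real.sq_sqrt (by positivity)] at h1
    refine h1.trans (le_of_eq ?_)
    field_simp
    ring
  rw [integral_add (integrable_const _) (hp2.const_mul _), integral_const_mul (1 / (4 * a)),
    hsq] at hsum
  simp only [integral_const, probReal_univ, smul_eq_mul, one_mul] at hsum
  refine hjensen.trans ?_
  have e : (∫ ω, ‖S ω‖ ^ 2 ∂μ) / (4 * a) = 1 / (4 * a) * ∫ ω, ‖S ω‖ ^ 2 ∂μ := by ring
  rw [e]
  linarith

end Support

/-! ### Measurability of the iterates -/

section Measurability

variable {Ω : Type*} {p l : ℕ} {Z : Iterates Ω p l} {h : Vec l → EReal} {ρ θ τ σ : ℕ → ℝ}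
  {g : ℕ → Ω → Vec p} {u : ℕ → Ω → Vec l} {v : ℕ → Ω → Vec p}

namespace Iterates.Driven

/-- The σ-algebra is arbitrary because `ỹ^{k+1}` is needed within iteration `k`: later calls of that
iteration query it, and their errors must be orthogonal to it. -/
theorem measurable_yt_succ (hD : Z.Driven h ρ τ σ g u v) (hh : ClosedProperConvex h)
    (hS : StepSizes ρ θ τ σ) {m : MeasurableSpace Ω} {k : ℕ} (hk : 1 ≤ k)
    (hy : Measurable[m] (Z.yt k)) (hu : Measurable[m] (u k)) : Measurable[m] (Z.yt (k + 1)) :=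
  IsProx.measurable hh (hS.sigma_pos k hk) (hy.add (hu.const_smul (σ k))) (hD.yt_succ k hk)

variable {𝓖 : ℕ → MeasurableSpace Ω}

theorem measurable_tilde (hD : Z.Driven h ρ τ σ g u v) (hh : ClosedProperConvex h)
    (hS : StepSizes ρ θ τ σ) (hmono : ∀ k, 1 ≤ k → 𝓖 k ≤ 𝓖 (k + 1))
    (hg : ∀ k, 1 ≤ k → Measurable[𝓖 (k + 1)] (g k))
    (hu : ∀ k, 1 ≤ k → Measurable[𝓖 (k + 1)] (u k))
    (hv : ∀ k, 1 ≤ k → Measurable[𝓖 (k + 1)] (v k)) {k : ℕ} (hk : 1 ≤ k) :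
    Measurable[𝓖 k] (Z.xt k) ∧ Measurable[𝓖 k] (Z.yt k) := by
  induction k, hk using Nat.le_induction with
  | base =>
    obtain ⟨c, hc⟩ := hD.xt_one
    obtain ⟨c', hc'⟩ := hD.yt_one
    rw [funext hc, funext hc']
    exact ⟨measurable_const, measurable_const⟩
  | succ k hk ih =>
    have hx := ih.1.mono (hmono k hk) le_rfl
    have hy := ih.2.mono (hmono k hk) le_rfl
    refine ⟨?_, hD.measurable_yt_succ hh hS hk hy (hu k hk)⟩
    rw [funext (hD.xt_succ k hk)]
    exact hx.sub (((hg k hk).add (hv k hk)).const_smul (τ k))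

theorem measurable_diff (hD : Z.Driven h ρ τ σ g u v)
    (hmono : ∀ k, 1 ≤ k → 𝓖 k ≤ 𝓖 (k + 1))
    (hx : ∀ k, 1 ≤ k → Measurable[𝓖 k] (Z.xt k)) (hy : ∀ k, 1 ≤ k → Measurable[𝓖 k] (Z.yt k))
    {k : ℕ} (hk : 1 ≤ k) : Measurable[𝓖 k] (Z.dx k) ∧ Measurable[𝓖 k] (Z.dy k) := by
  have hprev : Measurable[𝓖 k] (Z.xt (k - 1)) ∧ Measurable[𝓖 k] (Z.yt (k - 1)) := by
    rcases hk.eq_or_lt with rfl | hk1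
    · rw [Nat.sub_self, funext hD.xt_zero, funext hD.yt_zero]
      exact ⟨hx 1 le_rfl, hy 1 le_rfl⟩
    · obtain ⟨n, rfl⟩ : ∃ n, k = n + 1 := ⟨k - 1, by omega⟩
      exact ⟨(hx n (by omega)).mono (hmono n (by omega)) le_rfl,
        (hy n (by omega)).mono (hmono n (by omega)) le_rfl⟩
  exact ⟨(hx k hk).sub hprev.1, (hy k hk).sub hprev.2⟩

/-- Nothing is known about `x¹` and `y¹`, which may even be nonmeasurable, so the averages are
treated only from the index 2 on. -/
theorem measurable_average (hD : Z.Driven h ρ τ σ g u v) (hS : StepSizes ρ θ τ σ)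
    (hmono : ∀ k, 1 ≤ k → 𝓖 k ≤ 𝓖 (k + 1))
    (hx : ∀ k, 1 ≤ k → Measurable[𝓖 k] (Z.xt k)) (hy : ∀ k, 1 ≤ k → Measurable[𝓖 k] (Z.yt k))
    {k : ℕ} (hk : 1 ≤ k) :
    Measurable[𝓖 (k + 1)] (Z.x (k + 1)) ∧ Measurable[𝓖 (k + 1)] (Z.y (k + 1)) := by
  induction k, hk using Nat.le_induction with
  | base =>
    rw [funext (hD.x_succ 1 le_rfl), funext (hD.y_succ 1 le_rfl)]
    simp only [hS.rho_one, sub_self, zero_smul, one_smul, zero_add]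
    exact ⟨hx _ (by omega), hy _ (by omega)⟩
  | succ k hk ih =>
    rw [funext (hD.x_succ (k + 1) (by omega)), funext (hD.y_succ (k + 1) (by omega))]
    exact ⟨((ih.1.mono (hmono _ (by omega)) le_rfl).const_smul (1 - ρ (k + 1))).add
        ((hx _ (by omega)).const_smul (ρ (k + 1))),
      ((ih.2.mono (hmono _ (by omega)) le_rfl).const_smul (1 - ρ (k + 1))).add
        ((hy _ (by omega)).const_smul (ρ (k + 1)))⟩

theorem measurable_xmd (hD : Z.Driven h ρ τ σ g u v) (hS : StepSizes ρ θ τ σ)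
    (hmono : ∀ k, 1 ≤ k → 𝓖 k ≤ 𝓖 (k + 1))
    (hx : ∀ k, 1 ≤ k → Measurable[𝓖 k] (Z.xt k)) (hy : ∀ k, 1 ≤ k → Measurable[𝓖 k] (Z.yt k))
    {k : ℕ} (hk : 1 ≤ k) : Measurable[𝓖 k] (Z.xmd ρ k) := by
  rcases hk.eq_or_lt with rfl | hk1
  · have : Z.xmd ρ 1 = Z.xt 1 := by
      ext1 ω
      simp [Iterates.xmd, hS.rho_one]
    rw [this]
    exact hx 1 le_rfl
  · obtain ⟨n, rfl⟩ : ∃ n, k = n + 1 := ⟨k - 1, by omega⟩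
    exact ((hD.measurable_average hS hmono hx hy (by omega)).1.const_smul (1 - ρ (n + 1))).add
      ((hx _ hk).const_smul (ρ (n + 1)))

/-- All averaged iterates are bounded if the `x̃^k`, `ỹ^k` are. -/
theorem norm_average_le (hD : Z.Driven h ρ τ σ g u v) (hS : StepSizes ρ θ τ σ) {ω : Ω}
    {Rx Ry : ℝ} (hx : ∀ k, 1 ≤ k → ‖Z.xt k ω‖ ≤ Rx) (hy : ∀ k, 1 ≤ k → ‖Z.yt k ω‖ ≤ Ry)
    {k : ℕ} (hk : 1 ≤ k) : ‖Z.x (k + 1) ω‖ ≤ Rx ∧ ‖Z.y (k + 1) ω‖ ≤ Ry := by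
  have combo : ∀ {n : ℕ} {a b : Vec n} {c R : ℝ}, 0 ≤ c → c ≤ 1 → ‖a‖ ≤ R → ‖b‖ ≤ R →
      ‖(1 - c) • a + c • b‖ ≤ R := by
    intro n a b c R h0 h1 ha hb
    have := (convex_closedBall (0 : Vec n) R) (mem_closedBall_zero_iff.2 ha)
      (mem_closedBall_zero_iff.2 hb) (sub_nonneg.2 h1) h0 (by ring)
    exact mem_closedBall_zero_iff.1 this
  induction k, hk using Nat.le_induction with
  | base =>
    rw [hD.x_succ 1 le_rfl, hD.y_succ 1 le_rfl]
    simp only [hS.rho_one, sub_self, zero_smul, one_smul, zero_add]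
    exact ⟨hx _ (by omega), hy _ (by omega)⟩
  | succ k hk ih =>
    obtain ⟨h0, h1⟩ := hS.rho_mem (k := k + 1) (by omega)
    rw [hD.x_succ (k + 1) (by omega), hD.y_succ (k + 1) (by omega)]
    exact ⟨combo h0.le h1 ih.1 (hx _ (by omega)), combo h0.le h1 ih.2 (hy _ (by omega))⟩

end Iterates.Driven

end Measurability

/-! ### Oracle errors -/

section Errors

variable {Ω : Type*} {mΩ : MeasurableSpace Ω} {ι : Type*} [Preorder ι] {n : ℕ}

/-- A centered error with second moment at most `χ²`, made after the time `i`. -/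
structure CenteredError (μ : Measure Ω) (𝓕 : Filtration ι mΩ) (χ : ℝ) (i : ι)
    (d : Ω → Vec n) : Prop where
  known_later : ∀ j, i < j → Measurable[𝓕 j] d
  memLp : MemLp d 2 μ
  centered : μ[d | 𝓕 i] =ᵐ[μ] 0
  sq_le : ∫ ω, ‖d ω‖ ^ 2 ∂μ ≤ χ ^ 2

theorem BoundedVarianceCall.centeredError {μ : Measure Ω} {𝓕 : Filtration ι mΩ} {χ : ℝ} {i : ι}
    {target ans : Ω → Vec n} (hc : BoundedVarianceCall μ 𝓕 χ i target ans)
    (ht : Measurable[𝓕 i] target) : CenteredError μ 𝓕 χ i (fun ω => ans ω - target ω) where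
  known_later j hj := (hc.known_later j hj).sub (ht.mono (𝓕.mono hj.le) le_rfl)
  memLp := by
    refine ⟨hc.integrable.1, ?_⟩
    rw [eLpNorm_lt_top_iff_lintegral_rpow_enorm_lt_top two_ne_zero ENNReal.ofNat_ne_top]
    simp only [ENNReal.toReal_ofNat, ENNReal.rpow_ofNat]
    exact hc.variance_le.trans_lt ENNReal.ofReal_lt_top
  centered := hc.unbiased
  sq_le := by
    rw [integral_eq_lintegral_of_nonneg_ae (ae_of_all _ fun ω => sq_nonneg _)
      (hc.integrable.1.norm.pow 2)]
    refine ENNReal.toReal_le_of_le_ofReal (sq_nonneg χ) (le_trans (le_of_eq ?_) hc.variance_le)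
    refine lintegral_congr fun ω => ?_
    rw [ENNReal.ofReal_pow (norm_nonneg _), ofReal_norm]

/-- A centered error with light tails, made after the time `i`. -/
structure LightError (μ : Measure Ω) (𝓕 : Filtration ι mΩ) (χ : ℝ) (i : ι)
    (d : Ω → Vec n) : Prop where
  known_later : ∀ j, i < j → Measurable[𝓕 j] d
  integrable : Integrable d μ
  centered : μ[d | 𝓕 i] =ᵐ[μ] 0
  integrable_exp : Integrable (fun ω => Real.exp (‖d ω‖ ^ 2 / χ ^ 2)) μ
  tail_le : ∀ᵐ ω ∂μ, (μ[fun ω => Real.exp (‖d ω‖ ^ 2 / χ ^ 2) | 𝓕 i]) ω ≤ Real.exp 1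

theorem LightTailCall.lightError {μ : Measure Ω} {𝓕 : Filtration ι mΩ} {χ : ℝ} {i : ι}
    {target ans : Ω → Vec n} (hc : LightTailCall μ 𝓕 χ i target ans)
    (ht : Measurable[𝓕 i] target) : LightError μ 𝓕 χ i (fun ω => ans ω - target ω) where
  known_later j hj := (hc.known_later j hj).sub (ht.mono (𝓕.mono hj.le) le_rfl)
  integrable := hc.integrable
  centered := hc.unbiased
  integrable_exp := hc.integrable_exp
  tail_le := hc.tail_le

end Errors

/-! ### Runs of the algorithm as perturbed deterministic iterations -/

section Runs

variable {Ω : Type*} {mΩ : MeasurableSpace Ω} {μ : Measure Ω} {p l : ℕ} {f : Vec p → ℝ}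
  {h : Vec l → EReal} {K A B : Vec p →L[ℝ] Vec l} {ρ θ τ σ : ℕ → ℝ} {Z : Iterates Ω p l}

theorem toLex_lt_same {n : ℕ} (k : ℕ) {i j : Fin n} (hij : i < j) :
    (toLex (k, i) : ℕ ×ₗ Fin n) < toLex (k, j) :=
  Prod.Lex.toLex_lt_toLex.2 (Or.inr ⟨rfl, hij⟩)

theorem toLex_lt_succ {n : ℕ} (k : ℕ) (i j : Fin n) :
    (toLex (k, i) : ℕ ×ₗ Fin n) < toLex (k + 1, j) :=
  Prod.Lex.toLex_lt_toLex.2 (Or.inl (Nat.lt_succ_self k))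

namespace Run

variable {𝓕 : Filtration (ℕ ×ₗ Fin 7) mΩ} {χf χK χy χA χB : ℝ} {O : Answers Ω p l}

theorem measurable_tilde (hR : Run μ 𝓕 f h K A B ρ θ τ σ χf χK χy χA χB Z O)
    (hh : ClosedProperConvex h) (hS : StepSizes ρ θ τ σ) {k : ℕ} (hk : 1 ≤ k) :
    Measurable[𝓕 (toLex (k, 0))] (Z.xt k) ∧ Measurable[𝓕 (toLex (k, 0))] (Z.yt k) :=
  hR.driven.measurable_tilde (𝓖 := fun k => 𝓕 (toLex (k, 0))) hh hS
    (fun k _ => 𝓕.mono (toLex_lt_succ k 0 0).le)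
    (fun k hk => (hR.call_F k hk).known_later _ (toLex_lt_succ k _ _))
    (fun k hk => ((hR.call_Kx k hk).known_later _ (toLex_lt_succ k _ _)).sub
      ((hR.call_A k hk).known_later _ (toLex_lt_succ k _ _)))
    (fun k hk => ((hR.call_Ky' k hk).known_later _ (toLex_lt_succ k _ _)).add
      ((hR.call_B' k hk).known_later _ (toLex_lt_succ k _ _))) hk

theorem measurable_yt_succ (hR : Run μ 𝓕 f h K A B ρ θ τ σ χf χK χy χA χB Z O)
    (hh : ClosedProperConvex h) (hS : StepSizes ρ θ τ σ) {k : ℕ} (hk : 1 ≤ k) :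
    Measurable[𝓕 (toLex (k, 5))] (Z.yt (k + 1)) :=
  hR.driven.measurable_yt_succ hh hS hk
    ((hR.measurable_tilde hh hS hk).2.mono (𝓕.mono (toLex_lt_same k (by decide)).le) le_rfl)
    (((hR.call_Kx k hk).known_later _ (toLex_lt_same k (by decide))).sub
      ((hR.call_A k hk).known_later _ (toLex_lt_same k (by decide))))

/-- The run as an iteration perturbed by centered errors. -/
theorem exists_errors (hR : Run μ 𝓕 f h K A B ρ θ τ σ χf χK χy χA χB Z O)
    (hh : ClosedProperConvex h) (hS : StepSizes ρ θ τ σ) (hf : Continuous (gradient f)) :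
    ∃ (dF dKy dB dKy' dB' : ℕ → Ω → Vec p) (dKx dA : ℕ → Ω → Vec l),
      (∀ k, 1 ≤ k → CenteredError μ 𝓕 χf (toLex (k, 0)) (dF k) ∧
        CenteredError μ 𝓕 χK (toLex (k, 1)) (dKy k) ∧
        CenteredError μ 𝓕 χB (toLex (k, 2)) (dB k) ∧
        CenteredError μ 𝓕 χy (toLex (k, 3)) (dKx k) ∧
        CenteredError μ 𝓕 χA (toLex (k, 4)) (dA k) ∧
        CenteredError μ 𝓕 χK (toLex (k, 5)) (dKy' k) ∧
        CenteredError μ 𝓕 χB (toLex (k, 6)) (dB' k)) ∧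
      ∀ ω, NoisyIteration f h K A B ρ θ τ σ (fun k => Z.x k ω) (fun k => Z.xt k ω)
        (fun k => Z.y k ω) (fun k => Z.yt k ω) (fun k => dF k ω + dKy' k ω + dB' k ω)
        (fun k => (dKx k ω - dA k ω - (τ k • (K + A)) (dKy k ω + dB k ω)) +
          (τ k • (K + A)) (dKy' k ω + dB' k ω)) := by
  have hmono : ∀ k, 1 ≤ k → 𝓕 (toLex (k, 0)) ≤ 𝓕 (toLex (k + 1, 0)) :=
    fun k _ => 𝓕.mono (toLex_lt_succ k 0 0).le
  have hx : ∀ k, 1 ≤ k → Measurable[𝓕 (toLex (k, 0))] (Z.xt k) :=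
    fun k hk => (hR.measurable_tilde hh hS hk).1
  have hy : ∀ k, 1 ≤ k → Measurable[𝓕 (toLex (k, 0))] (Z.yt k) :=
    fun k hk => (hR.measurable_tilde hh hS hk).2
  refine ⟨fun k ω => O.F k ω - gradient f (Z.xmd ρ k ω),
    fun k ω => O.Ky k ω - K.adjoint (Z.yt k ω + (θ k * τ (k - 1) / τ k) • Z.dy k ω),
    fun k ω => O.B k ω - B.adjoint ((θ k * (τ (k - 1) / τ k - 1)) • Z.dy k ω),
    fun k ω => O.Ky' k ω - K.adjoint (Z.yt (k + 1) ω),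
    fun k ω => O.B' k ω - B.adjoint (Z.dy (k + 1) ω - θ k • Z.dy k ω),
    fun k ω => O.Kx k ω - K (Z.xt k ω - τ k • O.w k ω),
    fun k ω => O.A k ω - A (θ k • Z.dx k ω + τ k • O.w k ω), ?_, ?_⟩
  · intro k hk
    have hd := hR.driven.measurable_diff (𝓖 := fun k => 𝓕 (toLex (k, 0))) hmono hx hy hk
    have up : ∀ {n : ℕ} {a : Ω → Vec n} {i j : Fin 7}, i ≤ j →
        Measurable[𝓕 (toLex (k, i))] a → Measurable[𝓕 (toLex (k, j))] a := by
      intro n a i j hij ha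
      rcases hij.eq_or_lt with rfl | hij
      · exact ha
      · exact ha.mono (𝓕.mono (toLex_lt_same k hij).le) le_rfl
    have hw : Measurable[𝓕 (toLex (k, 3))] (O.w k) :=
      ((hR.call_F k hk).known_later _ (toLex_lt_same k (by decide))).add
        (((hR.call_Ky k hk).known_later _ (toLex_lt_same k (by decide))).add
          ((hR.call_B k hk).known_later _ (toLex_lt_same k (by decide))))
    have hy' := hR.measurable_yt_succ hh hS hk
    have hdy' : Measurable[𝓕 (toLex (k, 6))] (Z.dy (k + 1)) :=
      (up (by decide) hy').sub (up (by decide) (hy k hk))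
    have tF : Measurable[𝓕 (toLex (k, 0))] fun ω => gradient f (Z.xmd ρ k ω) :=
      hf.measurable.comp
        (hR.driven.measurable_xmd (𝓖 := fun k => 𝓕 (toLex (k, 0))) hS hmono hx hy hk)
    have tKy : Measurable[𝓕 (toLex (k, 1))] fun ω =>
        K.adjoint (Z.yt k ω + (θ k * τ (k - 1) / τ k) • Z.dy k ω) :=
      K.adjoint.continuous.measurable.comp
        (up (by decide) ((hy k hk).add (hd.2.const_smul (θ k * τ (k - 1) / τ k))))
    have tB : Measurable[𝓕 (toLex (k, 2))] fun ω =>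
        B.adjoint ((θ k * (τ (k - 1) / τ k - 1)) • Z.dy k ω) :=
      B.adjoint.continuous.measurable.comp
        (up (by decide) (hd.2.const_smul (θ k * (τ (k - 1) / τ k - 1))))
    have tKx : Measurable[𝓕 (toLex (k, 3))] fun ω => K (Z.xt k ω - τ k • O.w k ω) :=
      K.continuous.measurable.comp ((up (by decide) (hx k hk)).sub (hw.const_smul (τ k)))
    have tA : Measurable[𝓕 (toLex (k, 4))] fun ω => A (θ k • Z.dx k ω + τ k • O.w k ω) :=
      A.continuous.measurable.comp
        ((up (by decide) (hd.1.const_smul (θ k))).add (up (by decide) (hw.const_smul (τ k))))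
    have tB' : Measurable[𝓕 (toLex (k, 6))] fun ω =>
        B.adjoint (Z.dy (k + 1) ω - θ k • Z.dy k ω) :=
      B.adjoint.continuous.measurable.comp (hdy'.sub (up (by decide) (hd.2.const_smul (θ k))))
    exact ⟨(hR.call_F k hk).centeredError tF, (hR.call_Ky k hk).centeredError tKy,
      (hR.call_B k hk).centeredError tB, (hR.call_Kx k hk).centeredError tKx,
      (hR.call_A k hk).centeredError tA,
      (hR.call_Ky' k hk).centeredError (K.adjoint.continuous.measurable.comp hy'),
      (hR.call_B' k hk).centeredError tB'⟩
  · intro ω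
    refine ⟨hR.driven.xt_zero ω, hR.driven.yt_zero ω, fun k hk => ?_, fun k hk => ?_,
      fun k hk => hR.driven.x_succ k hk ω, fun k hk => hR.driven.y_succ k hk ω⟩
    · simp only [hR.driven.xt_succ k hk ω, Iterates.xmd, Iterates.dy, Nat.add_sub_cancel]
      congr 2
      abel
    -- Substituting `x̃^{k+1}` into `K x̃^{k+1} + A (x̃^{k+1} - x̃^k)` leaves `τ_k (K + A)` applied
    -- to the difference of `F̂ + ṽ^{k+1}` and `w^k`. There `F̂` cancels, and the exact parts
    -- combine to `(K + B)ᵀ` of the increments because the arguments of the early `𝒦̂_y` and `B̂`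
    -- calls share the coefficient `θ_k τ_{k-1} / τ_k` up to `-θ_k`.
    · convert hR.driven.yt_succ k hk ω using 3
      have hτ := (hS.tau_pos k hk).ne'
      have hc : θ k * τ (k - 1) = τ k * (θ k * τ (k - 1) / τ k) := by field_simp
      have hc' : θ k * (τ (k - 1) / τ k - 1) = θ k * τ (k - 1) / τ k - θ k := by ring
      beta_reduce
      rw [hR.driven.xt_succ k hk ω, hc']
      generalize θ k * τ (k - 1) / τ k = c at hc ⊢
      rw [hc]
      simp only [Iterates.dy, Iterates.dx, Answers.w, Nat.add_sub_cancel, map_add, map_sub,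
        map_smul, add_apply, smul_apply]
      module

end Run

namespace SimpleRun

variable {𝓕 : Filtration (ℕ ×ₗ Fin 3) mΩ} {χf χK χy b : ℝ} {O : SimpleAnswers Ω p l}

theorem measurable_tilde (hR : SimpleRun μ 𝓕 f h K b ρ θ τ σ χf χK χy Z O)
    (hh : ClosedProperConvex h) (hS : StepSizes ρ θ τ σ) {k : ℕ} (hk : 1 ≤ k) :
    Measurable[𝓕 (toLex (k, 0))] (Z.xt k) ∧ Measurable[𝓕 (toLex (k, 0))] (Z.yt k) :=
  hR.driven.measurable_tilde (𝓖 := fun k => 𝓕 (toLex (k, 0))) hh hS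
    (fun k _ => 𝓕.mono (toLex_lt_succ k 0 0).le)
    (fun k hk => (hR.call_F k hk).known_later _ (toLex_lt_succ k _ _))
    (fun k hk => (hR.call_Kx k hk).known_later _ (toLex_lt_succ k _ _))
    (fun k hk => (hR.call_Ky k hk).known_later _ (toLex_lt_succ k _ _)) hk

/-- The run as an iteration perturbed by light-tailed errors. -/
theorem exists_errors (hR : SimpleRun μ 𝓕 f h K b ρ θ τ σ χf χK χy Z O)
    (hh : ClosedProperConvex h) (hS : StepSizes ρ θ τ σ) (hf : Continuous (gradient f)) :
    ∃ (dF dKy : ℕ → Ω → Vec p) (dKx : ℕ → Ω → Vec l),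
      (∀ k, 1 ≤ k → LightError μ 𝓕 χf (toLex (k, 0)) (dF k) ∧
        LightError μ 𝓕 χy (toLex (k, 1)) (dKx k) ∧
        LightError μ 𝓕 χK (toLex (k, 2)) (dKy k)) ∧
      ∀ ω, NoisyIteration f h K (-K) (b • K) ρ θ τ σ (fun k => Z.x k ω) (fun k => Z.xt k ω)
        (fun k => Z.y k ω) (fun k => Z.yt k ω) (fun k => dF k ω + dKy k ω)
        (fun k => dKx k ω) := by
  have hmono : ∀ k, 1 ≤ k → 𝓕 (toLex (k, 0)) ≤ 𝓕 (toLex (k + 1, 0)) :=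
    fun k _ => 𝓕.mono (toLex_lt_succ k 0 0).le
  have hx : ∀ k, 1 ≤ k → Measurable[𝓕 (toLex (k, 0))] (Z.xt k) :=
    fun k hk => (hR.measurable_tilde hh hS hk).1
  have hy : ∀ k, 1 ≤ k → Measurable[𝓕 (toLex (k, 0))] (Z.yt k) :=
    fun k hk => (hR.measurable_tilde hh hS hk).2
  refine ⟨fun k ω => O.F k ω - gradient f (Z.xmd ρ k ω),
    fun k ω => O.Ky k ω -
      K.adjoint (Z.yt (k + 1) ω + b • (Z.dy (k + 1) ω - θ k • Z.dy k ω)),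
    fun k ω => O.Kx k ω - K (Z.xt k ω + θ k • Z.dx k ω), ?_, ?_⟩
  · intro k hk
    have hd := hR.driven.measurable_diff (𝓖 := fun k => 𝓕 (toLex (k, 0))) hmono hx hy hk
    have up : ∀ {n : ℕ} {a : Ω → Vec n} {i : Fin 3}, 0 < i →
        Measurable[𝓕 (toLex (k, 0))] a → Measurable[𝓕 (toLex (k, i))] a := by
      intro n a i hi ha
      exact ha.mono (𝓕.mono (toLex_lt_same k hi).le) le_rfl
    have hy' : Measurable[𝓕 (toLex (k, 2))] (Z.yt (k + 1)) :=
      hR.driven.measurable_yt_succ hh hS hk (up (by decide) (hy k hk))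
        ((hR.call_Kx k hk).known_later _ (toLex_lt_same k (by decide)))
    have hdy' : Measurable[𝓕 (toLex (k, 2))] (Z.dy (k + 1)) :=
      hy'.sub (up (by decide) (hy k hk))
    exact ⟨(hR.call_F k hk).lightError (hf.measurable.comp
        (hR.driven.measurable_xmd (𝓖 := fun k => 𝓕 (toLex (k, 0))) hS hmono hx hy hk)),
      (hR.call_Kx k hk).lightError (K.continuous.measurable.comp
        (up (by decide) ((hx k hk).add (hd.1.const_smul (θ k))))),
      (hR.call_Ky k hk).lightError (K.adjoint.continuous.measurable.comp
        (hy'.add ((hdy'.sub (up (by decide) (hd.2.const_smul (θ k)))).const_smul b)))⟩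
  · intro ω
    refine ⟨hR.driven.xt_zero ω, hR.driven.yt_zero ω, fun k hk => ?_, fun k hk => ?_,
      fun k hk => hR.driven.x_succ k hk ω, fun k hk => hR.driven.y_succ k hk ω⟩
    · simp only [hR.driven.xt_succ k hk ω, Iterates.xmd, Iterates.dy, Nat.add_sub_cancel, map_smul,
        map_add, smul_apply, map_sub]
      congr 2
      module
    · convert hR.driven.yt_succ k hk ω using 3
      simp only [Iterates.dx, map_add, map_sub, map_smul, neg_apply,
        add_apply]
      module

end SimpleRun

end Runs

/-! ### The expected gap -/

section Expectation

variable {Ω : Type*} {mΩ : MeasurableSpace Ω} {μ : Measure Ω} {p l : ℕ}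

theorem inner_sub_mul_sq_le {E : Type*} [NormedAddCommGroup E] [InnerProductSpace ℝ E] (u v : E)
    {c : ℝ} (hc : 0 < c) : ⟪u, v⟫_ℝ - ‖v‖ ^ 2 / (2 * c) ≤ c / 2 * ‖u‖ ^ 2 := by
  have h1 := (real_inner_le_norm u v).trans (young hc)
  linarith

/-- The part `a` of the dual error precedes `ỹ^{k+1}`, so it is paired with `ỹ^k` at the price of a
square. The part `b` comes later and is paired with `ỹ^{k+1}` directly. Only `a` therefore enters
quadratically. -/
theorem noiseAt_le {τ σ : ℕ → ℝ} {s t : ℝ} {xt : ℕ → Vec p} {yt : ℕ → Vec l} {δx : ℕ → Vec p}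
    {δy : ℕ → Vec l} {k : ℕ} (hτ : 0 < τ k) (hσ : 0 < σ k) (hs : s < 1) (ht : t < 1)
    {a b : Vec l} (hab : δy k = a + b) (x : Vec p) (y : Vec l) :
    noiseAt τ σ s t xt yt δx δy x y k ≤
      ⟪yt k, a⟫_ℝ + ⟪yt (k + 1), b⟫_ℝ - ⟪xt k, δx k⟫_ℝ + τ k / (2 * (1 - s)) * ‖δx k‖ ^ 2 +
        σ k / (2 * (1 - t)) * ‖a‖ ^ 2 + ⟪δx k, x⟫_ℝ - ⟪δy k, y⟫_ℝ := by
  have hs' : 0 < 1 - s := by linarith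
  have ht' : 0 < 1 - t := by linarith
  have h1 := inner_sub_mul_sq_le (-(δx k)) (xt (k + 1) - xt k) (div_pos hτ hs')
  have h2 := inner_sub_mul_sq_le a (yt (k + 1) - yt k) (div_pos hσ ht')
  have e1 : (1 - s) / (2 * τ k) * ‖xt (k + 1) - xt k‖ ^ 2 =
      ‖xt (k + 1) - xt k‖ ^ 2 / (2 * (τ k / (1 - s))) := by field_simp
  have e2 : (1 - t) / (2 * σ k) * ‖yt (k + 1) - yt k‖ ^ 2 =
      ‖yt (k + 1) - yt k‖ ^ 2 / (2 * (σ k / (1 - t))) := by field_simp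
  have e3 : τ k / (2 * (1 - s)) = τ k / (1 - s) / 2 := by field_simp
  have e4 : σ k / (2 * (1 - t)) = σ k / (1 - t) / 2 := by field_simp
  unfold noiseAt
  rw [e1, e2, e3, e4]
  rw [norm_neg, inner_neg_left, inner_sub_right] at h1
  rw [inner_sub_right] at h2
  simp only [hab, inner_add_left, inner_sub_right]
  rw [real_inner_comm (yt k) a, real_inner_comm (yt (k + 1)) b, real_inner_comm (xt k) (δx k)]
    at *
  linarith

theorem norm_le_of_diam {n : ℕ} {X : Set (Vec n)} {D : ℝ}
    (hX : ∀ x ∈ X, ∀ x' ∈ X, ‖x - x'‖ ^ 2 ≤ 2 * D ^ 2) {x₀ : Vec n} (h₀ : x₀ ∈ X) :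
    ∀ x ∈ X, ‖x‖ ≤ ‖x₀‖ + √(2 * D ^ 2) := by
  intro x hx
  have h1 := Real.le_sqrt_of_sq_le (hX x hx x₀ h₀)
  have h2 := norm_le_norm_add_norm_sub' x x₀
  linarith

/-- The expected gap of an iteration that is perturbed by centered errors, in terms of the second
moments of the errors and of their weighted sums. -/
theorem integral_dualityGap_le [IsProbabilityMeasure μ] {f : Vec p → ℝ}
    (hc : ConvexOn ℝ Set.univ f) (hf : Differentiable ℝ f) {L : ℝ≥0}
    (hL : LipschitzWith L (gradient f)) {h : Vec l → EReal} (hh : ClosedProperConvex h)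
    {K A B : Vec p →L[ℝ] Vec l} {X : Set (Vec p)} {Y : Set (Vec l)} {ΩX ΩY : ℝ}
    (hX : ∀ x ∈ X, ∀ x' ∈ X, ‖x - x'‖ ^ 2 ≤ 2 * ΩX ^ 2)
    (hY : ∀ y ∈ Y, ∀ y' ∈ Y, ‖y - y'‖ ^ 2 ≤ 2 * ΩY ^ 2)
    {ρ θ τ σ : ℕ → ℝ} (hS : StepSizes ρ θ τ σ) {q r s t : ℝ} (hq : q ∈ Set.Ioo 0 1)
    (hr : r ∈ Set.Ioo 0 1) (hs : s ∈ Set.Ioo 0 1) (ht : t ∈ Set.Ioo 0 1)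
    (hC : Coupling K A B L q r s t ρ τ σ) {Z : Iterates Ω p l} (hZ : Z.StaysIn μ X Y)
    {g : ℕ → Ω → Vec p} {u : ℕ → Ω → Vec l} {v : ℕ → Ω → Vec p}
    (hD : Z.Driven h ρ τ σ g u v) {δx : ℕ → Ω → Vec p} {a b : ℕ → Ω → Vec l}
    (hN : ∀ ω, NoisyIteration f h K A B ρ θ τ σ (fun k => Z.x k ω) (fun k => Z.xt k ω)
      (fun k => Z.y k ω) (fun k => Z.yt k ω) (fun k => δx k ω) (fun k => a k ω + b k ω))
    {k : ℕ} (hk : 1 ≤ k) (hxm : Measurable (Z.x (k + 1))) (hym : Measurable (Z.y (k + 1)))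
    (hδx : ∀ i, 1 ≤ i → MemLp (δx i) 2 μ) (ha : ∀ i, 1 ≤ i → MemLp (a i) 2 μ)
    (hb : ∀ i, 1 ≤ i → MemLp (b i) 2 μ)
    (hδx0 : ∀ i, 1 ≤ i → ∫ ω, δx i ω ∂μ = 0) (ha0 : ∀ i, 1 ≤ i → ∫ ω, a i ω ∂μ = 0)
    (hb0 : ∀ i, 1 ≤ i → ∫ ω, b i ω ∂μ = 0)
    (hxi : ∀ i, 1 ≤ i → Integrable (fun ω => ⟪Z.xt i ω, δx i ω⟫_ℝ) μ ∧
      ∫ ω, ⟪Z.xt i ω, δx i ω⟫_ℝ ∂μ = 0)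
    (hyi : ∀ i, 1 ≤ i → Integrable (fun ω => ⟪Z.yt i ω, a i ω⟫_ℝ) μ ∧
      ∫ ω, ⟪Z.yt i ω, a i ω⟫_ℝ ∂μ = 0)
    (hyi' : ∀ i, 1 ≤ i → Integrable (fun ω => ⟪Z.yt (i + 1) ω, b i ω⟫_ℝ) μ ∧
      ∫ ω, ⟪Z.yt (i + 1) ω, b i ω⟫_ℝ ∂μ = 0)
    {vx vy : ℝ} (hvx : ∀ i ∈ Finset.Icc 1 k, ∫ ω, ‖δx i ω‖ ^ 2 ∂μ ≤ vx)
    (hvy : ∀ i ∈ Finset.Icc 1 k, ∫ ω, ‖a i ω‖ ^ 2 ∂μ ≤ vy)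
    (hSx : ∫ ω, ‖∑ i ∈ Finset.Icc 1 k, gam θ i • δx i ω‖ ^ 2 ∂μ ≤
      ∑ i ∈ Finset.Icc 1 k, gam θ i ^ 2 * (2 * vx))
    (hSy : ∫ ω, ‖∑ i ∈ Finset.Icc 1 k, gam θ i • (a i ω + b i ω)‖ ^ 2 ∂μ ≤
      ∑ i ∈ Finset.Icc 1 k, gam θ i ^ 2 * (2 * vy)) :
    (∀ᵐ ω ∂μ, dualityGap f h K X Y (Z.x (k + 1) ω) (Z.y (k + 1) ω) ≠ ⊤ ∧
      dualityGap f h K X Y (Z.x (k + 1) ω) (Z.y (k + 1) ω) ≠ ⊥) ∧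
    Integrable (fun ω => (dualityGap f h K X Y (Z.x (k + 1) ω) (Z.y (k + 1) ω)).toReal) μ ∧
    ∫ ω, (dualityGap f h K X Y (Z.x (k + 1) ω) (Z.y (k + 1) ω)).toReal ∂μ ≤
      diamTerm ρ θ τ σ ΩX ΩY k + noiseTerm ρ θ τ σ s t vx vy k := by
  obtain ⟨ω₀, hω₀⟩ := hZ.exists
  set x₀ := Z.xt 1 ω₀
  -- The index is 2 because `h*` may be infinite at the starting point `ỹ¹`, while `ỹ²` is an output
  -- of the proximal map.
  set y₀ := Z.yt 2 ω₀
  have hx₀ : x₀ ∈ X := (hω₀ 1 le_rfl).1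
  have hy₀ : y₀ ∈ Y := (hω₀ 2 (by norm_num)).2
  have hy₀t : conjugate h y₀ ≠ ⊤ := (hN ω₀).conjugate_yt_ne_top hh hS le_rfl
  have hXR := norm_le_of_diam hX hx₀
  have hYR := norm_le_of_diam hY hy₀
  set Rx := ‖x₀‖ + √(2 * ΩX ^ 2)
  set Ry := ‖y₀‖ + √(2 * ΩY ^ 2)
  have hγ := hS.gam_pos hk
  have hρ := (hS.rho_mem hk).1
  have hτ := hS.tau_pos k hk
  have hσ := hS.sigma_pos k hk
  have hs' : 0 < 1 - s := by linarith [hs.2]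
  have ht' : 0 < 1 - t := by linarith [ht.2]
  set Sx : Ω → Vec p := fun ω => ∑ i ∈ Finset.Icc 1 k, gam θ i • δx i ω
  set Sy : Ω → Vec l := fun ω => ∑ i ∈ Finset.Icc 1 k, gam θ i • (a i ω + b i ω)
  have hmem : ∀ {i}, i ∈ Finset.Icc 1 k → 1 ≤ i := fun hi => (Finset.mem_Icc.1 hi).1
  have hSxm : MemLp Sx 2 μ := memLp_finsetSum _ fun i hi => (hδx i (hmem hi)).const_smul (gam θ i)
  have hSym : MemLp Sy 2 μ := memLp_finsetSum _ fun i hi =>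
    ((ha i (hmem hi)).add (hb i (hmem hi))).const_smul (gam θ i)
  have hSx0 : ∫ ω, Sx ω ∂μ = 0 := by
    have hxint : ∀ i ∈ Finset.Icc 1 k, Integrable (fun ω => gam θ i • δx i ω) μ := fun i hi =>
      ((hδx i (hmem hi)).integrable one_le_two).smul (gam θ i)
    rw [integral_finsetSum _ hxint]
    refine Finset.sum_eq_zero fun i hi => ?_
    rw [integral_smul, hδx0 i (hmem hi), smul_zero]
  have hSy0 : ∫ ω, Sy ω ∂μ = 0 := by
    have hai : ∀ i ∈ Finset.Icc 1 k, Integrable (a i) μ := fun i hi =>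
      (ha i (hmem hi)).integrable one_le_two
    have hbi : ∀ i ∈ Finset.Icc 1 k, Integrable (b i) μ := fun i hi =>
      (hb i (hmem hi)).integrable one_le_two
    have hyint : ∀ i ∈ Finset.Icc 1 k, Integrable (fun ω => gam θ i • (a i ω + b i ω)) μ :=
      fun i hi => ((hai i hi).add (hbi i hi)).smul (gam θ i)
    rw [integral_finsetSum _ hyint]
    refine Finset.sum_eq_zero fun i hi => ?_
    rw [integral_smul, integral_add (hai i hi) (hbi i hi), ha0 i (hmem hi), hb0 i (hmem hi),
      add_zero, smul_zero]
  -- The part of the noise that does not depend on `(x, y)`: its inner products have mean zero and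
  -- only the squares contribute.
  let e : ℕ → Ω → ℝ := fun i ω =>
    ⟪Z.yt i ω, a i ω⟫_ℝ + ⟪Z.yt (i + 1) ω, b i ω⟫_ℝ - ⟪Z.xt i ω, δx i ω⟫_ℝ +
      τ i / (2 * (1 - s)) * ‖δx i ω‖ ^ 2 + σ i / (2 * (1 - t)) * ‖a i ω‖ ^ 2
  have hei : ∀ i, 1 ≤ i → Integrable (e i) μ := fun i hi =>
    ((((hyi i hi).1.add (hyi' i hi).1).sub (hxi i hi).1).add
      (((memLp_two_iff_integrable_sq_norm (hδx i hi).1).1 (hδx i hi)).const_mul _)).add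
      (((memLp_two_iff_integrable_sq_norm (ha i hi).1).1 (ha i hi)).const_mul _)
  have hei_le : ∀ i ∈ Finset.Icc 1 k, ∫ ω, e i ω ∂μ ≤
      τ i / (2 * (1 - s)) * vx + σ i / (2 * (1 - t)) * vy := by
    intro i hi
    have hi1 := hmem hi
    have h1 : Integrable (fun ω => ⟪Z.yt i ω, a i ω⟫_ℝ + ⟪Z.yt (i + 1) ω, b i ω⟫_ℝ) μ :=
      (hyi i hi1).1.add (hyi' i hi1).1
    have h2 : Integrable (fun ω => ⟪Z.yt i ω, a i ω⟫_ℝ + ⟪Z.yt (i + 1) ω, b i ω⟫_ℝ -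
        ⟪Z.xt i ω, δx i ω⟫_ℝ) μ := h1.sub (hxi i hi1).1
    have h3 : Integrable (fun ω => τ i / (2 * (1 - s)) * ‖δx i ω‖ ^ 2) μ :=
      ((memLp_two_iff_integrable_sq_norm (hδx i hi1).1).1 (hδx i hi1)).const_mul _
    have h4 : Integrable (fun ω => σ i / (2 * (1 - t)) * ‖a i ω‖ ^ 2) μ :=
      ((memLp_two_iff_integrable_sq_norm (ha i hi1).1).1 (ha i hi1)).const_mul _
    have h5 : Integrable (fun ω => ⟪Z.yt i ω, a i ω⟫_ℝ + ⟪Z.yt (i + 1) ω, b i ω⟫_ℝ -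
        ⟪Z.xt i ω, δx i ω⟫_ℝ + τ i / (2 * (1 - s)) * ‖δx i ω‖ ^ 2) μ := h2.add h3
    have hτi := hS.tau_pos i hi1
    have hσi := hS.sigma_pos i hi1
    simp only [e]
    rw [integral_add h5 h4, integral_add h2 h3, integral_sub h1 (hxi i hi1).1,
      integral_add (hyi i hi1).1 (hyi' i hi1).1, (hyi i hi1).2, (hyi' i hi1).2, (hxi i hi1).2,
      integral_const_mul, integral_const_mul, add_zero, sub_zero, zero_add]
    exact add_le_add (mul_le_mul_of_nonneg_left (hvx i hi) (by positivity))
      (mul_le_mul_of_nonneg_left (hvy i hi) (by positivity))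
  -- An integrable majorant of the gap. The supremum over `(x, y)` is absorbed by the two support
  -- functions.
  let W : Ω → ℝ := fun ω => ρ k / gam θ k * (gam θ k / τ k * ΩX ^ 2 + gam θ k / σ k * ΩY ^ 2 +
    ∑ i ∈ Finset.Icc 1 k, gam θ i * e i ω + suppFun X (Sx ω) + suppFun Y (-Sy ω))
  have hsum_i : Integrable (fun ω => ∑ i ∈ Finset.Icc 1 k, gam θ i * e i ω) μ :=
    integrable_finsetSum _ fun i hi => (hei i (hmem hi)).const_mul _
  have hsuppX : Integrable (fun ω => suppFun X (Sx ω)) μ :=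
    integrable_suppFun ⟨x₀, hx₀⟩ hXR (hSxm.integrable one_le_two)
  have hsuppY : Integrable (fun ω => suppFun Y (-Sy ω)) μ :=
    integrable_suppFun ⟨y₀, hy₀⟩ hYR (hSym.integrable one_le_two).neg
  have hWi1 : Integrable (fun ω => gam θ k / τ k * ΩX ^ 2 + gam θ k / σ k * ΩY ^ 2 +
    ∑ i ∈ Finset.Icc 1 k, gam θ i * e i ω) μ := (integrable_const _).add hsum_i
  have hWi2 : Integrable (fun ω => gam θ k / τ k * ΩX ^ 2 + gam θ k / σ k * ΩY ^ 2 +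
    ∑ i ∈ Finset.Icc 1 k, gam θ i * e i ω + suppFun X (Sx ω)) μ := hWi1.add hsuppX
  have hWi : Integrable W μ := (hWi2.add hsuppY).const_mul _
  have hup : ∀ᵐ ω ∂μ, dualityGap f h K X Y (Z.x (k + 1) ω) (Z.y (k + 1) ω) ≤ (W ω : EReal) := by
    filter_upwards [hZ] with ω hω
    refine dualityGap_le hh ((hN ω).conjugate_ys_ne_top hh hS hk) fun x hx y hy hyt => ?_
    have h1 := (hN ω).gapAt_le hh hS hc hf hL hC hq hr ht hyt
      (fun k hk => hX x hx _ (hω k hk).1) (fun k hk => hY y hy _ (hω k hk).2) hk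
    have h2 : ∑ i ∈ Finset.Icc 1 k, gam θ i * noiseAt τ σ s t (fun k => Z.xt k ω)
        (fun k => Z.yt k ω) (fun k => δx k ω) (fun k => a k ω + b k ω) x y i ≤
        ∑ i ∈ Finset.Icc 1 k, gam θ i * e i ω + ⟪Sx ω, x⟫_ℝ + ⟪-Sy ω, y⟫_ℝ := by
      rw [inner_neg_left, sum_inner, sum_inner, ← sub_eq_add_neg, ← Finset.sum_add_distrib,
        ← Finset.sum_sub_distrib]
      refine Finset.sum_le_sum fun i hi => ?_
      have h3 := noiseAt_le (xt := fun k => Z.xt k ω) (yt := fun k => Z.yt k ω)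
        (δx := fun k => δx k ω) (δy := fun k => a k ω + b k ω) (hS.tau_pos i (hmem hi))
        (hS.sigma_pos i (hmem hi)) hs.2 ht.2 rfl x y
      have h4 := mul_le_mul_of_nonneg_left h3 (hS.gam_pos (hmem hi)).le
      refine h4.trans (le_of_eq ?_)
      simp only [e, real_inner_smul_left]
      ring
    have h3 := le_suppFun hXR (Sx ω) hx
    have h4 := le_suppFun hYR (-Sy ω) hy
    have h5 : gapAt f h K x y (Z.x (k + 1) ω) (Z.y (k + 1) ω) =
        ρ k / gam θ k * (gam θ k / ρ k * gapAt f h K x y (Z.x (k + 1) ω) (Z.y (k + 1) ω)) := by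
      field_simp
    rw [h5]
    exact mul_le_mul_of_nonneg_left (by linarith) (div_pos hρ hγ).le
  -- Integrability also needs a lower bound. The gap is at least its value at `(x₀, y₀)`, which is
  -- bounded below: the averages are bounded, `f` lies above its tangent at 0, and `h*` lies above
  -- the affine function given by `u₁`.
  obtain ⟨u₁, c₁, hc₁⟩ := hh.exists_eq_coe
  let low : ℝ := f 0 - ‖gradient f 0‖ * Rx - ‖K‖ * Rx * ‖y₀‖ - conjReal h y₀ -
    (f x₀ + ‖K x₀‖ * Ry) - ‖u₁‖ * Ry - c₁
  have hlow : ∀ᵐ ω ∂μ, (low : EReal) ≤ dualityGap f h K X Y (Z.x (k + 1) ω) (Z.y (k + 1) ω) := by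
    filter_upwards [hZ] with ω hω
    have hyt := (hN ω).conjugate_ys_ne_top hh hS hk
    refine le_trans ?_ (le_dualityGap hh hx₀ hy₀ hy₀t hyt)
    obtain ⟨hxb, hyb⟩ := hD.norm_average_le hS (fun k hk => hXR _ (hω k hk).1)
      (fun k hk => hYR _ (hω k hk).2) hk
    have h1 := le_of_convex_differentiable hc hf 0 (Z.x (k + 1) ω)
    rw [sub_zero] at h1
    have inner_ge : ∀ {n : ℕ} (a b : Vec n) {Ra Rb : ℝ}, ‖a‖ ≤ Ra → ‖b‖ ≤ Rb →
        |⟪a, b⟫_ℝ| ≤ Ra * Rb := by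
      intro n a b Ra Rb ha hb
      exact (abs_real_inner_le_norm a b).trans
        (mul_le_mul ha hb (norm_nonneg _) ((norm_nonneg _).trans ha))
    have h2 := (abs_le.1 (inner_ge (gradient f 0) (Z.x (k + 1) ω) le_rfl hxb)).1
    have h3 := (abs_le.1 (inner_ge (K (Z.x (k + 1) ω)) y₀ (Ra := ‖K‖ * Rx) ((K.le_opNorm _).trans
      (mul_le_mul_of_nonneg_left hxb (norm_nonneg _))) le_rfl)).1
    have h4 := (abs_le.1 (inner_ge (K x₀) (Z.y (k + 1) ω) le_rfl hyb)).2
    have h5 := (abs_le.1 (inner_ge u₁ (Z.y (k + 1) ω) le_rfl hyb)).1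
    have h6 := hh.sub_le_conjReal hyt hc₁
    rw [EReal.coe_le_coe_iff]
    simp only [low, gapAt]
    linarith
  have hfin : ∀ᵐ ω ∂μ, dualityGap f h K X Y (Z.x (k + 1) ω) (Z.y (k + 1) ω) ≠ ⊤ ∧
      dualityGap f h K X Y (Z.x (k + 1) ω) (Z.y (k + 1) ω) ≠ ⊥ := by
    filter_upwards [hup, hlow] with ω h1 h2
    exact ⟨ne_top_of_le_ne_top (EReal.coe_ne_top _) h1,
      ne_bot_of_le_ne_bot (EReal.coe_ne_bot _) h2⟩
  have hmeas : Measurable fun ω =>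
      (dualityGap f h K X Y (Z.x (k + 1) ω) (Z.y (k + 1) ω)).toReal :=
    ((measurable_dualityGap (K := K) hh hf.continuous X Y).comp (hxm.prodMk hym)).ereal_toReal
  have hupR : ∀ᵐ ω ∂μ, (dualityGap f h K X Y (Z.x (k + 1) ω) (Z.y (k + 1) ω)).toReal ≤ W ω := by
    filter_upwards [hup, hfin] with ω h1 h2
    rw [← EReal.coe_toReal h2.1 h2.2] at h1
    exact_mod_cast h1
  have hlowR : ∀ᵐ ω ∂μ, low ≤
      (dualityGap f h K X Y (Z.x (k + 1) ω) (Z.y (k + 1) ω)).toReal := by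
    filter_upwards [hlow, hfin] with ω h1 h2
    rw [← EReal.coe_toReal h2.1 h2.2] at h1
    exact_mod_cast h1
  have hInt : Integrable
      (fun ω => (dualityGap f h K X Y (Z.x (k + 1) ω) (Z.y (k + 1) ω)).toReal) μ := by
    refine (hWi.abs.add (integrable_const |low|)).mono' hmeas.aestronglyMeasurable ?_
    filter_upwards [hupR, hlowR] with ω h1 h2
    rw [Real.norm_eq_abs, abs_le]
    simp only [Pi.add_apply]
    constructor
    · linarith [neg_abs_le low, abs_nonneg (W ω)]
    · linarith [le_abs_self (W ω), abs_nonneg low]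
  refine ⟨hfin, hInt, ?_⟩
  refine (integral_mono_ae hInt hWi hupR).trans ?_
  have hsx := integral_suppFun_le ⟨x₀, hx₀⟩ hXR hX hSxm hSx0 (div_pos hγ hτ)
  have hsy := integral_suppFun_le ⟨y₀, hy₀⟩ hYR hY (S := fun ω => -Sy ω) hSym.neg
    (by rw [integral_neg, hSy0, neg_zero]) (div_pos hγ hσ)
  simp only [norm_neg] at hsy
  have hvx0 : 0 ≤ vx :=
    (integral_nonneg fun ω => sq_nonneg _).trans (hvx 1 (Finset.mem_Icc.2 ⟨le_rfl, hk⟩))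
  have hvy0 : 0 ≤ vy :=
    (integral_nonneg fun ω => sq_nonneg _).trans (hvy 1 (Finset.mem_Icc.2 ⟨le_rfl, hk⟩))
  -- The factor `1/4` from symmetrization leaves room for the variance `2 w`. Monotonicity of `γ_i /
  -- c_i` replaces the final ratio by the current one.
  have key : ∀ (c : ℕ → ℝ) (w V : ℝ), (∀ i, 1 ≤ i → 0 < c i) → 0 ≤ w →
      (∀ i, 1 ≤ i → i ≤ k → gam θ i / c i ≤ gam θ k / c k) →
      V ≤ ∑ i ∈ Finset.Icc 1 k, gam θ i ^ 2 * (2 * w) →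
      V / (4 * (gam θ k / c k)) ≤ ∑ i ∈ Finset.Icc 1 k, gam θ i * (c i / 2 * w) := by
    intro c w V hcpos hw hmono hV
    have hck := hcpos k hk
    have hpos : 0 < gam θ k / c k := div_pos hγ hck
    rw [div_le_iff₀ (by positivity), Finset.sum_mul]
    refine hV.trans (Finset.sum_le_sum fun i hi => ?_)
    have hi' := Finset.mem_Icc.1 hi
    have hci := hcpos i hi'.1
    have hgi := hS.gam_pos hi'.1
    have h1 : gam θ i ≤ gam θ k / c k * c i := by
      rw [← div_le_iff₀ hci]
      exact hmono i hi'.1 hi'.2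
    have h2 := mul_le_mul_of_nonneg_left h1 (mul_nonneg hgi.le hw)
    calc gam θ i ^ 2 * (2 * w) = 2 * (gam θ i * w * gam θ i) := by ring
      _ ≤ 2 * (gam θ i * w * (gam θ k / c k * c i)) := by linarith
      _ = gam θ i * (c i / 2 * w) * (4 * (gam θ k / c k)) := by ring
  have hkx := key τ vx _ hS.tau_pos hvx0 (fun i h1 h2 => hS.gam_div_tau_mono h1 h2) hSx
  have hky := key σ vy _ hS.sigma_pos hvy0 (fun i h1 h2 => hS.gam_div_sigma_mono h1 h2) hSy
  have hWint : ∫ ω, W ω ∂μ = ρ k / gam θ k * (gam θ k / τ k * ΩX ^ 2 + gam θ k / σ k * ΩY ^ 2 +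
      ∑ i ∈ Finset.Icc 1 k, gam θ i * ∫ ω, e i ω ∂μ + ∫ ω, suppFun X (Sx ω) ∂μ +
      ∫ ω, suppFun Y (-Sy ω) ∂μ) := by
    simp only [W]
    rw [integral_const_mul, integral_add hWi2 hsuppY, integral_add hWi1 hsuppX,
      integral_add (integrable_const _) hsum_i,
      integral_finsetSum _ fun i hi => (hei i (hmem hi)).const_mul _]
    simp only [integral_const_mul, integral_const, probReal_univ, smul_eq_mul, one_mul]
  have hsum_e : ∑ i ∈ Finset.Icc 1 k, gam θ i * ∫ ω, e i ω ∂μ ≤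
      ∑ i ∈ Finset.Icc 1 k, gam θ i * (τ i / (2 * (1 - s)) * vx + σ i / (2 * (1 - t)) * vy) :=
    Finset.sum_le_sum fun i hi =>
      mul_le_mul_of_nonneg_left (hei_le i hi) (hS.gam_pos (hmem hi)).le
  rw [hWint]
  have hfinal : diamTerm ρ θ τ σ ΩX ΩY k + noiseTerm ρ θ τ σ s t vx vy k =
      ρ k / gam θ k * (gam θ k / τ k * ΩX ^ 2 + gam θ k / σ k * ΩY ^ 2 +
        ∑ i ∈ Finset.Icc 1 k, gam θ i * (τ i / (2 * (1 - s)) * vx + σ i / (2 * (1 - t)) * vy) +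
        (gam θ k / τ k * ΩX ^ 2 + ∑ i ∈ Finset.Icc 1 k, gam θ i * (τ i / 2 * vx)) +
        (gam θ k / σ k * ΩY ^ 2 + ∑ i ∈ Finset.Icc 1 k, gam θ i * (σ i / 2 * vy))) := by
    have e1 : ∑ i ∈ Finset.Icc 1 k, ((2 - s) * τ i * gam θ i / (1 - s) * vx +
        (2 - t) * σ i * gam θ i / (1 - t) * vy) = 2 *
        (∑ i ∈ Finset.Icc 1 k, gam θ i * (τ i / (2 * (1 - s)) * vx + σ i / (2 * (1 - t)) * vy) +
        ∑ i ∈ Finset.Icc 1 k, gam θ i * (τ i / 2 * vx) +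
        ∑ i ∈ Finset.Icc 1 k, gam θ i * (σ i / 2 * vy)) := by
      rw [← Finset.sum_add_distrib, ← Finset.sum_add_distrib, Finset.mul_sum]
      refine Finset.sum_congr rfl fun i _ => ?_
      field_simp
      ring
    unfold diamTerm noiseTerm
    rw [e1]
    generalize ∑ i ∈ Finset.Icc 1 k, gam θ i * (τ i / 2 * vx) = T₁
    generalize ∑ i ∈ Finset.Icc 1 k, gam θ i * (σ i / 2 * vy) = T₂
    generalize ∑ i ∈ Finset.Icc 1 k,
      gam θ i * (τ i / (2 * (1 - s)) * vx + σ i / (2 * (1 - t)) * vy) = T₃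
    field_simp
    ring
  rw [hfinal]
  refine mul_le_mul_of_nonneg_left ?_ (div_pos hρ hγ).le
  linarith

end Expectation

/-! ### Moments of the accumulated errors -/

section Moments

variable {Ω : Type*} {mΩ : MeasurableSpace Ω} {μ : Measure Ω} {n k : ℕ}

/-- `Z` and `d` are integrable against each other and orthogonal in the mean. -/
def MeanOrth (μ : Measure Ω) (Z d : Ω → Vec n) : Prop :=
  Integrable (fun ω => ⟪Z ω, d ω⟫_ℝ) μ ∧ ∫ ω, ⟪Z ω, d ω⟫_ℝ ∂μ = 0

theorem MeanOrth.add {Z d d' : Ω → Vec n} (h : MeanOrth μ Z d) (h' : MeanOrth μ Z d') :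
    MeanOrth μ Z (fun ω => d ω + d' ω) := by
  unfold MeanOrth
  simp only [inner_add_right]
  exact ⟨h.1.add h'.1, by rw [integral_add h.1 h'.1, h.2, h'.2, add_zero]⟩

theorem MeanOrth.sub {Z d d' : Ω → Vec n} (h : MeanOrth μ Z d) (h' : MeanOrth μ Z d') :
    MeanOrth μ Z (fun ω => d ω - d' ω) := by
  unfold MeanOrth
  simp only [inner_sub_right]
  exact ⟨h.1.sub h'.1, by rw [integral_sub h.1 h'.1, h.2, h'.2, sub_zero]⟩

namespace CenteredError

variable {ι : Type*} [Preorder ι] {𝓕 : Filtration ι mΩ} {χ : ℝ} {i : ι} {d : Ω → Vec n}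
  [IsFiniteMeasure μ]

theorem integral_eq_zero (hd : CenteredError μ 𝓕 χ i d) : ∫ ω, d ω ∂μ = 0 := by
  rw [← integral_condExp (𝓕.le i), integral_congr_ae hd.centered]
  simp

theorem meanOrth_map (hd : CenteredError μ 𝓕 χ i d) {Z : Ω → Vec k} {j : ι} (hj : j ≤ i)
    (hZ : Measurable[𝓕 j] Z) (hZ2 : MemLp Z 2 μ) (T : Vec n →L[ℝ] Vec k) :
    MeanOrth μ Z (fun ω => T (d ω)) := by
  have e : ∀ ω, ⟪Z ω, T (d ω)⟫_ℝ = ⟪T.adjoint (Z ω), d ω⟫_ℝ := fun ω =>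
    (ContinuousLinearMap.adjoint_inner_left T _ _).symm
  unfold MeanOrth
  simp only [e]
  have hi := MemLp_two_integrable_inner (T.adjoint.comp_memLp' hZ2) hd.memLp
  exact ⟨hi, integral_inner_eq_zero (𝓕.le i) (hd.memLp.integrable one_le_two) hd.centered
    (T.adjoint.continuous.measurable.comp (hZ.mono (𝓕.mono hj) le_rfl)) hi⟩

theorem meanOrth (hd : CenteredError μ 𝓕 χ i d) {Z : Ω → Vec n} {j : ι} (hj : j ≤ i)
    (hZ : Measurable[𝓕 j] Z) (hZ2 : MemLp Z 2 μ) : MeanOrth μ Z d :=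
  hd.meanOrth_map hj hZ hZ2 (ContinuousLinearMap.id ℝ _)

theorem integral_norm_add_map_sq_le (hd : CenteredError μ 𝓕 χ i d) {P : Ω → Vec k}
    (hP : Measurable[𝓕 i] P) (hP2 : MemLp P 2 μ) (T : Vec n →L[ℝ] Vec k) {b v : ℝ}
    (hb : ‖T‖ ^ 2 ≤ b) (hv : ∫ ω, ‖P ω‖ ^ 2 ∂μ ≤ v) :
    MemLp (fun ω => P ω + T (d ω)) 2 μ ∧ ∫ ω, ‖P ω + T (d ω)‖ ^ 2 ∂μ ≤ v + b * χ ^ 2 := by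
  obtain ⟨h1, h2⟩ := integral_norm_add_sq_le (𝓕.le i) hd.memLp hd.centered hP2 hP T
  refine ⟨h1, h2.trans (add_le_add hv (mul_le_mul hb hd.sq_le ?_ ((sq_nonneg _).trans hb)))⟩
  exact integral_nonneg fun ω => sq_nonneg _

end CenteredError

theorem sq_norm_smul_id_le (c : ℝ) : ‖c • ContinuousLinearMap.id ℝ (Vec n)‖ ^ 2 ≤ c ^ 2 := by
  have h : ‖c • ContinuousLinearMap.id ℝ (Vec n)‖ ≤ |c| := by
    rw [norm_smul, Real.norm_eq_abs]
    exact mul_le_of_le_one_right (abs_nonneg _) ContinuousLinearMap.norm_id_le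
  rw [← sq_abs c]
  exact pow_le_pow_left₀ (norm_nonneg _) h 2

/-- Orthogonality of martingale increments. The increment property is a hypothesis on all known `P`,
so that it can be checked for errors assembled from several successive calls. -/
theorem integral_norm_sum_sq_le {m : ℕ → MeasurableSpace Ω} (hm : ∀ i, 1 ≤ i → m i ≤ m (i + 1))
    {e : ℕ → Ω → Vec n} (he : ∀ i, 1 ≤ i → Measurable[m (i + 1)] (e i)) {V : ℕ → ℝ}
    (hinc : ∀ i, 1 ≤ i → ∀ (c : ℝ) (P : Ω → Vec n), Measurable[m i] P → MemLp P 2 μ →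
      MemLp (fun ω => P ω + c • e i ω) 2 μ ∧
        ∫ ω, ‖P ω + c • e i ω‖ ^ 2 ∂μ ≤ ∫ ω, ‖P ω‖ ^ 2 ∂μ + c ^ 2 * V i) (c : ℕ → ℝ) (k : ℕ) :
    ∫ ω, ‖∑ i ∈ Finset.Icc 1 k, c i • e i ω‖ ^ 2 ∂μ ≤ ∑ i ∈ Finset.Icc 1 k, c i ^ 2 * V i := by
  suffices H : Measurable[m (k + 1)] (fun ω => ∑ i ∈ Finset.Icc 1 k, c i • e i ω) ∧
      MemLp (fun ω => ∑ i ∈ Finset.Icc 1 k, c i • e i ω) 2 μ ∧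
      ∫ ω, ‖∑ i ∈ Finset.Icc 1 k, c i • e i ω‖ ^ 2 ∂μ ≤ ∑ i ∈ Finset.Icc 1 k, c i ^ 2 * V i from
    H.2.2
  induction k with
  | zero => simp
  | succ k ih =>
    simp only [Finset.sum_Icc_succ_top (Nat.le_add_left 1 k)]
    obtain ⟨h1, h2, h3⟩ := ih
    obtain ⟨h4, h5⟩ := hinc (k + 1) (by omega) (c (k + 1)) _ h1 h2
    exact ⟨(h1.mono (hm _ (by omega)) le_rfl).add
      ((he _ (by omega)).const_smul (c (k + 1))), h4, h5.trans (add_le_add_left h3 _)⟩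

end Moments

/-! ### The expected gap with bounded-variance oracles -/

namespace Run

variable {Ω : Type*} {mΩ : MeasurableSpace Ω} {μ : Measure Ω} [IsProbabilityMeasure μ] {p l : ℕ}
  {f : Vec p → ℝ} {h : Vec l → EReal} {K A B : Vec p →L[ℝ] Vec l} {ρ θ τ σ : ℕ → ℝ}
  {Z : Iterates Ω p l} {𝓕 : Filtration (ℕ ×ₗ Fin 7) mΩ} {χf χK χy χA χB : ℝ} {O : Answers Ω p l}

/-- The dual error is split into the part made before `ỹ^{k+1}`, which is charged as a square, and
the part from the later calls of `𝒦̂_y` and `B̂`. In the accumulated dual error both parts count,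
but twice the admitted variance is allowed there. -/
theorem dualityGap_bounds (hR : Run μ 𝓕 f h K A B ρ θ τ σ χf χK χy χA χB Z O)
    (hc : ConvexOn ℝ Set.univ f) (hf : Differentiable ℝ f) {L : ℝ≥0}
    (hL : LipschitzWith L (gradient f)) (hh : ClosedProperConvex h)
    {X : Set (Vec p)} {Y : Set (Vec l)} {ΩX ΩY : ℝ}
    (hX : ∀ x ∈ X, ∀ x' ∈ X, ‖x - x'‖ ^ 2 ≤ 2 * ΩX ^ 2)
    (hY : ∀ y ∈ Y, ∀ y' ∈ Y, ‖y - y'‖ ^ 2 ≤ 2 * ΩY ^ 2)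
    (hS : StepSizes ρ θ τ σ) {q r s t : ℝ} (hq : q ∈ Set.Ioo 0 1)
    (hr : r ∈ Set.Ioo 0 1) (hs : s ∈ Set.Ioo 0 1) (ht : t ∈ Set.Ioo 0 1)
    (hC : Coupling K A B L q r s t ρ τ σ) (hZ : Z.StaysIn μ X Y) {k : ℕ} (hk : 1 ≤ k) :
    (∀ᵐ ω ∂μ, dualityGap f h K X Y (Z.x (k + 1) ω) (Z.y (k + 1) ω) ≠ ⊤ ∧
      dualityGap f h K X Y (Z.x (k + 1) ω) (Z.y (k + 1) ω) ≠ ⊥) ∧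
    Integrable (fun ω => (dualityGap f h K X Y (Z.x (k + 1) ω) (Z.y (k + 1) ω)).toReal) μ ∧
    ∫ ω, (dualityGap f h K X Y (Z.x (k + 1) ω) (Z.y (k + 1) ω)).toReal ∂μ ≤
      Q0 ρ θ τ σ ΩX ΩY s t χf χK χy χA χB ‖K + A‖ k := by
  obtain ⟨dF, dKy, dB, dKy', dB', dKx, dA, hE, hN⟩ := hR.exists_errors hh hS hL.continuous
  have hmono : ∀ k, 1 ≤ k → 𝓕 (toLex (k, 0)) ≤ 𝓕 (toLex (k + 1, 0)) :=
    fun k _ => 𝓕.mono (toLex_lt_succ k 0 0).le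
  have hx : ∀ k, 1 ≤ k → Measurable[𝓕 (toLex (k, 0))] (Z.xt k) :=
    fun k hk => (hR.measurable_tilde hh hS hk).1
  have hy : ∀ k, 1 ≤ k → Measurable[𝓕 (toLex (k, 0))] (Z.yt k) :=
    fun k hk => (hR.measurable_tilde hh hS hk).2
  have havg := hR.driven.measurable_average (𝓖 := fun k => 𝓕 (toLex (k, 0))) hS hmono hx hy hk
  obtain ⟨ω₀, hω₀⟩ := hZ.exists
  have hXR := norm_le_of_diam hX (hω₀ 1 le_rfl).1
  have hYR := norm_le_of_diam hY (hω₀ 1 le_rfl).2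
  have hxL : ∀ k, 1 ≤ k → MemLp (Z.xt k) 2 μ := fun k hk =>
    MemLp_two_of_bounded ((hx k hk).mono (𝓕.le _) le_rfl)
      (hZ.mono fun ω hω => hXR _ (hω k hk).1)
  have hyL : ∀ k, 1 ≤ k → MemLp (Z.yt k) 2 μ := fun k hk =>
    MemLp_two_of_bounded ((hy k hk).mono (𝓕.le _) le_rfl)
      (hZ.mono fun ω hω => hYR _ (hω k hk).2)
  have le_of : ∀ {i : ℕ} {j j' : Fin 7}, j ≤ j' →
      (toLex (i, j) : ℕ ×ₗ Fin 7) ≤ toLex (i, j') := by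
    intro i j j' hj
    rcases hj.eq_or_lt with rfl | hj
    · exact le_rfl
    · exact (toLex_lt_same i hj).le
  have up : ∀ {n i : ℕ} {a : Ω → Vec n} {j j' : Fin 7}, j ≤ j' →
      Measurable[𝓕 (toLex (i, j))] a → Measurable[𝓕 (toLex (i, j'))] a :=
    fun hj ha => ha.mono (𝓕.mono (le_of hj)) le_rfl
  set κ := ‖K + A‖
  have hTn : ∀ i, ‖τ i • (K + A)‖ ^ 2 = τ i ^ 2 * κ ^ 2 := by
    intro i
    rw [norm_smul, mul_pow, Real.norm_eq_abs, sq_abs]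
  -- one more primal error
  have hincx : ∀ i, 1 ≤ i → ∀ (c : ℝ) (P : Ω → Vec p), Measurable[𝓕 (toLex (i, 0))] P →
      MemLp P 2 μ → MemLp (fun ω => P ω + c • (dF i ω + dKy' i ω + dB' i ω)) 2 μ ∧
        ∫ ω, ‖P ω + c • (dF i ω + dKy' i ω + dB' i ω)‖ ^ 2 ∂μ ≤
          ∫ ω, ‖P ω‖ ^ 2 ∂μ + c ^ 2 * (χf ^ 2 + χK ^ 2 + χB ^ 2) := by
    intro i hi c P hP hP2
    obtain ⟨eF, -, -, -, -, eKy', eB'⟩ := hE i hi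
    have hT := sq_norm_smul_id_le (n := p) c
    obtain ⟨m1, v1⟩ := eF.integral_norm_add_map_sq_le hP hP2 _ hT le_rfl
    have k1 : Measurable[𝓕 (toLex (i, 5))]
        fun ω => P ω + (c • ContinuousLinearMap.id ℝ (Vec p)) (dF i ω) :=
      (up (by decide) hP).add
        ((eF.known_later _ (toLex_lt_same i (by decide))).const_smul c)
    obtain ⟨m2, v2⟩ := eKy'.integral_norm_add_map_sq_le k1 m1 _ hT v1
    have k2 : Measurable[𝓕 (toLex (i, 6))]
        fun ω => P ω + (c • ContinuousLinearMap.id ℝ (Vec p)) (dF i ω) +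
          (c • ContinuousLinearMap.id ℝ (Vec p)) (dKy' i ω) :=
      (up (by decide) k1).add
        ((eKy'.known_later _ (toLex_lt_same i (by decide))).const_smul c)
    obtain ⟨m3, v3⟩ := eB'.integral_norm_add_map_sq_le k2 m2 _ hT v2
    have e : ∀ ω, P ω + c • (dF i ω + dKy' i ω + dB' i ω) =
        P ω + (c • ContinuousLinearMap.id ℝ (Vec p)) (dF i ω) +
          (c • ContinuousLinearMap.id ℝ (Vec p)) (dKy' i ω) +
          (c • ContinuousLinearMap.id ℝ (Vec p)) (dB' i ω) := by
      intro ω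
      simp only [smul_apply, ContinuousLinearMap.id_apply]
      module
    simp only [e]
    exact ⟨m3, v3.trans (le_of_eq (by ring))⟩
  -- one more dual error, in two parts
  have hinca : ∀ i, 1 ≤ i → ∀ (c : ℝ) (P : Ω → Vec l), Measurable[𝓕 (toLex (i, 0))] P →
      MemLp P 2 μ →
      MemLp (fun ω => P ω + c • (dKx i ω - dA i ω - (τ i • (K + A)) (dKy i ω + dB i ω))) 2 μ ∧
        ∫ ω, ‖P ω + c • (dKx i ω - dA i ω - (τ i • (K + A)) (dKy i ω + dB i ω))‖ ^ 2 ∂μ ≤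
          ∫ ω, ‖P ω‖ ^ 2 ∂μ +
            c ^ 2 * (χy ^ 2 + χA ^ 2 + τ i ^ 2 * κ ^ 2 * (χK ^ 2 + χB ^ 2)) := by
    intro i hi c P hP hP2
    obtain ⟨-, eKy, eB, eKx, eA, -, -⟩ := hE i hi
    have hT := sq_norm_smul_id_le (n := l) c
    have hT' := sq_norm_smul_id_le (n := l) (-c)
    have hTK : ‖(-c) • (τ i • (K + A))‖ ^ 2 ≤ c ^ 2 * (τ i ^ 2 * κ ^ 2) := by
      rw [norm_smul, mul_pow, hTn, Real.norm_eq_abs, sq_abs, neg_sq]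
    obtain ⟨m1, v1⟩ := eKy.integral_norm_add_map_sq_le (up (by decide) hP) hP2 _ hTK le_rfl
    have k1 : Measurable[𝓕 (toLex (i, 2))]
        fun ω => P ω + ((-c) • (τ i • (K + A))) (dKy i ω) :=
      (up (by decide) hP).add (((-c) • (τ i • (K + A))).continuous.measurable.comp
        (eKy.known_later _ (toLex_lt_same i (by decide))))
    obtain ⟨m2, v2⟩ := eB.integral_norm_add_map_sq_le k1 m1 _ hTK v1
    have k2 : Measurable[𝓕 (toLex (i, 3))]
        fun ω => P ω + ((-c) • (τ i • (K + A))) (dKy i ω) +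
          ((-c) • (τ i • (K + A))) (dB i ω) :=
      (up (by decide) k1).add (((-c) • (τ i • (K + A))).continuous.measurable.comp
        (eB.known_later _ (toLex_lt_same i (by decide))))
    obtain ⟨m3, v3⟩ := eKx.integral_norm_add_map_sq_le k2 m2 _ hT v2
    have k3 : Measurable[𝓕 (toLex (i, 4))]
        fun ω => P ω + ((-c) • (τ i • (K + A))) (dKy i ω) +
          ((-c) • (τ i • (K + A))) (dB i ω) +
          (c • ContinuousLinearMap.id ℝ (Vec l)) (dKx i ω) :=
      (up (by decide) k2).add
        ((eKx.known_later _ (toLex_lt_same i (by decide))).const_smul c)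
    obtain ⟨m4, v4⟩ := eA.integral_norm_add_map_sq_le k3 m3 _ hT' v3
    have e : ∀ ω, P ω + c • (dKx i ω - dA i ω - (τ i • (K + A)) (dKy i ω + dB i ω)) =
        P ω + ((-c) • (τ i • (K + A))) (dKy i ω) +
          ((-c) • (τ i • (K + A))) (dB i ω) +
          (c • ContinuousLinearMap.id ℝ (Vec l)) (dKx i ω) +
          ((-c) • ContinuousLinearMap.id ℝ (Vec l)) (dA i ω) := by
      intro ω
      simp only [smul_apply, ContinuousLinearMap.id_apply, map_add]
      module
    simp only [e]
    exact ⟨m4, v4.trans (le_of_eq (by ring))⟩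
  -- The later part may be added to anything known at call 5, in particular to the earlier part.
  have hincb : ∀ i, 1 ≤ i → ∀ (c : ℝ) (P : Ω → Vec l), Measurable[𝓕 (toLex (i, 5))] P →
      MemLp P 2 μ →
      MemLp (fun ω => P ω + c • ((τ i • (K + A)) (dKy' i ω + dB' i ω))) 2 μ ∧
        ∫ ω, ‖P ω + c • ((τ i • (K + A)) (dKy' i ω + dB' i ω))‖ ^ 2 ∂μ ≤
          ∫ ω, ‖P ω‖ ^ 2 ∂μ + c ^ 2 * (τ i ^ 2 * κ ^ 2 * (χK ^ 2 + χB ^ 2)) := by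
    intro i hi c P hP hP2
    obtain ⟨-, -, -, -, -, eKy', eB'⟩ := hE i hi
    have hTK : ‖c • (τ i • (K + A))‖ ^ 2 ≤ c ^ 2 * (τ i ^ 2 * κ ^ 2) := by
      rw [norm_smul, mul_pow, hTn, Real.norm_eq_abs, sq_abs]
    obtain ⟨m1, v1⟩ := eKy'.integral_norm_add_map_sq_le hP hP2 _ hTK le_rfl
    have k1 : Measurable[𝓕 (toLex (i, 6))]
        fun ω => P ω + (c • (τ i • (K + A))) (dKy' i ω) :=
      (up (by decide) hP).add ((c • (τ i • (K + A))).continuous.measurable.comp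
        (eKy'.known_later _ (toLex_lt_same i (by decide))))
    obtain ⟨m2, v2⟩ := eB'.integral_norm_add_map_sq_le k1 m1 _ hTK v1
    have e : ∀ ω, P ω + c • ((τ i • (K + A)) (dKy' i ω + dB' i ω)) =
        P ω + (c • (τ i • (K + A))) (dKy' i ω) + (c • (τ i • (K + A))) (dB' i ω) := by
      intro ω
      simp only [smul_apply, map_add]
      module
    simp only [e]
    exact ⟨m2, v2.trans (le_of_eq (by ring))⟩
  have hma : ∀ i, 1 ≤ i → Measurable[𝓕 (toLex (i, 5))]
      fun ω => dKx i ω - dA i ω - (τ i • (K + A)) (dKy i ω + dB i ω) := by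
    intro i hi
    obtain ⟨-, eKy, eB, eKx, eA, -, -⟩ := hE i hi
    exact ((eKx.known_later _ (toLex_lt_same i (by decide))).sub
      (eA.known_later _ (toLex_lt_same i (by decide)))).sub
      ((τ i • (K + A)).continuous.measurable.comp
        ((eKy.known_later _ (toLex_lt_same i (by decide))).add
          (eB.known_later _ (toLex_lt_same i (by decide)))))
  have hmb : ∀ i, 1 ≤ i → Measurable[𝓕 (toLex (i + 1, 0))]
      fun ω => (τ i • (K + A)) (dKy' i ω + dB' i ω) := by
    intro i hi
    obtain ⟨-, -, -, -, -, eKy', eB'⟩ := hE i hi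
    exact (τ i • (K + A)).continuous.measurable.comp
      ((eKy'.known_later _ (toLex_lt_succ i _ _)).add (eB'.known_later _ (toLex_lt_succ i _ _)))
  have hmx : ∀ i, 1 ≤ i → Measurable[𝓕 (toLex (i + 1, 0))]
      fun ω => dF i ω + dKy' i ω + dB' i ω := by
    intro i hi
    obtain ⟨eF, -, -, -, -, eKy', eB'⟩ := hE i hi
    exact ((eF.known_later _ (toLex_lt_succ i _ _)).add
      (eKy'.known_later _ (toLex_lt_succ i _ _))).add (eB'.known_later _ (toLex_lt_succ i _ _))
  have hincy : ∀ i, 1 ≤ i → ∀ (c : ℝ) (P : Ω → Vec l), Measurable[𝓕 (toLex (i, 0))] P →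
      MemLp P 2 μ →
      MemLp (fun ω => P ω + c • (dKx i ω - dA i ω - (τ i • (K + A)) (dKy i ω + dB i ω) +
        (τ i • (K + A)) (dKy' i ω + dB' i ω))) 2 μ ∧
        ∫ ω, ‖P ω + c • (dKx i ω - dA i ω - (τ i • (K + A)) (dKy i ω + dB i ω) +
          (τ i • (K + A)) (dKy' i ω + dB' i ω))‖ ^ 2 ∂μ ≤
          ∫ ω, ‖P ω‖ ^ 2 ∂μ +
            c ^ 2 * (χy ^ 2 + χA ^ 2 + 2 * (τ i ^ 2 * κ ^ 2 * (χK ^ 2 + χB ^ 2))) := by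
    intro i hi c P hP hP2
    obtain ⟨m1, v1⟩ := hinca i hi c P hP hP2
    obtain ⟨m2, v2⟩ := hincb i hi c
      (fun ω => P ω + c • (dKx i ω - dA i ω - (τ i • (K + A)) (dKy i ω + dB i ω)))
      ((up (by decide) hP).add ((hma i hi).const_smul c)) m1
    have e : ∀ ω, P ω + c • (dKx i ω - dA i ω - (τ i • (K + A)) (dKy i ω + dB i ω) +
        (τ i • (K + A)) (dKy' i ω + dB' i ω)) =
        P ω + c • (dKx i ω - dA i ω - (τ i • (K + A)) (dKy i ω + dB i ω)) +
          c • (τ i • (K + A)) (dKy' i ω + dB' i ω) := fun ω => by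
      rw [smul_add, add_assoc]
    simp only [e]
    exact ⟨m2, v2.trans (by linarith)⟩
  have hτk : ∀ i ∈ Finset.Icc 1 k, τ i ^ 2 ≤ τ k ^ 2 := fun i hi => by
    have hi' := Finset.mem_Icc.1 hi
    exact pow_le_pow_left₀ (hS.tau_pos i hi'.1).le (hS.tau_mono hi'.1 hi'.2) 2
  have hchi : chiX χf χK ^ 2 = χf ^ 2 + χK ^ 2 := Real.sq_sqrt (by positivity)
  have hKB : 0 ≤ χK ^ 2 + χB ^ 2 := by positivity
  -- The steps `τ_i` increase, so one variance bound with `τ_k` serves all terms of the sum.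
  have hvar : ∀ i ∈ Finset.Icc 1 k, τ i ^ 2 * κ ^ 2 * (χK ^ 2 + χB ^ 2) ≤
      τ k ^ 2 * κ ^ 2 * (chiX χf χK ^ 2 + χB ^ 2) := by
    intro i hi
    rw [hchi]
    refine mul_le_mul (mul_le_mul_of_nonneg_right (hτk i hi) (sq_nonneg _)) ?_ hKB (by positivity)
    nlinarith [sq_nonneg χf]
  have hzero : MemLp (fun _ : Ω => (0 : Vec p)) 2 μ := MemLp.zero'
  have hzero' : MemLp (fun _ : Ω => (0 : Vec l)) 2 μ := MemLp.zero'
  have hx1 : ∀ i, 1 ≤ i → MemLp (fun ω => dF i ω + dKy' i ω + dB' i ω) 2 μ ∧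
      ∫ ω, ‖dF i ω + dKy' i ω + dB' i ω‖ ^ 2 ∂μ ≤ χf ^ 2 + χK ^ 2 + χB ^ 2 := fun i hi => by
    simpa using hincx i hi 1 _ measurable_const hzero
  have ha1 : ∀ i, 1 ≤ i →
      MemLp (fun ω => dKx i ω - dA i ω - (τ i • (K + A)) (dKy i ω + dB i ω)) 2 μ ∧
      ∫ ω, ‖dKx i ω - dA i ω - (τ i • (K + A)) (dKy i ω + dB i ω)‖ ^ 2 ∂μ ≤
        χy ^ 2 + χA ^ 2 + τ i ^ 2 * κ ^ 2 * (χK ^ 2 + χB ^ 2) := fun i hi => by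
    have := hinca i hi 1 _ measurable_const hzero'
    simpa only [zero_add, one_smul, norm_zero, ne_eq, OfNat.ofNat_ne_zero, not_false_eq_true,
      zero_pow, integral_zero, one_pow, one_mul] using this
  have hb1 : ∀ i, 1 ≤ i → MemLp (fun ω => (τ i • (K + A)) (dKy' i ω + dB' i ω)) 2 μ :=
    fun i hi => by
    have := (hincb i hi 1 _ measurable_const hzero').1
    simpa only [zero_add, one_smul] using this
  have hInt : ∀ {n : ℕ} {χ : ℝ} {j : ℕ ×ₗ Fin 7} {d : Ω → Vec n}, CenteredError μ 𝓕 χ j d →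
      Integrable d μ := fun hd => hd.memLp.integrable one_le_two
  have hle : Q0 ρ θ τ σ ΩX ΩY s t χf χK χy χA χB κ k = diamTerm ρ θ τ σ ΩX ΩY k +
      noiseTerm ρ θ τ σ s t (chiX χf χK ^ 2 + χB ^ 2)
        (χy ^ 2 + χA ^ 2 + τ k ^ 2 * κ ^ 2 * (chiX χf χK ^ 2 + χB ^ 2)) k := rfl
  rw [hle]
  refine integral_dualityGap_le hc hf hL hh hX hY hS hq hr hs ht hC hZ hR.driven hN hk
    (havg.1.mono (𝓕.le _) le_rfl) (havg.2.mono (𝓕.le _) le_rfl) (fun i hi => (hx1 i hi).1)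
    (fun i hi => (ha1 i hi).1) hb1 ?_ ?_ ?_ ?_ ?_ ?_ ?_ ?_ ?_ ?_
  · intro i hi
    obtain ⟨eF, -, -, -, -, eKy', eB'⟩ := hE i hi
    have h1 : Integrable (fun ω => dF i ω + dKy' i ω) μ := (hInt eF).add (hInt eKy')
    rw [integral_add h1 (hInt eB'), integral_add (hInt eF) (hInt eKy'), eF.integral_eq_zero,
      eKy'.integral_eq_zero, eB'.integral_eq_zero, add_zero, add_zero]
  · intro i hi
    obtain ⟨-, eKy, eB, eKx, eA, -, -⟩ := hE i hi
    have h1 : Integrable (fun ω => dKx i ω - dA i ω) μ := (hInt eKx).sub (hInt eA)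
    have h2 : Integrable (fun ω => dKy i ω + dB i ω) μ := (hInt eKy).add (hInt eB)
    rw [integral_sub h1 ((τ i • (K + A)).integrable_comp h2), integral_sub (hInt eKx) (hInt eA),
      ContinuousLinearMap.integral_comp_comm _ h2, integral_add (hInt eKy) (hInt eB),
      eKx.integral_eq_zero, eA.integral_eq_zero, eKy.integral_eq_zero, eB.integral_eq_zero,
      add_zero, map_zero, sub_zero, sub_zero]
  · intro i hi
    obtain ⟨-, -, -, -, -, eKy', eB'⟩ := hE i hi
    have h2 : Integrable (fun ω => dKy' i ω + dB' i ω) μ := (hInt eKy').add (hInt eB')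
    rw [ContinuousLinearMap.integral_comp_comm _ h2, integral_add (hInt eKy') (hInt eB'),
      eKy'.integral_eq_zero, eB'.integral_eq_zero, add_zero, map_zero]
  · intro i hi
    obtain ⟨eF, -, -, -, -, eKy', eB'⟩ := hE i hi
    exact ((eF.meanOrth le_rfl (hx i hi) (hxL i hi)).add
      (eKy'.meanOrth (le_of (by decide)) (hx i hi) (hxL i hi))).add
      (eB'.meanOrth (le_of (by decide)) (hx i hi) (hxL i hi))
  · intro i hi
    obtain ⟨-, eKy, eB, eKx, eA, -, -⟩ := hE i hi
    have h1 := ((eKx.meanOrth (le_of (by decide)) (hy i hi) (hyL i hi)).sub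
      (eA.meanOrth (le_of (by decide)) (hy i hi) (hyL i hi))).sub
      ((eKy.meanOrth_map (le_of (by decide)) (hy i hi) (hyL i hi) (τ i • (K + A))).add
        (eB.meanOrth_map (le_of (by decide)) (hy i hi) (hyL i hi) (τ i • (K + A))))
    simp only [← map_add] at h1
    exact h1
  · intro i hi
    obtain ⟨-, -, -, -, -, eKy', eB'⟩ := hE i hi
    have hy' := hR.measurable_yt_succ hh hS hi
    have h1 := (eKy'.meanOrth_map le_rfl hy' (hyL (i + 1) (by omega)) (τ i • (K + A))).add
        (eB'.meanOrth_map (le_of (by decide)) hy' (hyL (i + 1) (by omega)) (τ i • (K + A)))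
    simp only [← map_add] at h1
    exact h1
  · intro i hi
    rw [hchi]
    exact (hx1 i (Finset.mem_Icc.1 hi).1).2
  · intro i hi
    exact (ha1 i (Finset.mem_Icc.1 hi).1).2.trans (add_le_add_right (hvar i hi) _)
  · refine (integral_norm_sum_sq_le (m := fun i => 𝓕 (toLex (i, 0))) hmono hmx hincx (gam θ)
      k).trans (Finset.sum_le_sum fun i _ => mul_le_mul_of_nonneg_left ?_ (sq_nonneg _))
    rw [hchi]
    nlinarith [sq_nonneg χf]
  -- The contribution of `K + A` occurs twice, from the early and the late calls. This is within the
  -- bound `2 vy`.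
  · refine (integral_norm_sum_sq_le (m := fun i => 𝓕 (toLex (i, 0))) hmono
      (fun i hi => ((hma i hi).mono (𝓕.mono (toLex_lt_succ i _ _).le) le_rfl).add (hmb i hi))
      hincy (gam θ) k).trans
      (Finset.sum_le_sum fun i hi => mul_le_mul_of_nonneg_left ?_ (sq_nonneg _))
    have := hvar i hi
    nlinarith [sq_nonneg χy, sq_nonneg χA]

end Run

/-! ### Exponential moments of light-tailed errors -/

section ExpMoments

variable {Ω : Type*} {m mΩ : MeasurableSpace Ω} {μ : Measure Ω} {n : ℕ}

/-- A conditional bound in integrated form: on the smaller σ-algebra the measure with density `H` is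
at most `C • μ`, and both are applied to `G`. No integrability of `G` is required, so exponential
moments can be multiplied freely. -/
theorem lintegral_mul_le_of_setLIntegral_le [IsFiniteMeasure μ] (hm : m ≤ mΩ) {H : Ω → ℝ≥0∞}
    (hH : Measurable H) {C : ℝ≥0∞}
    (hle : ∀ s, MeasurableSet[m] s → ∫⁻ ω in s, H ω ∂μ ≤ C * μ s) {G : Ω → ℝ≥0∞}
    (hG : Measurable[m] G) : ∫⁻ ω, G ω * H ω ∂μ ≤ C * ∫⁻ ω, G ω ∂μ := by
  have h1 : (μ.withDensity H).trim hm ≤ C • μ.trim hm := by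
    refine Measure.le_iff.2 fun s hs => ?_
    rw [trim_measurableSet_eq hm hs, withDensity_apply _ (hm s hs), Measure.smul_apply,
      trim_measurableSet_eq hm hs]
    exact hle s hs
  have h2 : ∫⁻ ω, G ω * H ω ∂μ = ∫⁻ ω, G ω ∂(μ.withDensity H).trim hm := by
    rw [lintegral_trim hm hG, lintegral_withDensity_eq_lintegral_mul _ hH (hG.mono hm le_rfl)]
    simp only [Pi.mul_apply, mul_comm]
  rw [h2, ← lintegral_trim hm hG, ← smul_eq_mul, ← lintegral_smul_measure]
  exact lintegral_mono' h1 le_rfl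

/-- Azuma's inequality for partial sums with sub-Gaussian conditional moments. -/
theorem measure_lt_sum_le [IsProbabilityMeasure μ] {𝓖 : ℕ → MeasurableSpace Ω}
    (h𝓖 : ∀ i, 𝓖 i ≤ mΩ) {ξ : ℕ → Ω → ℝ} {v : ℕ → ℝ}
    (hξ : ∀ i j, 1 ≤ j → j < i → Measurable[𝓖 i] (ξ j))
    (hmgf : ∀ i, 1 ≤ i → ∀ (c : ℝ) (G : Ω → ℝ≥0∞), Measurable[𝓖 i] G →
      ∫⁻ ω, G ω * ENNReal.ofReal (Real.exp (c * ξ i ω)) ∂μ ≤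
        ENNReal.ofReal (Real.exp (3 / 4 * c ^ 2 * v i)) * ∫⁻ ω, G ω ∂μ)
    {k : ℕ} (hV : 0 < ∑ i ∈ Finset.Icc 1 k, v i) {lam : ℝ}
    (hlam : 0 < lam) :
    μ {ω | lam * √(∑ i ∈ Finset.Icc 1 k, v i) < ∑ i ∈ Finset.Icc 1 k, ξ i ω} ≤
      ENNReal.ofReal (Real.exp (-lam ^ 2 / 3)) := by
  -- With `G` the exponential of the earlier partial sum, `hmgf` removes the last increment.
  have key : ∀ (c : ℝ) (k : ℕ),
      ∫⁻ ω, ENNReal.ofReal (Real.exp (c * ∑ i ∈ Finset.Icc 1 k, ξ i ω)) ∂μ ≤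
        ENNReal.ofReal (Real.exp (3 / 4 * c ^ 2 * ∑ i ∈ Finset.Icc 1 k, v i)) := by
    intro c k
    induction k with
    | zero => simp
    | succ k ih =>
      simp only [Finset.sum_Icc_succ_top (Nat.le_add_left 1 k), mul_add, Real.exp_add,
        ENNReal.ofReal_mul (Real.exp_pos _).le]
      refine (hmgf (k + 1) (by omega) c
        (fun ω => ENNReal.ofReal (Real.exp (c * ∑ i ∈ Finset.Icc 1 k, ξ i ω))) ?_).trans ?_
      · refine ENNReal.measurable_ofReal.comp (Real.measurable_exp.comp ?_)
        refine Measurable.const_mul (Finset.measurable_sum _ fun i hi => ?_) c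
        have hi' := Finset.mem_Icc.1 hi
        exact hξ _ _ hi'.1 (by omega)
      · rw [mul_comm]
        gcongr
  have hmeas : Measurable fun ω => ∑ i ∈ Finset.Icc 1 k, ξ i ω :=
    Finset.measurable_sum _ fun i hi =>
      (hξ (i + 1) i (Finset.mem_Icc.1 hi).1 (by omega)).mono (h𝓖 _) le_rfl
  set V := ∑ i ∈ Finset.Icc 1 k, v i with hVdef
  have hsV : 0 < √V := Real.sqrt_pos.2 hV
  have hsq : √V ^ 2 = V := Real.sq_sqrt hV.le
  -- The minimizer of `3 c² V / 4 - c lam √V`, with minimum `-lam² / 3`.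
  set c := 2 * lam / (3 * √V) with hc
  have hc0 : 0 < c := by positivity
  have hsub : {ω | lam * √V < ∑ i ∈ Finset.Icc 1 k, ξ i ω} ⊆
      {ω | ENNReal.ofReal (Real.exp (c * (lam * √V))) ≤
        ENNReal.ofReal (Real.exp (c * ∑ i ∈ Finset.Icc 1 k, ξ i ω))} := fun ω hω =>
    ENNReal.ofReal_le_ofReal (Real.exp_le_exp.2 (mul_le_mul_of_nonneg_left (le_of_lt hω) hc0.le))
  refine (measure_mono hsub).trans ?_
  have hpos : 0 < Real.exp (c * (lam * √V)) := Real.exp_pos _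
  refine (meas_ge_le_lintegral_div (ENNReal.measurable_ofReal.comp (Real.measurable_exp.comp
    (hmeas.const_mul c))).aemeasurable (ENNReal.ofReal_pos.2 hpos).ne'
    ENNReal.ofReal_ne_top).trans ?_
  refine (ENNReal.div_le_div_right (key c k) _).trans ?_
  rw [← ENNReal.ofReal_div_of_pos hpos, ← Real.exp_sub]
  refine ENNReal.ofReal_le_ofReal (Real.exp_le_exp.2 (le_of_eq ?_))
  have h1 : c * √V = 2 * lam / 3 := by rw [hc]; field_simp
  rw [← hVdef]
  nth_rewrite 1 [← hsq]
  linear_combination (3 / 4 * (c * √V + 2 * lam / 3) - lam) * h1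

namespace LightError

variable {ι : Type*} [Preorder ι] {𝓕 : Filtration ι mΩ} {χ : ℝ} {i : ι} {d : Ω → Vec n}

theorem setIntegral_exp_le [IsFiniteMeasure μ] (hd : LightError μ 𝓕 χ i d) {s : Set Ω}
    (hs : MeasurableSet[𝓕 i] s) :
    ∫ ω in s, Real.exp (‖d ω‖ ^ 2 / χ ^ 2) ∂μ ≤ Real.exp 1 * μ.real s := by
  rw [← setIntegral_condExp (𝓕.le i) hd.integrable_exp hs]
  refine (setIntegral_mono_ae integrable_condExp.integrableOn
    (integrable_const (Real.exp 1)).integrableOn hd.tail_le).trans (le_of_eq ?_)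
  rw [setIntegral_const, smul_eq_mul, mul_comm]

/-- If `H` is dominated by a combination of a centered term, of the exponential of the squared
error and of a constant, its mean given the past is at most that of the combination. -/
theorem lintegral_mul_le_of_le [IsFiniteMeasure μ] (hd : LightError μ 𝓕 χ i d) {Z : Ω → Vec n}
    (hZ : Measurable[𝓕 i] Z) {D : ℝ} (hZD : ∀ᵐ ω ∂μ, ‖Z ω‖ ≤ D) {H : Ω → ℝ} (hH : Measurable H)
    (hH0 : ∀ ω, 0 ≤ H ω) {α β : ℝ} (hα : 0 ≤ α)
    (hle : ∀ᵐ ω ∂μ, H ω ≤ ⟪Z ω, d ω⟫_ℝ + α * Real.exp (‖d ω‖ ^ 2 / χ ^ 2) + β)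
    {G : Ω → ℝ≥0∞} (hG : Measurable[𝓕 i] G) :
    ∫⁻ ω, G ω * ENNReal.ofReal (H ω) ∂μ ≤
      ENNReal.ofReal (α * Real.exp 1 + β) * ∫⁻ ω, G ω ∂μ := by
  refine lintegral_mul_le_of_setLIntegral_le (𝓕.le i) hH.ennreal_ofReal (fun s hs => ?_) hG
  have hs' := 𝓕.le i s hs
  have hZd : ∀ {W : Ω → Vec n}, Measurable[𝓕 i] W → (∀ᵐ ω ∂μ, ‖W ω‖ ≤ D) →
      Integrable (fun ω => ⟪W ω, d ω⟫_ℝ) μ := fun hW hWD => by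
    refine (hd.integrable.norm.const_mul D).mono'
      ((hW.mono (𝓕.le i) le_rfl).aestronglyMeasurable.inner hd.integrable.1) ?_
    filter_upwards [hWD] with ω hω
    exact (norm_inner_le_norm _ _).trans (mul_le_mul_of_nonneg_right hω (norm_nonneg _))
  have hI := hZd hZ hZD
  have hR : Integrable
      (fun ω => ⟪Z ω, d ω⟫_ℝ + α * Real.exp (‖d ω‖ ^ 2 / χ ^ 2) + β) μ :=
    (hI.add (hd.integrable_exp.const_mul α)).add (integrable_const β)
  have hHi : Integrable H μ := hR.mono' hH.aestronglyMeasurable (by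
    filter_upwards [hle] with ω hω
    rwa [Real.norm_of_nonneg (hH0 ω)])
  have hzero : ∫ ω in s, ⟪Z ω, d ω⟫_ℝ ∂μ = 0 := by
    have hZs : Measurable[𝓕 i] (s.indicator Z) := hZ.indicator hs
    have hZsD : ∀ᵐ ω ∂μ, ‖s.indicator Z ω‖ ≤ D := by
      filter_upwards [hZD] with ω hω
      exact (norm_indicator_le_norm_self _ _).trans hω
    rw [← integral_indicator hs',
      ← integral_inner_eq_zero (𝓕.le i) hd.integrable hd.centered hZs (hZd hZs hZsD)]
    refine integral_congr_ae (ae_of_all _ fun ω => ?_)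
    by_cases hω : ω ∈ s <;> simp [hω]
  rw [← ofReal_integral_eq_lintegral_ofReal hHi.integrableOn (ae_of_all _ hH0),
    ← ofReal_measureReal, ← ENNReal.ofReal_mul' measureReal_nonneg]
  refine ENNReal.ofReal_le_ofReal ?_
  refine (setIntegral_mono_ae hHi.integrableOn hR.integrableOn hle).trans ?_
  have hIα : Integrable (fun ω => ⟪Z ω, d ω⟫_ℝ + α * Real.exp (‖d ω‖ ^ 2 / χ ^ 2)) μ :=
    hI.add (hd.integrable_exp.const_mul α)
  rw [integral_add hIα.integrableOn
      (integrable_const β).integrableOn,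
    integral_add hI.integrableOn (hd.integrable_exp.const_mul α).integrableOn, hzero,
    integral_const_mul, setIntegral_const, smul_eq_mul]
  nlinarith [hd.setIntegral_exp_le hs, mul_le_mul_of_nonneg_left (hd.setIntegral_exp_le hs) hα]

theorem lintegral_mul_exp_sq_le [IsFiniteMeasure μ] (hd : LightError μ 𝓕 χ i d)
    (hdm : Measurable d) {G : Ω → ℝ≥0∞} (hG : Measurable[𝓕 i] G) :
    ∫⁻ ω, G ω * ENNReal.ofReal (Real.exp (‖d ω‖ ^ 2 / χ ^ 2)) ∂μ ≤
      ENNReal.ofReal (Real.exp 1) * ∫⁻ ω, G ω ∂μ := by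
  have := hd.lintegral_mul_le_of_le (Z := fun _ => 0) measurable_const (D := 0)
    (ae_of_all _ fun _ => by simp) (H := fun ω => Real.exp (‖d ω‖ ^ 2 / χ ^ 2))
    (Real.measurable_exp.comp ((hdm.norm.pow_const 2).div_const _)) (fun ω => (Real.exp_pos _).le)
    (α := 1) (β := 0) zero_le_one (ae_of_all _ fun ω => by simp) hG
  simpa using this

/-- The conditional moment generating function of a bounded multiple of a light-tailed error. -/
theorem lintegral_mul_exp_inner_le [IsFiniteMeasure μ] (hd : LightError μ 𝓕 χ i d)
    (hdm : Measurable d) (hχ : 0 < χ) {Z : Ω → Vec n} (hZ : Measurable[𝓕 i] Z) {D : ℝ}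
    (hZD : ∀ᵐ ω ∂μ, ‖Z ω‖ ≤ D) (c : ℝ) {G : Ω → ℝ≥0∞} (hG : Measurable[𝓕 i] G) :
    ∫⁻ ω, G ω * ENNReal.ofReal (Real.exp (c * ⟪Z ω, d ω⟫_ℝ)) ∂μ ≤
      ENNReal.ofReal (Real.exp (3 / 4 * c ^ 2 * (D ^ 2 * χ ^ 2))) * ∫⁻ ω, G ω ∂μ := by
  have hH : Measurable fun ω => Real.exp (c * ⟪Z ω, d ω⟫_ℝ) :=
    Real.measurable_exp.comp (((hZ.mono (𝓕.le i) le_rfl).inner hdm).const_mul c)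
  have hin : ∀ᵐ ω ∂μ, |⟪Z ω, d ω⟫_ℝ| ≤ D * ‖d ω‖ := by
    filter_upwards [hZD] with ω hω
    exact (abs_real_inner_le_norm _ _).trans (mul_le_mul_of_nonneg_right hω (norm_nonneg _))
  set v := c ^ 2 * (D ^ 2 * χ ^ 2) with hv
  have hv0 : 0 ≤ v := by positivity
  -- For small `v` the linear term of `exp_le_add_exp_sq` averages to zero, and `exp_mul_le` with `κ
  -- = 9 v / 16 ≤ 1` gives `exp (9 v / 16)`. As `exp_mul_le` is affine in the exponential, no
  -- conditional Jensen inequality is needed.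
  rcases le_or_gt v (16 / 9) with h | h
  · refine (hd.lintegral_mul_le_of_le (hZ.const_smul c) (D := |c| * D) ?_ hH
      (fun ω => (Real.exp_pos _).le) (α := 9 * v / 16 * Real.exp (9 * v / 16 - 1))
      (β := (1 - 9 * v / 16) * Real.exp (9 * v / 16)) (by positivity) ?_ hG).trans ?_
    · filter_upwards [hZD] with ω hω
      rw [Pi.smul_apply, norm_smul, Real.norm_eq_abs]
      exact mul_le_mul_of_nonneg_left hω (abs_nonneg c)
    · filter_upwards [hin] with ω hω
      have h1 := exp_le_add_exp_sq (c * ⟪Z ω, d ω⟫_ℝ)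
      have h2 := exp_mul_le (κ := 9 * v / 16) (by positivity) (by linarith)
        (‖d ω‖ ^ 2 / χ ^ 2)
      have h3 : 9 * (c * ⟪Z ω, d ω⟫_ℝ) ^ 2 / 16 ≤ 9 * v / 16 * (‖d ω‖ ^ 2 / χ ^ 2) := by
        have h4 : ⟪Z ω, d ω⟫_ℝ ^ 2 ≤ (D * ‖d ω‖) ^ 2 := sq_le_sq' (abs_le.1 hω).1 (abs_le.1 hω).2
        have h5 := mul_le_mul_of_nonneg_left h4 (sq_nonneg c)
        have h6 : v * (‖d ω‖ ^ 2 / χ ^ 2) = c ^ 2 * (D * ‖d ω‖) ^ 2 := by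
          rw [hv]; field_simp
        nlinarith
      have h4 := Real.exp_le_exp.2 h3
      rw [Pi.smul_apply, real_inner_smul_left]
      linarith
    · refine mul_le_mul_left (ENNReal.ofReal_le_ofReal ?_) _
      have h1 : Real.exp (9 * v / 16 - 1) * Real.exp 1 = Real.exp (9 * v / 16) := by
        rw [← Real.exp_add]; ring_nf
      have h2 : Real.exp (9 * v / 16) ≤ Real.exp (3 / 4 * c ^ 2 * (D ^ 2 * χ ^ 2)) :=
        Real.exp_le_exp.2 (by rw [mul_assoc, ← hv]; linarith)
      linear_combination h2 + 9 * v / 16 * h1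
  -- For large `v` centering is not used. Young's inequality `a b ≤ 3 a² / 8 + 2 b² / 3` gives `exp
  -- (3 v / 8 + 2 / 3)`, and `2 / 3 ≤ 3 v / 8` precisely when `v ≥ 16 / 9`.
  · refine (hd.lintegral_mul_le_of_le (Z := fun _ => 0) measurable_const (D := 0)
      (ae_of_all _ fun _ => by simp) hH
      (fun ω => (Real.exp_pos _).le)
      (α := Real.exp (3 * v / 8) * (2 / 3 * Real.exp (2 / 3 - 1)))
      (β := Real.exp (3 * v / 8) * ((1 - 2 / 3) * Real.exp (2 / 3))) (by positivity) ?_ hG).trans ?_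
    · filter_upwards [hin] with ω hω
      have h2 := exp_mul_le (κ := 2 / 3) (by norm_num) (by norm_num) (‖d ω‖ ^ 2 / χ ^ 2)
      have h3 : c * ⟪Z ω, d ω⟫_ℝ ≤ 3 * v / 8 + 2 / 3 * (‖d ω‖ ^ 2 / χ ^ 2) := by
        have h4 : c * ⟪Z ω, d ω⟫_ℝ ≤ |c| * (D * ‖d ω‖) :=
          (le_abs_self _).trans (by rw [abs_mul]; exact mul_le_mul_of_nonneg_left hω (abs_nonneg c))
        have h5 : |c| * (D * ‖d ω‖) = (|c| * D * χ) * (‖d ω‖ / χ) := by field_simp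
        have h6 : v = (|c| * D * χ) ^ 2 := by rw [mul_pow, mul_pow, sq_abs, hv]; ring
        have h7 : ‖d ω‖ ^ 2 / χ ^ 2 = (‖d ω‖ / χ) ^ 2 := by rw [div_pow]
        rw [h6, h7]
        nlinarith [sq_nonneg (3 * (|c| * D * χ) - 4 * (‖d ω‖ / χ))]
      have h4 := Real.exp_le_exp.2 h3
      rw [Real.exp_add] at h4
      have h5 := mul_le_mul_of_nonneg_left h2 (Real.exp_pos (3 * v / 8)).le
      rw [inner_zero_left]
      linarith
    · refine mul_le_mul_left (ENNReal.ofReal_le_ofReal ?_) _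
      have h1 : Real.exp (2 / 3 - 1) * Real.exp 1 = Real.exp (2 / 3) := by
        rw [← Real.exp_add]; ring_nf
      have h2 : Real.exp (3 * v / 8) * Real.exp (2 / 3) ≤
          Real.exp (3 / 4 * c ^ 2 * (D ^ 2 * χ ^ 2)) := by
        rw [← Real.exp_add]
        exact Real.exp_le_exp.2 (by rw [mul_assoc, ← hv]; linarith)
      linear_combination h2 + 2 / 3 * Real.exp (3 * v / 8) * h1

end LightError

end ExpMoments

/-! ### Projected reference sequences -/

section Reference

variable {Ω : Type*} {n : ℕ}

theorem exists_projection {C : Set (Vec n)} (hne : C.Nonempty) (hcl : IsClosed C)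
    (hC : Convex ℝ C) :
    ∃ P : Vec n → Vec n, (∀ u, P u ∈ C) ∧ (∀ u v, ‖P u - P v‖ ≤ ‖u - v‖) ∧
      ∀ u, ∀ x ∈ C, ‖P u - x‖ ≤ ‖u - x‖ := by
  choose P hPC hP using exists_norm_eq_iInf_of_complete_convex hne hcl.isComplete hC
  have hin : ∀ u, ∀ w ∈ C, ⟪u - P u, w - P u⟫_ℝ ≤ 0 := fun u =>
    (norm_eq_iInf_iff_real_inner_le_zero hC (hPC u)).1 (hP u)
  refine ⟨P, hPC, fun u v => ?_, fun u x hx => ?_⟩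
  · exact norm_sub_le_of_inner_le (hin u _ (hPC v)) (by simpa using hin v _ (hPC u))
  · exact norm_sub_le_of_inner_le (hin u _ hx) (by simp)

/-- The sequence of projected steps `a₁ = x₀`, `a_{k+1} = P (a_k + v_k)`. -/
def projSteps (P : Vec n → Vec n) (x₀ : Vec n) (v : ℕ → Vec n) : ℕ → Vec n
  | 0 => x₀
  | 1 => x₀
  | k + 2 => P (projSteps P x₀ v (k + 1) + v (k + 1))

theorem projSteps_succ (P : Vec n → Vec n) (x₀ : Vec n) (v : ℕ → Vec n) {k : ℕ} (hk : 1 ≤ k) :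
    projSteps P x₀ v (k + 1) = P (projSteps P x₀ v k + v k) := by
  obtain ⟨j, rfl⟩ := Nat.exists_eq_add_of_le' hk
  rfl

/-- An adapted sequence that competes with all points of `X` simultaneously. -/
theorem exists_reference {𝓖 : ℕ → MeasurableSpace Ω} (hmono : ∀ k, 1 ≤ k → 𝓖 k ≤ 𝓖 (k + 1))
    {X : Set (Vec n)} (hne : X.Nonempty) {R : ℝ} (hR : 0 ≤ R)
    (hX : ∀ x ∈ X, ∀ x' ∈ X, ‖x - x'‖ ^ 2 ≤ 2 * R ^ 2)
    {γ η : ℕ → ℝ} (hγ : ∀ k, 1 ≤ k → 0 < γ k) (hη : ∀ k, 1 ≤ k → 0 < η k)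
    (hγη : ∀ k, 1 ≤ k → γ k / η k ≤ γ (k + 1) / η (k + 1)) {δ : ℕ → Ω → Vec n}
    (hδ : ∀ k, 1 ≤ k → Measurable[𝓖 (k + 1)] (δ k)) :
    ∃ a : ℕ → Ω → Vec n, (∀ k, 1 ≤ k → Measurable[𝓖 k] (a k)) ∧
      (∀ k, 1 ≤ k → ∀ ω, ∀ x ∈ X, ‖a k ω - x‖ ≤ √2 * R) ∧
      ∀ k, 1 ≤ k → ∀ ω, ∀ x ∈ X, ∑ i ∈ Finset.Icc 1 k, γ i * ⟪δ i ω, x - a i ω⟫_ℝ ≤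
        γ k / η k * R ^ 2 + ∑ i ∈ Finset.Icc 1 k, γ i * (η i / 2 * ‖δ i ω‖ ^ 2) := by
  have hXR : ∀ x ∈ X, ∀ x' ∈ X, ‖x - x'‖ ≤ √2 * R := fun x hx x' hx' => by
    refine le_of_sq_le_sq ?_ (by positivity)
    rw [mul_pow, Real.sq_sqrt zero_le_two]
    exact hX x hx x' hx'
  -- `X` need not be closed or convex. Points of `C` are still within the diameter of `X` from every
  -- point of `X`, since closed balls are closed and convex.
  set C := closure (convexHull ℝ X) with hCdef
  have hXC : X ⊆ C := (subset_convexHull ℝ X).trans subset_closure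
  obtain ⟨P, hPC, hPl, hPx⟩ := exists_projection (hne.mono hXC) isClosed_closure
    (convex_convexHull ℝ X).closure
  obtain ⟨x₀, hx₀⟩ := hne
  set a : ℕ → Ω → Vec n := fun k ω => projSteps P x₀ (fun i => η i • δ i ω) k with ha
  have hsucc : ∀ k, 1 ≤ k → ∀ ω, a (k + 1) ω = P (a k ω + η k • δ k ω) := fun k hk ω =>
    projSteps_succ P x₀ _ hk
  have hmem : ∀ k, 1 ≤ k → ∀ ω, a k ω ∈ C := fun k hk ω => by
    induction k, hk using Nat.le_induction with
    | base => exact hXC hx₀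
    | succ k hk _ => rw [hsucc k hk]; exact hPC _
  have hball : ∀ x ∈ X, ∀ w ∈ C, ‖w - x‖ ≤ √2 * R := fun x hx w hw => by
    have h1 : C ⊆ Metric.closedBall x (√2 * R) :=
      closure_minimal (convexHull_min (fun x' hx' => by
        rw [mem_closedBall_iff_norm]; exact hXR x' hx' x hx) (convex_closedBall _ _))
        Metric.isClosed_closedBall
    exact mem_closedBall_iff_norm.1 (h1 hw)
  refine ⟨a, fun k hk => ?_, fun k hk ω x hx => hball x hx _ (hmem k hk ω), fun k hk ω x hx => ?_⟩
  · induction k, hk using Nat.le_induction with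
    | base => exact measurable_const
    | succ k hk ih =>
      have h1 : a (k + 1) = fun ω => P (a k ω + η k • δ k ω) := funext (hsucc k hk)
      rw [h1]
      have h2 : LipschitzWith 1 P := LipschitzWith.of_dist_le_mul fun u v => by
        simpa [dist_eq_norm] using hPl u v
      exact h2.continuous.measurable.comp
        ((ih.mono (hmono k hk) le_rfl).add ((hδ k hk).const_smul (η k)))
  -- One projected step: the projection does not increase the distance to `x ∈ X`, and expanding the
  -- square gives the inner product.
  · have hstep : ∀ k, 1 ≤ k → γ k * ⟪δ k ω, x - a k ω⟫_ℝ ≤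
        γ k / η k * (‖a k ω - x‖ ^ 2 / 2) - γ k / η k * (‖a (k + 1) ω - x‖ ^ 2 / 2) +
          γ k * (η k / 2 * ‖δ k ω‖ ^ 2) := fun k hk => by
      have h1 : ‖a (k + 1) ω - x‖ ^ 2 ≤ ‖a k ω - x + η k • δ k ω‖ ^ 2 := by
        rw [hsucc k hk]
        refine pow_le_pow_left₀ (norm_nonneg _) ((hPx _ x (hXC hx)).trans (le_of_eq ?_)) 2
        congr 1
        abel
      rw [norm_add_sq_real, real_inner_smul_right, norm_smul, mul_pow, Real.norm_eq_abs, sq_abs,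
        real_inner_comm, ← neg_sub x (a k ω), inner_neg_right, norm_neg] at h1
      rw [norm_sub_rev (a k ω)]
      have h2 := mul_le_mul_of_nonneg_left h1 (div_pos (hγ k hk) (hη k hk)).le
      have h3 : γ k / η k * η k = γ k := div_mul_cancel₀ _ (hη k hk).ne'
      linear_combination h2 / 2 - (⟪δ k ω, x - a k ω⟫_ℝ - η k / 2 * ‖δ k ω‖ ^ 2) * h3
    have hb : ∀ k, 1 ≤ k → ‖a k ω - x‖ ^ 2 / 2 ≤ R ^ 2 := fun k hk => by
      have h1 := pow_le_pow_left₀ (norm_nonneg _) (hball x hx _ (hmem k hk ω)) 2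
      rw [mul_pow, Real.sq_sqrt zero_le_two] at h1
      linarith
    suffices H : ∑ i ∈ Finset.Icc 1 k, γ i * ⟪δ i ω, x - a i ω⟫_ℝ ≤
        γ k / η k * R ^ 2 - γ k / η k * (‖a (k + 1) ω - x‖ ^ 2 / 2) +
          ∑ i ∈ Finset.Icc 1 k, γ i * (η i / 2 * ‖δ i ω‖ ^ 2) by
      have := mul_nonneg (div_pos (hγ k hk) (hη k hk)).le
        (by positivity : 0 ≤ ‖a (k + 1) ω - x‖ ^ 2 / 2)
      linarith
    induction k, hk using Nat.le_induction with
    | base =>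
      have h1 := hstep 1 le_rfl
      have h2 := mul_le_mul_of_nonneg_left (hb 1 le_rfl) (div_pos (hγ 1 le_rfl) (hη 1 le_rfl)).le
      simp only [Finset.Icc_self, Finset.sum_singleton]
      linarith
    | succ k hk ih =>
      rw [Finset.sum_Icc_succ_top (by omega), Finset.sum_Icc_succ_top (by omega)]
      have h1 := hstep (k + 1) (by omega)
      have h2 := mul_nonneg (sub_nonneg.2 (hγη k hk)) (sub_nonneg.2 (hb (k + 1) (by omega)))
      nlinarith

end Reference

/-! ### Weighted sums of squared errors -/

section Squares

variable {Ω : Type*} {mΩ : MeasurableSpace Ω} {μ : Measure Ω} {n : ℕ}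

/-- Convexity of the exponential in the normalized weights, then Markov's inequality. The summands
may depend on each other in any way. -/
theorem measure_lt_weighted_sum_le {ι : Type*} {s : Finset ι} {w : ι → ℝ}
    (hw : ∀ i ∈ s, 0 ≤ w i) (hW : 0 < ∑ i ∈ s, w i) {U : ι → Ω → ℝ}
    (hU : ∀ i ∈ s, Measurable (U i)) {C : ℝ≥0∞}
    (hC : ∀ i ∈ s, ∫⁻ ω, ENNReal.ofReal (Real.exp (U i ω)) ∂μ ≤ C) (c : ℝ) :
    μ {ω | c * ∑ i ∈ s, w i < ∑ i ∈ s, w i * U i ω} ≤ C * ENNReal.ofReal (Real.exp (-c)) := by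
  set W := ∑ i ∈ s, w i with hWdef
  have hmeas : Measurable fun ω => ∑ i ∈ s, w i / W * U i ω :=
    Finset.measurable_sum _ fun i hi => (hU i hi).const_mul _
  have hw' : ∀ i ∈ s, 0 ≤ w i / W := fun i hi => div_nonneg (hw i hi) hW.le
  have hsum : ∑ i ∈ s, w i / W = 1 := by rw [← Finset.sum_div, div_self hW.ne']
  have hsub : {ω | c * W < ∑ i ∈ s, w i * U i ω} ⊆
      {ω | ENNReal.ofReal (Real.exp c) ≤
        ENNReal.ofReal (Real.exp (∑ i ∈ s, w i / W * U i ω))} := fun ω hω => by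
    refine ENNReal.ofReal_le_ofReal (Real.exp_le_exp.2 ?_)
    have h1 : ∑ i ∈ s, w i / W * U i ω = (∑ i ∈ s, w i * U i ω) / W := by
      rw [Finset.sum_div]
      exact Finset.sum_congr rfl fun i _ => by ring
    rw [h1, le_div_iff₀ hW]
    exact le_of_lt hω
  have hInt : ∫⁻ ω, ENNReal.ofReal (Real.exp (∑ i ∈ s, w i / W * U i ω)) ∂μ ≤ C := by
    calc ∫⁻ ω, ENNReal.ofReal (Real.exp (∑ i ∈ s, w i / W * U i ω)) ∂μ
        ≤ ∫⁻ ω, ∑ i ∈ s, ENNReal.ofReal (w i / W) * ENNReal.ofReal (Real.exp (U i ω)) ∂μ := by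
          refine lintegral_mono fun ω => ?_
          have h1 := convexOn_exp.map_sum_le (p := fun i => U i ω) hw' hsum
            (fun i _ => Set.mem_univ _)
          simp only [smul_eq_mul] at h1
          refine (ENNReal.ofReal_le_ofReal h1).trans (le_of_eq ?_)
          rw [ENNReal.ofReal_sum_of_nonneg fun i hi => mul_nonneg (hw' i hi) (Real.exp_pos _).le]
          exact Finset.sum_congr rfl fun i hi => ENNReal.ofReal_mul (hw' i hi)
      _ = ∑ i ∈ s, ENNReal.ofReal (w i / W) * ∫⁻ ω, ENNReal.ofReal (Real.exp (U i ω)) ∂μ := by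
          have hUe : ∀ i ∈ s, Measurable fun ω => ENNReal.ofReal (Real.exp (U i ω)) :=
            fun i hi => (Real.measurable_exp.comp (hU i hi)).ennreal_ofReal
          rw [lintegral_finsetSum _ fun i hi => (hUe i hi).const_mul _]
          exact Finset.sum_congr rfl fun i hi => lintegral_const_mul _ (hUe i hi)
      _ ≤ ∑ i ∈ s, ENNReal.ofReal (w i / W) * C := by
          gcongr with i hi
          exact hC i hi
      _ = C := by
          rw [← Finset.sum_mul, ← ENNReal.ofReal_sum_of_nonneg hw', hsum, ENNReal.ofReal_one,
            one_mul]
  refine (measure_mono hsub).trans ?_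
  refine (meas_ge_le_lintegral_div (Real.measurable_exp.comp hmeas).ennreal_ofReal.aemeasurable
    (ENNReal.ofReal_pos.2 (Real.exp_pos c)).ne' ENNReal.ofReal_ne_top).trans ?_
  rw [Real.exp_neg, ENNReal.ofReal_inv_of_pos (Real.exp_pos c), ← div_eq_mul_inv]
  exact ENNReal.div_le_div_right hInt _

/-- A case of the Cauchy–Schwarz inequality. It lets the sum of two errors be scaled by `χ_x² =
χ_{x,f}² + χ_{x,K}²`. -/
theorem add_sq_div_le {a b c d : ℝ} (hc : 0 < c) (hd : 0 < d) :
    (a + b) ^ 2 / (c ^ 2 + d ^ 2) ≤ a ^ 2 / c ^ 2 + b ^ 2 / d ^ 2 := by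
  rw [div_add_div _ _ (by positivity) (by positivity),
    div_le_div_iff₀ (by positivity) (by positivity)]
  nlinarith [sq_nonneg (a * d ^ 2 - b * c ^ 2)]

variable {ι : Type*} [Preorder ι] {𝓕 : Filtration ι mΩ} [IsProbabilityMeasure μ]

theorem LightError.lintegral_exp_sq_le {χ : ℝ} {i : ι} {d : Ω → Vec n}
    (hd : LightError μ 𝓕 χ i d) (hdm : Measurable d) :
    ∫⁻ ω, ENNReal.ofReal (Real.exp (‖d ω‖ ^ 2 / χ ^ 2)) ∂μ ≤ ENNReal.ofReal (Real.exp 1) := by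
  simpa using hd.lintegral_mul_exp_sq_le hdm (G := fun _ => 1) measurable_const

/-- The exponential splits into two factors, removed one after the other by conditioning. The
resulting `exp 2` is affordable, as the constant 3 of the final bound only has to exceed `exp 1`. -/
theorem LightError.lintegral_exp_sq_add_le {χ χ' : ℝ} (hχ : 0 < χ) (hχ' : 0 < χ') {i j : ι}
    (hij : i < j) {d d' : Ω → Vec n} (hd : LightError μ 𝓕 χ i d) (hd' : LightError μ 𝓕 χ' j d')
    (hdm' : Measurable d') :
    ∫⁻ ω, ENNReal.ofReal (Real.exp (‖d ω + d' ω‖ ^ 2 / (χ ^ 2 + χ' ^ 2))) ∂μ ≤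
      ENNReal.ofReal (Real.exp 2) := by
  have hdj := hd.known_later j hij
  have hG : Measurable[𝓕 j] fun ω => ENNReal.ofReal (Real.exp (‖d ω‖ ^ 2 / χ ^ 2)) :=
    (ENNReal.continuous_ofReal.comp (Real.continuous_exp.comp
      ((continuous_norm.pow 2).div_const (χ ^ 2)))).measurable.comp hdj
  calc ∫⁻ ω, ENNReal.ofReal (Real.exp (‖d ω + d' ω‖ ^ 2 / (χ ^ 2 + χ' ^ 2))) ∂μ
      ≤ ∫⁻ ω, ENNReal.ofReal (Real.exp (‖d ω‖ ^ 2 / χ ^ 2)) *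
          ENNReal.ofReal (Real.exp (‖d' ω‖ ^ 2 / χ' ^ 2)) ∂μ := by
        refine lintegral_mono fun ω => ?_
        rw [← ENNReal.ofReal_mul (Real.exp_pos _).le, ← Real.exp_add]
        refine ENNReal.ofReal_le_ofReal (Real.exp_le_exp.2 (le_trans ?_ (add_sq_div_le hχ hχ')))
        gcongr
        exact norm_add_le _ _
    _ ≤ ENNReal.ofReal (Real.exp 1) * ENNReal.ofReal (Real.exp 1) :=
        (hd'.lintegral_mul_exp_sq_le hdm' hG).trans
          (by gcongr; exact hd.lintegral_exp_sq_le (hdj.mono (𝓕.le j) le_rfl))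
    _ = ENNReal.ofReal (Real.exp 2) := by
        rw [← ENNReal.ofReal_mul (Real.exp_pos _).le, ← Real.exp_add]
        norm_num

end Squares

/-! ### The gap of runs with light-tailed oracles -/

/-- A martingale formed by light-tailed errors and bounded adapted directions. -/
theorem measure_lt_sum_inner_le {Ω : Type*} {mΩ : MeasurableSpace Ω} {μ : Measure Ω}
    [IsProbabilityMeasure μ] {ι : Type*} [Preorder ι] {𝓕 : Filtration ι mΩ} {n : ℕ} {χ : ℝ}
    (hχ : 0 < χ) {idx : ℕ → ι} (hidx : ∀ i j, i < j → idx i < idx j) {d Z : ℕ → Ω → Vec n}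
    (hd : ∀ i, 1 ≤ i → LightError μ 𝓕 χ (idx i) (d i))
    (hZ : ∀ i, 1 ≤ i → Measurable[𝓕 (idx i)] (Z i)) {D : ℝ} (hD : 0 < D)
    (hZD : ∀ i, 1 ≤ i → ∀ᵐ ω ∂μ, ‖Z i ω‖ ≤ D) {γ : ℕ → ℝ} (hγ : ∀ i, 1 ≤ i → 0 < γ i) {k : ℕ}
    (hk : 1 ≤ k) {lam : ℝ} (hlam : 0 < lam) :
    μ {ω | lam * (D * χ * √(∑ i ∈ Finset.Icc 1 k, γ i ^ 2)) <
      ∑ i ∈ Finset.Icc 1 k, γ i * ⟪Z i ω, d i ω⟫_ℝ} ≤ ENNReal.ofReal (Real.exp (-lam ^ 2 / 3)) := by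
  have hsum : ∑ i ∈ Finset.Icc 1 k, (γ i * D) ^ 2 * χ ^ 2 =
      (D * χ) ^ 2 * ∑ i ∈ Finset.Icc 1 k, γ i ^ 2 := by
    rw [Finset.mul_sum]
    exact Finset.sum_congr rfl fun i _ => by ring
  have hpos : 0 < ∑ i ∈ Finset.Icc 1 k, γ i ^ 2 :=
    Finset.sum_pos (fun i hi => pow_pos (hγ i (Finset.mem_Icc.1 hi).1) 2) ⟨1, by simp [hk]⟩
  have hdm : ∀ i, 1 ≤ i → Measurable (d i) := fun i hi =>
    ((hd i hi).known_later _ (hidx i (i + 1) (by omega))).mono (𝓕.le _) le_rfl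
  have := measure_lt_sum_le (μ := μ) (𝓖 := fun i => 𝓕 (idx i)) (fun i => 𝓕.le _)
    (ξ := fun i ω => γ i * ⟪Z i ω, d i ω⟫_ℝ) (v := fun i => (γ i * D) ^ 2 * χ ^ 2) ?_ ?_
    (k := k) (by rw [hsum]; positivity) hlam
  · rwa [hsum, Real.sqrt_mul (by positivity), Real.sqrt_sq (by positivity)] at this
  · intro i j hj hji
    exact (((hZ j hj).mono (𝓕.mono (hidx j i hji).le) le_rfl).inner
      ((hd j hj).known_later _ (hidx j i hji))).const_mul _
  · intro i hi c G hG
    have := (hd i hi).lintegral_mul_exp_inner_le (hdm i hi) hχ ((hZ i hi).const_smul (γ i))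
      (D := γ i * D) (by
        filter_upwards [hZD i hi] with ω hω
        rw [Pi.smul_apply, norm_smul, Real.norm_of_nonneg (hγ i hi).le]
        exact mul_le_mul_of_nonneg_left hω (hγ i hi).le) c hG
    simpa only [Pi.smul_apply, real_inner_smul_left] using this

namespace SimpleRun

variable {Ω : Type*} {mΩ : MeasurableSpace Ω} {μ : Measure Ω} [IsProbabilityMeasure μ] {p l : ℕ}
  {f : Vec p → ℝ} {h : Vec l → EReal} {K : Vec p →L[ℝ] Vec l} {b : ℝ} {ρ θ τ σ : ℕ → ℝ}
  {Z : Iterates Ω p l} {𝓕 : Filtration (ℕ ×ₗ Fin 3) mΩ} {χf χK χy : ℝ} {O : SimpleAnswers Ω p l}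

/-- Outside four exceptional events, three for martingales and one for the squared errors, the gap
obeys the bound pathwise and for all `(x, y)` at once. -/
theorem measure_lt_dualityGap_le (hR : SimpleRun μ 𝓕 f h K b ρ θ τ σ χf χK χy Z O)
    (hχf : 0 < χf) (hχK : 0 < χK) (hχy : 0 < χy)
    (hc : ConvexOn ℝ Set.univ f) (hf : Differentiable ℝ f) {L : ℝ≥0}
    (hL : LipschitzWith L (gradient f)) (hh : ClosedProperConvex h)
    {X : Set (Vec p)} {Y : Set (Vec l)} {ΩX ΩY : ℝ} (hΩX : 0 < ΩX) (hΩY : 0 < ΩY)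
    (hX : ∀ x ∈ X, ∀ x' ∈ X, ‖x - x'‖ ^ 2 ≤ 2 * ΩX ^ 2)
    (hY : ∀ y ∈ Y, ∀ y' ∈ Y, ‖y - y'‖ ^ 2 ≤ 2 * ΩY ^ 2)
    (hS : StepSizes ρ θ τ σ) {q r s t : ℝ} (hq : q ∈ Set.Ioo 0 1)
    (hr : r ∈ Set.Ioo 0 1) (hs : s ∈ Set.Ioo 0 1) (ht : t ∈ Set.Ioo 0 1)
    (hC : Coupling K (-K) (b • K) L q r s t ρ τ σ) (hZ : Z.StaysIn μ X Y) {k : ℕ} (hk : 1 ≤ k)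
    {lam : ℝ} (hlam : 0 < lam) :
    μ {ω | ((Q0' ρ θ τ σ ΩX ΩY s t χf χK χy k + lam * Q1 ρ θ τ σ ΩX ΩY s t χf χK χy k : ℝ) :
        EReal) < dualityGap f h K X Y (Z.x (k + 1) ω) (Z.y (k + 1) ω)} ≤
      ENNReal.ofReal (3 * Real.exp (-lam ^ 2 / 3) + 3 * Real.exp (-lam)) := by
  obtain ⟨dF, dKy, dKx, hE, hN⟩ := hR.exists_errors hh hS hL.continuous
  have hmono : ∀ k, 1 ≤ k → 𝓕 (toLex (k, 0)) ≤ 𝓕 (toLex (k + 1, 0)) :=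
    fun k _ => 𝓕.mono (toLex_lt_succ k 0 0).le
  have hidx : ∀ (a : Fin 3) (i j : ℕ), i < j →
      (toLex (i, a) : ℕ ×ₗ Fin 3) < toLex (j, a) := fun a i j hij =>
    Prod.Lex.toLex_lt_toLex.2 (Or.inl hij)
  have up : ∀ {n i : ℕ} {a : Ω → Vec n} (j : Fin 3), Measurable[𝓕 (toLex (i, 0))] a →
      Measurable[𝓕 (toLex (i, j))] a := fun {n i a} j ha =>
    ha.mono (𝓕.mono (Prod.Lex.toLex_mono (Prod.mk_le_mk.2 ⟨le_rfl, Fin.zero_le j⟩))) le_rfl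
  have hx : ∀ k, 1 ≤ k → Measurable[𝓕 (toLex (k, 0))] (Z.xt k) :=
    fun k hk => (hR.measurable_tilde hh hS hk).1
  have hy : ∀ k, 1 ≤ k → Measurable[𝓕 (toLex (k, 0))] (Z.yt k) :=
    fun k hk => (hR.measurable_tilde hh hS hk).2
  have hFm : ∀ i, 1 ≤ i → Measurable[𝓕 (toLex (i + 1, 0))] (dF i) := fun i hi =>
    (hE i hi).1.known_later _ (toLex_lt_succ i _ _)
  have hKxm : ∀ i, 1 ≤ i → Measurable[𝓕 (toLex (i + 1, 0))] (dKx i) := fun i hi =>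
    (hE i hi).2.1.known_later _ (toLex_lt_succ i _ _)
  have hKym : ∀ i, 1 ≤ i → Measurable[𝓕 (toLex (i + 1, 0))] (dKy i) := fun i hi =>
    (hE i hi).2.2.known_later _ (toLex_lt_succ i _ _)
  have hγ : ∀ i, 1 ≤ i → 0 < gam θ i := fun i hi => hS.gam_pos hi
  obtain ⟨ω₀, hω₀⟩ := hZ.exists
  -- Writing `x - x̃^i = (x - xv_i) + (xv_i - x̃^i)` separates a part bounded pathwise for all `x`
  -- from a martingale with bounded directions.
  obtain ⟨xv, hxvm, hxvb, hxv⟩ := exists_reference (𝓖 := fun k => 𝓕 (toLex (k, 0))) hmono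
    ⟨_, (hω₀ 1 le_rfl).1⟩ hΩX.le hX hγ hS.tau_pos (fun i hi => hS.gam_div_tau_le hi)
    (δ := fun i ω => dF i ω + dKy i ω) (fun i hi => (hFm i hi).add (hKym i hi))
  obtain ⟨yv, hyvm, hyvb, hyv⟩ := exists_reference (𝓖 := fun k => 𝓕 (toLex (k, 0))) hmono
    ⟨_, (hω₀ 1 le_rfl).2⟩ hΩY.le hY hγ hS.sigma_pos (fun i hi => hS.gam_div_sigma_le hi)
    (δ := fun i ω => -dKx i ω) (fun i hi => (hKxm i hi).neg)
  have hxD : ∀ i, 1 ≤ i → ∀ᵐ ω ∂μ, ‖xv i ω - Z.xt i ω‖ ≤ √2 * ΩX := fun i hi => by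
    filter_upwards [hZ] with ω hω
    exact hxvb i hi ω _ (hω i hi).1
  have hyD : ∀ i, 1 ≤ i → ∀ᵐ ω ∂μ, ‖Z.yt i ω - yv i ω‖ ≤ √2 * ΩY := fun i hi => by
    filter_upwards [hZ] with ω hω
    rw [norm_sub_rev]
    exact hyvb i hi ω _ (hω i hi).2
  have mF := measure_lt_sum_inner_le hχf (hidx 0) (fun i hi => (hE i hi).1)
    (fun i hi => (hxvm i hi).sub (hx i hi)) (by positivity) hxD hγ hk hlam
  have mKy := measure_lt_sum_inner_le hχK (hidx 2) (fun i hi => (hE i hi).2.2)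
    (fun i hi => up 2 ((hxvm i hi).sub (hx i hi))) (by positivity) hxD hγ hk hlam
  have mKx := measure_lt_sum_inner_le hχy (hidx 1) (fun i hi => (hE i hi).2.1)
    (fun i hi => up 1 ((hy i hi).sub (hyvm i hi))) (by positivity) hyD hγ hk hlam
  have hchi : chiX χf χK ^ 2 = χf ^ 2 + χK ^ 2 := Real.sq_sqrt (by positivity)
  have hchi0 : 0 < chiX χf χK := Real.sqrt_pos.2 (by positivity)
  have hs' : 0 < 1 - s := sub_pos.2 hs.2
  have ht' : 0 < 1 - t := sub_pos.2 ht.2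
  set wx : ℕ → ℝ := fun i => (2 - s) * τ i * gam θ i / (1 - s) * chiX χf χK ^ 2 with hwx
  set wy : ℕ → ℝ := fun i => (2 - t) * σ i * gam θ i / (1 - t) * χy ^ 2 with hwy
  have hwx0 : ∀ i, 1 ≤ i → 0 < wx i := fun i hi => by
    have := hγ i hi
    have := hS.tau_pos i hi
    have : 0 < 2 - s := by linarith
    positivity
  have hwy0 : ∀ i, 1 ≤ i → 0 < wy i := fun i hi => by
    have := hγ i hi
    have := hS.sigma_pos i hi
    have : 0 < 2 - t := by linarith
    positivity
  have hdm : ∀ {n i : ℕ} {a : Ω → Vec n}, Measurable[𝓕 (toLex (i + 1, 0))] a → Measurable a :=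
    fun ha => ha.mono (𝓕.le _) le_rfl
  -- Primal and dual squares form one weighted family, so they cost one exceptional event. In the
  -- level `1 + lam`, the 1 belongs to `Q0'` and `lam` to `Q1`.
  have mS := measure_lt_weighted_sum_le (μ := μ)
    (s := (Finset.Icc 1 k).disjSum (Finset.Icc 1 k)) (w := Sum.elim wx wy)
    (U := Sum.elim (fun i ω => ‖dF i ω + dKy i ω‖ ^ 2 / chiX χf χK ^ 2)
      (fun i ω => ‖dKx i ω‖ ^ 2 / χy ^ 2)) (C := ENNReal.ofReal (Real.exp 2)) ?_ ?_ ?_ ?_ (1 + lam)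
  rotate_left
  · rintro (i | i) hi
    · exact (hwx0 i (Finset.mem_Icc.1 (Finset.inl_mem_disjSum.1 hi)).1).le
    · exact (hwy0 i (Finset.mem_Icc.1 (Finset.inr_mem_disjSum.1 hi)).1).le
  · refine Finset.sum_pos ?_ ⟨Sum.inl 1, by simp [hk]⟩
    rintro (i | i) hi
    · exact hwx0 i (Finset.mem_Icc.1 (Finset.inl_mem_disjSum.1 hi)).1
    · exact hwy0 i (Finset.mem_Icc.1 (Finset.inr_mem_disjSum.1 hi)).1
  · rintro (i | i) hi
    · have hi' := (Finset.mem_Icc.1 (Finset.inl_mem_disjSum.1 hi)).1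
      exact (((hdm (hFm i hi')).add (hdm (hKym i hi'))).norm.pow_const 2).div_const _
    · have hi' := (Finset.mem_Icc.1 (Finset.inr_mem_disjSum.1 hi)).1
      exact ((hdm (hKxm i hi')).norm.pow_const 2).div_const _
  · rintro (i | i) hi
    · have hi' := (Finset.mem_Icc.1 (Finset.inl_mem_disjSum.1 hi)).1
      simp only [Sum.elim_inl, hchi]
      exact (hE i hi').1.lintegral_exp_sq_add_le hχf hχK (toLex_lt_same i (by decide))
        (hE i hi').2.2 (hdm (hKym i hi'))
    · have hi' := (Finset.mem_Icc.1 (Finset.inr_mem_disjSum.1 hi)).1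
      exact ((hE i hi').2.1.lintegral_exp_sq_le (hdm (hKxm i hi'))).trans
        (ENNReal.ofReal_le_ofReal (Real.exp_le_exp.2 one_le_two))
  simp only [Finset.sum_disjSum, Sum.elim_inl, Sum.elim_inr] at mS
  have mS' : ENNReal.ofReal (Real.exp 2) * ENNReal.ofReal (Real.exp (-(1 + lam))) ≤
      ENNReal.ofReal (3 * Real.exp (-lam)) := by
    rw [← ENNReal.ofReal_mul (Real.exp_pos _).le, ← Real.exp_add]
    refine ENNReal.ofReal_le_ofReal ?_
    have h1 : Real.exp (2 + -(1 + lam)) = Real.exp 1 * Real.exp (-lam) := by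
      rw [← Real.exp_add]; ring_nf
    rw [h1]
    exact mul_le_mul_of_nonneg_right (Real.exp_one_lt_d9.le.trans (by norm_num))
      (Real.exp_pos _).le
  refine (measure_mono_ae (t := ((_ ∪ _) ∪ _) ∪ _) ?_).trans
    ((measure_union_le _ _).trans ((add_le_add ((measure_union_le _ _).trans
      (add_le_add ((measure_union_le _ _).trans (add_le_add mF mKy)) mKx)) (mS.trans mS')).trans
      (le_of_eq ?_)))
  swap
  · rw [← ENNReal.ofReal_add (Real.exp_pos _).le (Real.exp_pos _).le,
      ← ENNReal.ofReal_add (by positivity) (Real.exp_pos _).le,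
      ← ENNReal.ofReal_add (by positivity) (by positivity)]
    congr 1
    ring
  filter_upwards [hZ] with ω hω
  intro hgap
  by_contra hnot
  change ¬((( _ ∨ _) ∨ _) ∨ _) at hnot
  simp only [not_or] at hnot
  obtain ⟨⟨⟨nF, nKy⟩, nKx⟩, nS⟩ := hnot
  simp only [Set.mem_ofPred_eq, not_lt, Pi.sub_apply] at nF nKy nKx nS
  refine (show _ < _ from hgap).not_ge
    (dualityGap_le hh ((hN ω).conjugate_ys_ne_top hh hS hk) fun x hx y hy hyt => ?_)
  have hmain := (hN ω).gapAt_le hh hS hc hf hL hC hq hr ht hyt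
    (fun k hk => hX x hx _ (hω k hk).1) (fun k hk => hY y hy _ (hω k hk).2) hk
  have hnoise : ∑ i ∈ Finset.Icc 1 k, gam θ i * noiseAt τ σ s t (fun k => Z.xt k ω)
      (fun k => Z.yt k ω) (fun k => dF k ω + dKy k ω) (fun k => dKx k ω) x y i ≤
      ∑ i ∈ Finset.Icc 1 k, (gam θ i * ⟪dF i ω + dKy i ω, x - xv i ω⟫_ℝ +
        gam θ i * ⟪-dKx i ω, y - yv i ω⟫_ℝ + gam θ i * ⟪xv i ω - Z.xt i ω, dF i ω⟫_ℝ +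
        gam θ i * ⟪xv i ω - Z.xt i ω, dKy i ω⟫_ℝ + gam θ i * ⟪Z.yt i ω - yv i ω, dKx i ω⟫_ℝ +
        1 / 2 * (wx i * (‖dF i ω + dKy i ω‖ ^ 2 / chiX χf χK ^ 2)) +
        1 / 2 * (wy i * (‖dKx i ω‖ ^ 2 / χy ^ 2)) -
        gam θ i * (τ i / 2 * ‖dF i ω + dKy i ω‖ ^ 2) -
        gam θ i * (σ i / 2 * ‖-dKx i ω‖ ^ 2)) := by
    refine Finset.sum_le_sum fun i hi => ?_
    have hi' := (Finset.mem_Icc.1 hi).1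
    -- As `K + A = 0`, the dual error has no later part: here `b = 0`.
    have h1 := mul_le_mul_of_nonneg_left (noiseAt_le (s := s) (t := t) (xt := fun k => Z.xt k ω)
      (yt := fun k => Z.yt k ω) (δx := fun k => dF k ω + dKy k ω) (δy := fun k => dKx k ω)
      (hS.tau_pos i hi') (hS.sigma_pos i hi') hs.2 ht.2 (add_zero _).symm x y) (hγ i hi').le
    refine h1.trans (le_of_eq ?_)
    have e1 : 1 / 2 * (wx i * (‖dF i ω + dKy i ω‖ ^ 2 / chiX χf χK ^ 2)) =
        gam θ i * (τ i / (2 * (1 - s)) * ‖dF i ω + dKy i ω‖ ^ 2) +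
          gam θ i * (τ i / 2 * ‖dF i ω + dKy i ω‖ ^ 2) := by
      rw [hwx]
      field_simp
      ring
    have e2 : 1 / 2 * (wy i * (‖dKx i ω‖ ^ 2 / χy ^ 2)) =
        gam θ i * (σ i / (2 * (1 - t)) * ‖dKx i ω‖ ^ 2) +
          gam θ i * (σ i / 2 * ‖dKx i ω‖ ^ 2) := by
      rw [hwy]
      field_simp
      ring
    rw [e1, e2, norm_neg]
    simp only [inner_sub_left, inner_sub_right, inner_add_left, inner_add_right, inner_neg_left,
      inner_zero_right, real_inner_comm (dF i ω) (Z.xt i ω), real_inner_comm (dKy i ω) (Z.xt i ω),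
      real_inner_comm (dF i ω) (xv i ω), real_inner_comm (dKy i ω) (xv i ω),
      real_inner_comm (dKx i ω) (yv i ω), real_inner_comm (dKx i ω) (Z.yt i ω)]
    ring
  simp only [Finset.sum_add_distrib, Finset.sum_sub_distrib, ← Finset.mul_sum] at hnoise
  have hx' := hxv k hk ω x hx
  have hy' := hyv k hk ω y hy
  set Γ := √(∑ i ∈ Finset.Icc 1 k, gam θ i ^ 2) with hΓ
  set N := ∑ i ∈ Finset.Icc 1 k, wx i + ∑ i ∈ Finset.Icc 1 k, wy i with hNdef
  -- The two primal martingales combine through `χf + χK ≤ √2 χ_x`. The other `√2`, from the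
  -- diameters, becomes the 2 under the root.
  have hdev : √2 * ΩX * χf * Γ + √2 * ΩX * χK * Γ + √2 * ΩY * χy * Γ ≤
      (√2 * chiX χf χK * ΩX + χy * ΩY) * √(2 * ∑ i ∈ Finset.Icc 1 k, gam θ i ^ 2) := by
    have h1 : χf + χK ≤ √2 * chiX χf χK := by
      refine le_of_sq_le_sq ?_ (by positivity)
      rw [mul_pow, Real.sq_sqrt zero_le_two, hchi]
      nlinarith [sq_nonneg (χf - χK)]
    rw [Real.sqrt_mul zero_le_two, ← hΓ]
    have h2 : 0 ≤ √2 * Γ * ΩX := by positivity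
    nlinarith [mul_le_mul_of_nonneg_left h1 h2]
  have hρ := (hS.rho_mem hk).1
  have hγk := hγ k hk
  have hdev' := mul_le_mul_of_nonneg_left hdev hlam.le
  have htotal : gam θ k / ρ k * gapAt f h K x y (Z.x (k + 1) ω) (Z.y (k + 1) ω) ≤
      2 * gam θ k / τ k * ΩX ^ 2 + 2 * gam θ k / σ k * ΩY ^ 2 + (1 + lam) * N / 2 +
        lam * ((√2 * chiX χf χK * ΩX + χy * ΩY) *
          √(2 * ∑ i ∈ Finset.Icc 1 k, gam θ i ^ 2)) := by
    have e1 : 2 * gam θ k / τ k = 2 * (gam θ k / τ k) := by ring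
    have e2 : 2 * gam θ k / σ k = 2 * (gam θ k / σ k) := by ring
    rw [e1, e2]
    linarith
  have hfinal := mul_le_mul_of_nonneg_left htotal (div_pos hρ hγk).le
  have e3 : ρ k / gam θ k * (gam θ k / ρ k * gapAt f h K x y (Z.x (k + 1) ω) (Z.y (k + 1) ω)) =
      gapAt f h K x y (Z.x (k + 1) ω) (Z.y (k + 1) ω) := by
    field_simp
  have e4 : noiseTerm ρ θ τ σ s t (chiX χf χK ^ 2) (χy ^ 2) k = ρ k / gam θ k * (N / 2) := by
    rw [noiseTerm, Finset.sum_add_distrib, hNdef]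
    ring
  rw [e3] at hfinal
  refine hfinal.trans (le_of_eq ?_)
  rw [Q0', Q1, e4, diamTerm]
  ring

end SimpleRun

end

end StocPD

theorem mainTheorem10 {p l : ℕ}
    (f : Vec p → ℝ) (hf_convex : ConvexOn ℝ Set.univ f) (hf_diff : Differentiable ℝ f)
    (Lf : ℝ≥0) (hf_lip : LipschitzWith Lf (gradient f))
    (h : Vec l → EReal) (hh : StocPD.ClosedProperConvex h)
    (K A B : Vec p →L[ℝ] Vec l)
    (X : Set (Vec p)) (Y : Set (Vec l)) (ΩX ΩY : ℝ) (hΩX : 0 < ΩX) (hΩY : 0 < ΩY)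
    (hX : ∀ x ∈ X, ∀ x' ∈ X, ‖x - x'‖ ^ 2 ≤ 2 * ΩX ^ 2)
    (hY : ∀ y ∈ Y, ∀ y' ∈ Y, ‖y - y'‖ ^ 2 ≤ 2 * ΩY ^ 2)
    (ρ θ τ σ : ℕ → ℝ) (hsteps : StocPD.StepSizes ρ θ τ σ)
    (q r s t : ℝ) (hq : q ∈ Set.Ioo 0 1) (hr : r ∈ Set.Ioo 0 1) (hs : s ∈ Set.Ioo 0 1)
    (ht : t ∈ Set.Ioo 0 1) (hcoupling : StocPD.Coupling K A B Lf q r s t ρ τ σ)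
    {Ω : Type*} [mΩ : MeasurableSpace Ω] (μ : Measure Ω) [IsProbabilityMeasure μ]
    (Z : StocPD.Iterates Ω p l) (hZ : Z.StaysIn μ X Y) :
    (∀ (χf χK χy χA χB : ℝ) (𝓕 : Filtration (ℕ ×ₗ Fin 7) mΩ) (O : StocPD.Answers Ω p l),
      StocPD.Run μ 𝓕 f h K A B ρ θ τ σ χf χK χy χA χB Z O →
      ∀ k, 1 ≤ k →
        (∀ᵐ ω ∂μ, StocPD.dualityGap f h K X Y (Z.x (k + 1) ω) (Z.y (k + 1) ω) ≠ ⊤ ∧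
          StocPD.dualityGap f h K X Y (Z.x (k + 1) ω) (Z.y (k + 1) ω) ≠ ⊥) ∧
        Integrable
          (fun ω => (StocPD.dualityGap f h K X Y (Z.x (k + 1) ω) (Z.y (k + 1) ω)).toReal) μ ∧
        ∫ ω, (StocPD.dualityGap f h K X Y (Z.x (k + 1) ω) (Z.y (k + 1) ω)).toReal ∂μ ≤
          StocPD.Q0 ρ θ τ σ ΩX ΩY s t χf χK χy χA χB ‖K + A‖ k) ∧
    (∀ b : ℝ, A = -K → B = b • K →
      ∀ (χf χK χy : ℝ), 0 < χf → 0 < χK → 0 < χy →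
      ∀ (𝓕 : Filtration (ℕ ×ₗ Fin 3) mΩ) (O : StocPD.SimpleAnswers Ω p l),
      StocPD.SimpleRun μ 𝓕 f h K b ρ θ τ σ χf χK χy Z O →
      ∀ k, 1 ≤ k → ∀ lam : ℝ, 0 < lam →
        μ {ω | ((StocPD.Q0' ρ θ τ σ ΩX ΩY s t χf χK χy k +
              lam * StocPD.Q1 ρ θ τ σ ΩX ΩY s t χf χK χy k : ℝ) : EReal) <
            StocPD.dualityGap f h K X Y (Z.x (k + 1) ω) (Z.y (k + 1) ω)} ≤
          ENNReal.ofReal (3 * Real.exp (-lam ^ 2 / 3) + 3 * Real.exp (-lam))) := by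
  refine ⟨fun χf χK χy χA χB 𝓕 O hR k hk =>
    hR.dualityGap_bounds hf_convex hf_diff hf_lip hh hX hY hsteps hq hr hs ht hcoupling hZ hk, ?_⟩
  rintro b rfl rfl χf χK χy hχf hχK hχy 𝓕 O hR k hk lam hlam
  exact hR.measure_lt_dualityGap_le hχf hχK hχy hf_convex hf_diff hf_lip hh hΩX hΩY hX hY hsteps
    hq hr hs ht hcoupling hZ hk hlam
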